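/- Let $\mathrm{Diff}_1(\mathbb{C}^2,0)$ be the group, under composition, of germs at the origin of holomorphic diffeomorphisms $F$ of $(\mathbb{C}^2,0)$ (so $F(0)=0$) that are tangent to the identity, i.e. $D_0F=\mathrm{id}$. For a finite set $S\subset \mathrm{Diff}_1(\mathbb{C}^2,0)$ define sets $S(j)$, $j\ge 0$, as follows: $S(0)=S$; $S(1)$ is the set of all commutators $[F_1^{\pm1},F_2^{\pm1}]$ (with all choices of signs) where $F_1,F_2\in S(0)$; and, for $j\ge 1$, $S(j+1)$ is the set of all commutators $[F_1^{\pm1},F_2^{\pm1}]$ where $F_1\in S(j)$ and $F_2\in S(j)\cup S(j-1)$. Here $[a,b]=aba^{-1}b^{-1}$. A subgroup $G\subset \mathrm{Diff}_1(\mathbb{C}^2,0)$ is called pseudo-solvable if it is generated by some finite set $S$ such that $S(j)\subseteq\{\mathrm{id}\}$ for all sufficiently large $j$. **Proposition.** Every pseudo-solvable subgroup $G$ of $\mathrm{Diff}_1(\mathbb{C}^2,0)$ is solvable. -/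

import Mathlib

/-- The monoid, under composition, of maps `ℂ² → ℂ²` that are holomorphic (analytic) at the origin
and fix the origin. Only their germs at the origin matter, see `germCon`. -/
def HolMap : Submonoid (Function.End (ℂ × ℂ)) where
  carrier := {f | AnalyticAt ℂ (f : ℂ × ℂ → ℂ × ℂ) 0 ∧ f 0 = 0}
  one_mem' := ⟨analyticAt_id, rfl⟩
  mul_mem' := by
    rintro f g ⟨hf, hf0⟩ ⟨hg, hg0⟩
    refine ⟨?_, ?_⟩
    · exact AnalyticAt.comp (g := f) (f := g) (by rw [hg0]; exact hf) hg
    · change f (g 0) = 0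
      rw [hg0, hf0]

/-- Two maps are identified when they agree on a neighbourhood of the origin; this relation is
compatible with composition. -/
def germCon : Con HolMap where
  r f g := Filter.EventuallyEq (nhds (0 : ℂ × ℂ)) f.1 g.1
  iseqv := ⟨fun _ => Filter.EventuallyEq.refl _ _, fun h => h.symm, fun h k => h.trans k⟩
  mul' := by
    intro f f' g g' hf hg
    have ht : Filter.Tendsto (g.1 : ℂ × ℂ → ℂ × ℂ) (nhds 0) (nhds 0) := by
      have h := g.2.1.continuousAt.tendsto
      rwa [g.2.2] at h
    filter_upwards [ht.eventually hf, hg] with z hz1 hz2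
    change f.1 (g.1 z) = f'.1 (g'.1 z)
    rw [hz1, hz2]

/-- The monoid, under composition, of germs at the origin of holomorphic maps `(ℂ², 0) → (ℂ², 0)`. -/
abbrev HolGerm : Type := germCon.Quotient

/-- `Diff(ℂ², 0)`: the group of germs of holomorphic diffeomorphisms of `(ℂ², 0)`, that is, of the
holomorphic germs fixing the origin that have a holomorphic inverse germ. -/
abbrev DiffGerm : Type := HolGermˣ

/-- The derivative at the origin of a holomorphic germ; by the chain rule it is multiplicative. -/
noncomputable def HolGerm.linearPart : HolGerm →* (ℂ × ℂ →L[ℂ] ℂ × ℂ) :=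
  germCon.lift
    { toFun := fun f => fderiv ℂ (f.1 : ℂ × ℂ → ℂ × ℂ) 0
      map_one' := fderiv_id
      map_mul' := by
        intro f g
        have hf : DifferentiableAt ℂ (f.1 : ℂ × ℂ → ℂ × ℂ) (g.1 0) := by
          rw [g.2.2]; exact f.2.1.differentiableAt
        have h := fderiv_comp (0 : ℂ × ℂ) hf g.2.1.differentiableAt
        rw [g.2.2] at h
        exact h }
    (fun _ _ h => Filter.EventuallyEq.fderiv_eq h)

/-- `Diff₁(ℂ², 0)`: the (normal) subgroup of `Diff(ℂ², 0)` of germs tangent to the identity, that is,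
whose derivative at the origin is the identity. -/
noncomputable def tangentToIdentity : Subgroup DiffGerm :=
  (Units.map HolGerm.linearPart).ker

/-- The set of all commutators `[F₁^{±1}, F₂^{±1}]` (independent signs) with `F₁ ∈ A`, `F₂ ∈ B`,
where `[a, b] = a b a⁻¹ b⁻¹`. -/
def signedCommutators {Γ : Type*} [Group Γ] (A B : Set Γ) : Set Γ :=
  {c | ∃ F₁ ∈ A, ∃ F₂ ∈ B, ∃ a b : Γ, (a = F₁ ∨ a = F₁⁻¹) ∧ (b = F₂ ∨ b = F₂⁻¹) ∧
    c = a * b * a⁻¹ * b⁻¹}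

/-- Ghys's sequence of sets `S(j)`: `S(0) = S`, and `S(j+1)` is the set of commutators
`[F₁^{±1}, F₂^{±1}]` with `F₁ ∈ S(j)` and `F₂ ∈ S(j) ∪ S(j-1)` (`F₂ ∈ S(0)` if `j = 0`). -/
def ghysSeq {Γ : Type*} [Group Γ] (S : Set Γ) : ℕ → Set Γ
  | 0 => S
  | 1 => signedCommutators S S
  | j + 2 => signedCommutators (ghysSeq S (j + 1)) (ghysSeq S (j + 1) ∪ ghysSeq S j)

/-- A subgroup `G` is pseudo-solvable if it is generated by some finite set `S` for which the sets
`S(j)` are reduced to the identity for all large `j`. -/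
def IsPseudoSolvable {Γ : Type*} [Group Γ] (G : Subgroup Γ) : Prop :=
  ∃ S : Set Γ, S.Finite ∧ Subgroup.closure S = G ∧ ∃ N : ℕ, ∀ j ≥ N, ghysSeq S j ⊆ {1}

open scoped commutatorElement


/-! Germs tangent to the identity act faithfully on the fraction field `K` of formal power series in
two variables, filtered by order of vanishing. Each germ `g` acts unipotently, so it is the
exponential of a derivation `log g`, and commutation of germs becomes commutation of derivations.
Two features of `K` carry the proof. The derivations that raise the filtration span a `K`-space of
dimension at most two, and an element killed by two independent ones is a complex constant.
Moreover, by unipotence, a derivation can only be multiplied by the complex number `1` under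
conjugation.

Let `T = fixer φ` for a nonconstant `φ`. All logarithms of elements of `T` are proportional over
`K`, so commuting is transitive on nontrivial elements of `T`, and two such groups coincide or meet
trivially. On the constants of these logarithms one dimension is left, so centralizers of nontrivial
elements in the normalizer of `T` modulo `T` are abelian too. Inside `T`, the normalizer of a
centralizer is metabelian. Consequently the derived group of a nonabelian solvable group lies in
some `fixer φ` (`exists_commutator_le_fixer`): otherwise its last nontrivial derived term would have
only constant invariants, which leads to a contradiction.

Pseudo-solvability is treated by descending induction on `j`, showing that the group generated by
`S(j+1) ∪ S(j)` is solvable. Put `B = S(j)`, let `A` be generated by `S(j+1)` and let `H` be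
generated by `S(j+2) ∪ S(j+1)`, solvable by induction. Since `b a b⁻¹ = a [a⁻¹, b]`, the set `B`
conjugates `A` into `H`; this and `[B, B] ⊆ A` are the main content of `IsCommutatorTower`.
Solvability of the group generated by `A ∪ B` (`isSolvable_closure_of_tower`) is proved separately
for `A` abelian with proportional logarithms, `A` abelian with two independent logarithms, and `A`
nonabelian. In each case one finds a group `Z`, close to abelian, that contains `A` and is
normalized by `B`.

The rest realizes the axioms of `LogAction`: logarithms of power series, extended to fractions by
the quotient rule, and Taylor series of germs treated as asymptotic expansions. -/

/-! ### Integer-valued polynomials and the axioms of the action -/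

open Polynomial in
/-- The polynomial `T(T-1)⋯(T-k+1)/k!`, whose value at a natural number `n` is `n.choose k`. -/
noncomputable def choosePoly (k : ℕ) : ℂ[X] := C ((k.factorial : ℂ)⁻¹) * descPochhammer ℂ k

theorem choosePoly_eval_natCast (k n : ℕ) : (choosePoly k).eval (n : ℂ) = n.choose k := by
  rw [choosePoly, Polynomial.eval_mul, Polynomial.eval_C, descPochhammer_eval_eq_descFactorial,
    Nat.choose_eq_descFactorial_div_factorial, Nat.cast_div (Nat.factorial_dvd_descFactorial n k)
    (by exact_mod_cast Nat.factorial_ne_zero k)]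
  field_simp

/-- A polynomial taking values in a subspace at all natural numbers has all its coefficients there. -/
theorem Polynomial.coeff_mem_of_forall_eval_natCast_mem {K : Type*} [Field K] [Algebra ℂ K]
    (V : Submodule ℂ K) (Q : Polynomial K) (h : ∀ n : ℕ, Q.eval (n : K) ∈ V) (i : ℕ) :
    Q.coeff i ∈ V := by
  by_contra hi
  -- A linear form that kills `V` but not the coefficient turns `Q` into a complex polynomial
  -- vanishing at every natural number, hence zero.
  obtain ⟨l, hl, hV⟩ := Submodule.exists_le_ker_of_notMem hi
  have h0 : (∑ j ∈ Finset.range (Q.natDegree + 1), Polynomial.C (l (Q.coeff j)) * Polynomial.X ^ j)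
      = 0 := by
    refine Polynomial.eq_zero_of_infinite_isRoot _
      (Set.Infinite.mono ?_ (Set.infinite_range_of_injective (Nat.cast_injective (R := ℂ))))
    rintro _ ⟨n, rfl⟩
    have hn := hV (h n)
    rw [LinearMap.mem_ker, Polynomial.eval_eq_sum_range, map_sum] at hn
    simp only [Set.mem_ofPred_eq, Polynomial.IsRoot.def, Polynomial.eval_finsetSum,
      Polynomial.eval_mul, Polynomial.eval_C, Polynomial.eval_pow, Polynomial.eval_X]
    rw [← hn]
    refine Finset.sum_congr rfl fun j _ => ?_
    have : Q.coeff j * (n : K) ^ j = ((n : ℂ) ^ j) • Q.coeff j := by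
      rw [Algebra.smul_def, mul_comm]; simp
    rw [this, map_smul, smul_eq_mul, mul_comm]
  have h1 := congrArg (fun p => Polynomial.coeff p i) h0
  simp only [Polynomial.finsetSum_coeff, Polynomial.coeff_C_mul, Polynomial.coeff_X_pow,
    Polynomial.coeff_zero] at h1
  by_cases hd : i < Q.natDegree + 1
  · rw [Finset.sum_eq_single i] at h1
    · simp at h1; exact hl h1
    · intro b _ hb; simp [Ne.symm hb]
    · intro hn; exact absurd (Finset.mem_range.mpr hd) hn
  · rw [Polynomial.coeff_eq_zero_of_natDegree_lt (by omega)] at hl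
    simp at hl

/-- The first `N` terms of the series `log g = (g - 1) - (g - 1)² / 2 + ⋯` applied to `f`. -/
noncomputable def logSum {K : Type*} [Field K] [Algebra ℂ K] (g : K ≃ₐ[ℂ] K) (N : ℕ) (f : K) : K :=
  ∑ k ∈ Finset.range N, (choosePoly k).coeff 1 • ((g.toLinearMap - 1 : Module.End ℂ K) ^ k) f

/-- A faithful action of a group by unipotent automorphisms of a filtered field. -/
structure UnipotentAction (Γ K : Type*) [Group Γ] [Field K] [Algebra ℂ K] where
  /-- the action -/
  act : Γ →* (K ≃ₐ[ℂ] K)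
  injective : Function.Injective act
  /-- the filtration by order of vanishing -/
  F : ℤ → Submodule ℂ K
  anti : Antitone F
  exhaustive : ∀ f, ∃ n, f ∈ F n
  separated : ∀ f, (∀ n, f ∈ F n) → f = 0
  mul_mem_F : ∀ {m n f h}, f ∈ F m → h ∈ F n → f * h ∈ F (m + n)
  act_sub_mem : ∀ g {n f}, f ∈ F n → act g f - f ∈ F (n + 1)

/-- A faithful action of a group by automorphisms of a filtered field of two-dimensional type,
every element of which is unipotent with a convergent logarithm. -/
structure LogAction (Γ K : Type*) [Group Γ] [Field K] [Algebra ℂ K] extends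
    UnipotentAction Γ K where
  -- Completeness of `K` is not among the axioms (a fraction field need not be complete), so
  -- convergence of the logarithm series is one.
  exists_log : ∀ g f, ∃ x, ∀ n (N : ℕ), f ∈ F n → x - logSum (act g) N f ∈ F (n + N)
  /-- the coordinates -/
  u : K
  v : K
  /-- the partial derivatives -/
  du : K → K
  dv : K → K
  -- A raising derivation is determined by its values at `u` and `v`: this is the bound two on the
  -- rank. The maps `du`, `dv` are not required to be derivations.
  chain_rule : ∀ X : Derivation ℂ K K, (∀ n f, f ∈ F n → X f ∈ F (n + 1)) →
    ∀ f, X f = X u * du f + X v * dv f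
  const_of_partials : ∀ f, du f = 0 → dv f = 0 → f ∈ Set.range (algebraMap ℂ K)

theorem Int.exists_nat_add_ge (a m : ℤ) : ∃ N : ℕ, m ≤ a + N := ⟨(m - a).toNat, by omega⟩

/-! ### Orbits of a unipotent automorphism as polynomials in the exponent -/

namespace UnipotentAction

variable {Γ K : Type*} [Group Γ] [Field K] [Algebra ℂ K] (S : UnipotentAction Γ K)

theorem act_mem (g : Γ) {n : ℤ} {f : K} (hf : f ∈ S.F n) : S.act g f ∈ S.F n := by
  have := (S.F n).add_mem (S.anti (by omega : n ≤ n + 1) (S.act_sub_mem g hf)) hf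
  simpa using this

/-- `P` interpolates the orbit `n ↦ gⁿ f` modulo `F m`. -/
def Interpolates (g : Γ) (f : K) (m : ℤ) (P : Polynomial K) : Prop :=
  ∀ n : ℕ, S.act (g ^ n) f - P.eval (n : K) ∈ S.F m

theorem delta_pow_mem (g : Γ) {n : ℤ} {f : K} (hf : f ∈ S.F n) (k : ℕ) :
    (((S.act g).toLinearMap - 1 : Module.End ℂ K) ^ k) f ∈ S.F (n + k) := by
  induction k with
  | zero => simpa using hf
  | succ k ih =>
    rw [pow_succ', Module.End.mul_apply]
    have := S.act_sub_mem g ih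
    push_cast
    rw [← add_assoc]
    exact this

/-- Binomial theorem for `g = (g - 1) + 1`. -/
theorem act_pow_eq_sum (g : Γ) (f : K) (n : ℕ) : S.act (g ^ n) f =
    ∑ k ∈ Finset.range (n + 1),
      (n.choose k : ℂ) • (((S.act g).toLinearMap - 1 : Module.End ℂ K) ^ k) f := by
  have h1 : ∀ n : ℕ, S.act (g ^ n) f = ((S.act g).toLinearMap ^ n : Module.End ℂ K) f := by
    intro n
    induction n with
    | zero => simp
    | succ n ih =>
      rw [pow_succ', pow_succ', map_mul, AlgEquiv.mul_apply, Module.End.mul_apply, ih]; rfl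
  have h2 : ((S.act g).toLinearMap : Module.End ℂ K) = ((S.act g).toLinearMap - 1) + 1 := by abel
  rw [h1, h2, Commute.add_pow (Commute.one_right _), LinearMap.sum_apply]
  refine Finset.sum_congr rfl fun k _ => ?_
  rw [add_sub_cancel_right, one_pow, mul_one, ← nsmul_eq_mul', LinearMap.smul_apply,
    Nat.cast_smul_eq_nsmul]

/-- The interpolating polynomial of degree `< N`. -/
noncomputable def interp (g : Γ) (N : ℕ) (f : K) : Polynomial K :=
  ∑ k ∈ Finset.range N, Polynomial.C ((((S.act g).toLinearMap - 1 : Module.End ℂ K) ^ k) f) *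
    (choosePoly k).map (algebraMap ℂ K)

theorem interp_coeff_one (g : Γ) (N : ℕ) (f : K) :
    (S.interp g N f).coeff 1 = logSum (S.act g) N f := by
  simp only [interp, logSum, Polynomial.finsetSum_coeff, Polynomial.coeff_C_mul,
    Polynomial.coeff_map, Algebra.smul_def]
  exact Finset.sum_congr rfl fun k _ => mul_comm _ _

theorem interp_eval (g : Γ) (N : ℕ) (f : K) (n : ℕ) : (S.interp g N f).eval (n : K) =
    ∑ k ∈ Finset.range N,
      (n.choose k : ℂ) • (((S.act g).toLinearMap - 1 : Module.End ℂ K) ^ k) f := by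
  simp only [interp, Polynomial.eval_finsetSum, Polynomial.eval_mul, Polynomial.eval_C]
  refine Finset.sum_congr rfl fun k _ => ?_
  have : (n : K) = algebraMap ℂ K n := by simp
  rw [this, Polynomial.eval_map_apply, choosePoly_eval_natCast, Algebra.smul_def, mul_comm]

theorem interpolates_interp (g : Γ) {a : ℤ} {f : K} (hf : f ∈ S.F a) (N : ℕ) :
    S.Interpolates g f (a + N) (S.interp g N f) := by
  intro n
  rw [act_pow_eq_sum, interp_eval]
  -- Terms with `k ≥ N` are negligible because `(g - 1)^k` raises the filtration by `k`; when `N > n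
  -- + 1` the surplus terms have a zero binomial coefficient.
  have h : ∀ M : ℕ, N ≤ M → ∑ k ∈ Finset.range M, (n.choose k : ℂ) •
      (((S.act g).toLinearMap - 1 : Module.End ℂ K) ^ k) f - ∑ k ∈ Finset.range N,
      (n.choose k : ℂ) • (((S.act g).toLinearMap - 1 : Module.End ℂ K) ^ k) f ∈ S.F (a + N) := by
    intro M hM
    rw [← Finset.sum_sdiff (Finset.range_mono hM), add_sub_cancel_right]
    refine Submodule.sum_mem _ fun k hk => Submodule.smul_mem _ _ ?_
    have hk' : N ≤ k := by simpa using (Finset.mem_sdiff.mp hk).2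
    exact S.anti (by omega) (S.delta_pow_mem g hf k)
  rcases le_total N (n + 1) with hN | hN
  · exact h _ hN
  · have : ∑ k ∈ Finset.range N, (n.choose k : ℂ) •
      (((S.act g).toLinearMap - 1 : Module.End ℂ K) ^ k) f = ∑ k ∈ Finset.range (n + 1),
      (n.choose k : ℂ) • (((S.act g).toLinearMap - 1 : Module.End ℂ K) ^ k) f := by
      refine (Finset.sum_subset (Finset.range_mono hN) fun k _ hk => ?_).symm
      rw [Nat.choose_eq_zero_of_lt (by simpa using hk)]; simp
    rw [this, sub_self]; exact Submodule.zero_mem _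

theorem exists_interpolates (g : Γ) (f : K) (m : ℤ) : ∃ P, S.Interpolates g f m P := by
  obtain ⟨a, ha⟩ := S.exhaustive f
  obtain ⟨N, hN⟩ := Int.exists_nat_add_ge a m
  exact ⟨_, fun n => S.anti hN (S.interpolates_interp g ha N n)⟩

theorem eq_of_forall_sub_mem {x y : K} (h : ∀ m, x - y ∈ S.F m) : x = y :=
  sub_eq_zero.mp (S.separated _ h)

theorem Interpolates.coeff_zero_sub_mem {S : UnipotentAction Γ K} {g : Γ} {f : K} {m : ℤ}
    {P : Polynomial K} (h : S.Interpolates g f m P) : f - P.coeff 0 ∈ S.F m := by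
  simpa [Polynomial.coeff_zero_eq_eval_zero] using h 0

/-- Uniqueness of interpolation modulo `F m`, coefficient by coefficient. Identities between
logarithms thereby reduce to identities between coefficients of polynomials. -/
theorem Interpolates.coeff_sub_coeff_mem {S : UnipotentAction Γ K} {g : Γ} {f : K} {m : ℤ}
    {P Q : Polynomial K} (hP : S.Interpolates g f m P) (hQ : S.Interpolates g f m Q) (i : ℕ) :
    P.coeff i - Q.coeff i ∈ S.F m := by
  rw [← Polynomial.coeff_sub]
  refine Polynomial.coeff_mem_of_forall_eval_natCast_mem _ _ (fun n => ?_) i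
  have := (S.F m).sub_mem (hQ n) (hP n)
  rw [Polynomial.eval_sub]
  simpa using this

/-- Here `M` is the precision of the factors and `c`, possibly negative, bounds their order from
below; the precision of the product is `M + c`. The condition `c ≤ M` keeps the approximation `x'`
in `F c`. -/
theorem mul_sub_mul_mem {x x' y y' : K} {c M m : ℤ} (hcM : c ≤ M) (hm : m ≤ M + c)
    (hx : x ∈ S.F c) (hy : y ∈ S.F c) (hxx : x - x' ∈ S.F M) (hyy : y - y' ∈ S.F M) :
    x * y - x' * y' ∈ S.F m := by
  have hx' : x' ∈ S.F c := by
    have := (S.F c).sub_mem hx (S.anti hcM hxx)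
    simpa using this
  have := (S.F m).add_mem (S.anti hm (S.mul_mem_F hxx hy))
    (S.anti (by omega : m ≤ c + M) (S.mul_mem_F hx' hyy))
  convert this using 1; ring

theorem Interpolates.mul {S : UnipotentAction Γ K} {g : Γ} {f h : K} {c M m : ℤ}
    {P Q : Polynomial K} (hP : S.Interpolates g f M P) (hQ : S.Interpolates g h M Q) (hcM : c ≤ M)
    (hm : m ≤ M + c) (hf : f ∈ S.F c) (hh : h ∈ S.F c) : S.Interpolates g (f * h) m (P * Q) :=
  fun n => by
    rw [map_mul, Polynomial.eval_mul]
    exact S.mul_sub_mul_mem hcM hm (S.act_mem _ hf) (S.act_mem _ hh) (hP n) (hQ n)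

end UnipotentAction

/-! ### Logarithms as derivations, and exponentials -/

namespace LogAction

variable {Γ K : Type*} [Group Γ] [Field K] [Algebra ℂ K] (S : LogAction Γ K)

/-- The logarithm of `g`, as a map. -/
noncomputable def logFun (g : Γ) (f : K) : K := (S.exists_log g f).choose

theorem logFun_sub_logSum_mem (g : Γ) {n : ℤ} {f : K} (N : ℕ) (hf : f ∈ S.F n) :
    S.logFun g f - logSum (S.act g) N f ∈ S.F (n + N) :=
  (S.exists_log g f).choose_spec n N hf

/-- The logarithm is the derivative at the origin of the orbit. -/
theorem _root_.UnipotentAction.Interpolates.logFun_sub_mem {S : LogAction Γ K} {g : Γ} {f : K} {m : ℤ} {P : Polynomial K}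
    (h : S.Interpolates g f m P) : S.logFun g f - P.coeff 1 ∈ S.F m := by
  obtain ⟨a, ha⟩ := S.exhaustive f
  obtain ⟨N, hN⟩ := Int.exists_nat_add_ge a m
  have h1 := UnipotentAction.Interpolates.coeff_sub_coeff_mem
    (fun n => S.anti hN (S.interpolates_interp g ha N n)) h 1
  have h2 := S.anti hN (S.logFun_sub_logSum_mem g N ha)
  rw [UnipotentAction.interp_coeff_one] at h1
  have := (S.F m).add_mem h2 h1
  simpa using this

theorem logFun_add (g : Γ) (f h : K) : S.logFun g (f + h) = S.logFun g f + S.logFun g h := by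
  refine S.eq_of_forall_sub_mem fun m => ?_
  obtain ⟨P, hP⟩ := S.exists_interpolates g f m
  obtain ⟨Q, hQ⟩ := S.exists_interpolates g h m
  have hPQ : S.Interpolates g (f + h) m (P + Q) := fun n => by
    rw [map_add, Polynomial.eval_add, add_sub_add_comm]
    exact (S.F m).add_mem (hP n) (hQ n)
  have := (S.F m).sub_mem hPQ.logFun_sub_mem ((S.F m).add_mem hP.logFun_sub_mem hQ.logFun_sub_mem)
  rw [Polynomial.coeff_add] at this
  convert this using 1; ring

theorem logFun_smul (g : Γ) (c : ℂ) (f : K) : S.logFun g (c • f) = c • S.logFun g f := by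
  refine S.eq_of_forall_sub_mem fun m => ?_
  obtain ⟨P, hP⟩ := S.exists_interpolates g f m
  have hPQ : S.Interpolates g (c • f) m (c • P) := fun n => by
    rw [map_smul, Polynomial.eval_smul, ← smul_sub]
    exact (S.F m).smul_mem c (hP n)
  have := (S.F m).sub_mem hPQ.logFun_sub_mem ((S.F m).smul_mem c hP.logFun_sub_mem)
  rw [Polynomial.coeff_smul, smul_sub] at this
  convert this using 1; ring

/-- The orbit of a product is interpolated by the product of the polynomials, and the coefficient of
degree one obeys the product rule. -/
theorem logFun_mul (g : Γ) (f h : K) :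
    S.logFun g (f * h) = f * S.logFun g h + h * S.logFun g f := by
  refine S.eq_of_forall_sub_mem fun m => ?_
  obtain ⟨a, ha⟩ := S.exhaustive f
  obtain ⟨b, hb⟩ := S.exhaustive h
  obtain ⟨a', ha'⟩ := S.exhaustive (S.logFun g f)
  obtain ⟨b', hb'⟩ := S.exhaustive (S.logFun g h)
  set c : ℤ := min (min a b) (min a' b') with hc
  have hfc : f ∈ S.F c := S.anti (by omega) ha
  have hhc : h ∈ S.F c := S.anti (by omega) hb
  have hfc' : S.logFun g f ∈ S.F c := S.anti (by omega) ha'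
  have hhc' : S.logFun g h ∈ S.F c := S.anti (by omega) hb'
  -- The least precision allowed by `mul_sub_mul_mem` for a result modulo `F m`.
  set M : ℤ := max c (m - c) with hM
  obtain ⟨P, hP⟩ := S.exists_interpolates g f M
  obtain ⟨Q, hQ⟩ := S.exists_interpolates g h M
  have hcM : c ≤ M := by omega
  have hmM : m ≤ M + c := by omega
  have hPQ := hP.mul hQ hcM hmM hfc hhc
  have h1 := hPQ.logFun_sub_mem
  rw [Polynomial.mul_coeff_one] at h1
  have h2 := S.mul_sub_mul_mem hcM hmM hfc hhc' hP.coeff_zero_sub_mem hQ.logFun_sub_mem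
  have h3 := S.mul_sub_mul_mem hcM hmM hfc' hhc hP.logFun_sub_mem hQ.coeff_zero_sub_mem
  have := (S.F m).sub_mem h1 ((S.F m).add_mem h2 h3)
  convert this using 1; ring

/-- The logarithm of `g`, as a derivation. -/
noncomputable def log (g : Γ) : Derivation ℂ K K where
  toFun := S.logFun g
  map_add' := S.logFun_add g
  map_smul' := S.logFun_smul g
  map_one_eq_zero' := by
    have := S.logFun_mul g 1 1
    simp only [mul_one, one_mul] at this
    change S.logFun g 1 = 0
    linear_combination -this
  leibniz' := S.logFun_mul g

theorem log_apply (g : Γ) (f : K) : S.log g f = S.logFun g f := rfl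

theorem log_mem (g : Γ) {n : ℤ} {f : K} (hf : f ∈ S.F n) : S.log g f ∈ S.F (n + 1) := by
  have h := S.logFun_sub_logSum_mem g 1 hf
  have h0 : logSum (S.act g) 1 f = 0 := by
    have : (choosePoly 0).coeff 1 = 0 := by simp [choosePoly, Polynomial.coeff_one]
    simp [logSum, this]
  rw [h0, sub_zero] at h
  simpa [log_apply] using h

/-- Commutation with group elements passes to logarithms. -/
theorem map_log_of_map_act {g g' : Γ} {c : ℤ} (W : Submodule ℂ K) (hW : ∀ f ∈ W, S.act g f ∈ W)
    (θ : K →ₗ[ℂ] K) (hθ : ∀ n f, f ∈ S.F n → θ f ∈ S.F (n + c))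
    (h : ∀ f ∈ W, θ (S.act g f) = S.act g' (θ f)) {f : K} (hf : f ∈ W) :
    θ (S.log g f) = S.log g' (θ f) := by
  -- On `W` the map `θ` intertwines all powers of `g - 1` and `g' - 1`, hence the partial sums of
  -- both logarithms; as it shifts the filtration by a fixed `c`, it passes to the limit.
  have hk : ∀ k : ℕ, (((S.act g).toLinearMap - 1 : Module.End ℂ K) ^ k) f ∈ W ∧
      θ ((((S.act g).toLinearMap - 1 : Module.End ℂ K) ^ k) f) =
      (((S.act g').toLinearMap - 1 : Module.End ℂ K) ^ k) (θ f) := by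
    intro k
    induction k with
    | zero => exact ⟨by simpa using hf, by simp⟩
    | succ k ih =>
      rw [pow_succ', pow_succ', Module.End.mul_apply, Module.End.mul_apply, ← ih.2]
      refine ⟨W.sub_mem (hW _ ih.1) ih.1, ?_⟩
      simp only [LinearMap.sub_apply, Module.End.one_apply, AlgEquiv.toLinearMap_apply, map_sub]
      rw [h _ ih.1]
  refine S.eq_of_forall_sub_mem fun m => ?_
  obtain ⟨a, ha⟩ := S.exhaustive f
  obtain ⟨N, hN⟩ := Int.exists_nat_add_ge (a + c) m
  have h1 := hθ _ _ (S.logFun_sub_logSum_mem g N ha)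
  have h2 := S.logFun_sub_logSum_mem g' N (hθ _ _ ha)
  have h3 : θ (logSum (S.act g) N f) = logSum (S.act g') N (θ f) := by
    simp only [logSum, map_sum, map_smul, (hk _).2]
  rw [map_sub, h3] at h1
  have := (S.F m).sub_mem (S.anti (by omega) h1) (S.anti (by omega) h2)
  simpa [log_apply] using this

theorem act_log_comm (g : Γ) (f : K) : S.act g (S.log g f) = S.log g (S.act g f) :=
  S.map_log_of_map_act (c := 0) ⊤ (fun _ _ => trivial) (S.act g).toLinearMap
    (fun n f hf => by simpa using S.act_mem g hf) (fun _ _ => rfl) trivial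

theorem _root_.UnipotentAction.Interpolates.derivative {S : LogAction Γ K} {g : Γ} {f : K} {m : ℤ} {P : Polynomial K}
    (h : S.Interpolates g f m P) : S.Interpolates g (S.log g f) m (Polynomial.derivative P) := by
  intro n
  have h1 : S.Interpolates g (S.act (g ^ n) f) m (P.comp (Polynomial.X + Polynomial.C (n : K))) := by
    intro k
    have := h (k + n)
    rw [pow_add, map_mul, AlgEquiv.mul_apply] at this
    simpa using this
  have h2 := h1.logFun_sub_mem
  -- The orbit of `gⁿ f` is the orbit of `f` translated by `n`, so its derivative at the origin is
  -- `P'(n)`.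
  have h3 : (P.comp (Polynomial.X + Polynomial.C (n : K))).coeff 1 =
      (Polynomial.derivative P).eval (n : K) := by
    have := Polynomial.taylor_coeff_one (n : K) P
    rwa [Polynomial.taylor_apply] at this
  have h4 : ∀ n : ℕ, S.act (g ^ n) (S.log g f) = S.log g (S.act (g ^ n) f) := by
    intro n
    induction n with
    | zero => simp
    | succ n ih => rw [pow_succ', map_mul, AlgEquiv.mul_apply, ih, act_log_comm]; rfl
  rw [h4, ← h3]
  exact h2

/-- The orbit polynomial is the Taylor polynomial of `t ↦ exp (t log g) f`; its value at `t = 1`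
recovers `g` from `log g`. -/
theorem _root_.UnipotentAction.Interpolates.coeff_sub_mem {S : LogAction Γ K} {g : Γ} {f : K} {m : ℤ} {P : Polynomial K}
    (h : S.Interpolates g f m P) (j : ℕ) :
    (j.factorial : ℂ)⁻¹ • ((S.log g)^[j] f) - P.coeff j ∈ S.F m := by
  have h1 : S.Interpolates g ((S.log g)^[j] f) m (Polynomial.derivative^[j] P) := by
    induction j with
    | zero => simpa using h
    | succ j ih => rw [Function.iterate_succ_apply', Function.iterate_succ_apply']; exact ih.derivative
  have h2 := h1.coeff_zero_sub_mem
  rw [Polynomial.coeff_iterate_derivative, zero_add, Nat.descFactorial_self] at h2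
  have h3 := (S.F m).smul_mem (j.factorial : ℂ)⁻¹ h2
  rw [smul_sub] at h3
  convert h3 using 2
  rw [← Nat.cast_smul_eq_nsmul ℂ, smul_smul, inv_mul_cancel₀, one_smul]
  exact_mod_cast Nat.factorial_ne_zero j

/-- `g` is the exponential of its logarithm. -/
theorem exists_act_sub_expSum_mem (g : Γ) (f : K) (m : ℤ) : ∃ N : ℕ, ∀ M ≥ N,
    S.act g f - ∑ j ∈ Finset.range M, (j.factorial : ℂ)⁻¹ • ((S.log g)^[j] f) ∈ S.F m := by
  obtain ⟨P, hP⟩ := S.exists_interpolates g f m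
  refine ⟨P.natDegree + 1, fun M hM => ?_⟩
  have h1 := hP 1
  rw [Polynomial.eval_eq_sum_range' (show P.natDegree < M by omega)] at h1
  have h2 : ∑ j ∈ Finset.range M, ((j.factorial : ℂ)⁻¹ • ((S.log g)^[j] f) - P.coeff j) ∈ S.F m :=
    Submodule.sum_mem _ fun j _ => hP.coeff_sub_mem j
  rw [Finset.sum_sub_distrib] at h2
  have := (S.F m).sub_mem h1 h2
  simpa using this

/-- Commutation with logarithms passes to group elements. -/
theorem map_act_of_map_log {g g' : Γ} {c : ℤ} (W : Submodule ℂ K) (hW : ∀ f ∈ W, S.log g f ∈ W)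
    (θ : K →ₗ[ℂ] K) (hθ : ∀ n f, f ∈ S.F n → θ f ∈ S.F (n + c))
    (h : ∀ f ∈ W, θ (S.log g f) = S.log g' (θ f)) {f : K} (hf : f ∈ W) :
    θ (S.act g f) = S.act g' (θ f) := by
  have hk : ∀ k : ℕ, (S.log g)^[k] f ∈ W ∧ θ ((S.log g)^[k] f) = (S.log g')^[k] (θ f) := by
    intro k
    induction k with
    | zero => exact ⟨hf, rfl⟩
    | succ k ih =>
      rw [Function.iterate_succ_apply', Function.iterate_succ_apply', ← ih.2]
      exact ⟨hW _ ih.1, h _ ih.1⟩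
  refine S.eq_of_forall_sub_mem fun m => ?_
  obtain ⟨N₁, h₁⟩ := S.exists_act_sub_expSum_mem g f (m - c)
  obtain ⟨N₂, h₂⟩ := S.exists_act_sub_expSum_mem g' (θ f) m
  have e1 := hθ _ _ (h₁ (max N₁ N₂) (le_max_left _ _))
  have e2 := h₂ (max N₁ N₂) (le_max_right _ _)
  rw [map_sub, map_sum, sub_add_cancel] at e1
  simp only [map_smul, (hk _).2] at e1
  have := (S.F m).sub_mem e1 e2
  simpa using this

end LogAction

/-! ### The adjoint action, and linear algebra of derivations over the field -/

namespace LogAction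

variable {Γ K : Type*} [Group Γ] [Field K] [Algebra ℂ K] (S : LogAction Γ K)

/-- The derivations that raise the filtration by `r`. -/
def level (r : ℤ) : Submodule ℂ (Derivation ℂ K K) where
  carrier := {X | ∀ n f, f ∈ S.F n → X f ∈ S.F (n + r)}
  add_mem' hX hY n f hf := (S.F _).add_mem (hX n f hf) (hY n f hf)
  zero_mem' _ _ _ := (S.F _).zero_mem
  smul_mem' c _ hX n f hf := (S.F _).smul_mem c (hX n f hf)

/-- The derivations that raise the filtration. -/
abbrev raising : Submodule ℂ (Derivation ℂ K K) := S.level 1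

theorem log_mem_raising (g : Γ) : S.log g ∈ S.raising := fun _ _ => S.log_mem g

/-- The adjoint action on derivations. -/
def ad (g : Γ) (X : Derivation ℂ K K) : Derivation ℂ K K where
  toFun f := S.act g (X (S.act g⁻¹ f))
  map_add' := by simp
  map_smul' := by simp
  map_one_eq_zero' := by simp
  leibniz' f h := by simp

theorem act_act_inv (g : Γ) (f : K) : S.act g (S.act g⁻¹ f) = f := by
  rw [← AlgEquiv.mul_apply, ← map_mul, mul_inv_cancel, map_one]; rfl

theorem act_inv_act (g : Γ) (f : K) : S.act g⁻¹ (S.act g f) = f := by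
  rw [← AlgEquiv.mul_apply, ← map_mul, inv_mul_cancel, map_one]; rfl

theorem act_mul (g h : Γ) (f : K) : S.act (g * h) f = S.act g (S.act h f) := by
  rw [map_mul, AlgEquiv.mul_apply]

theorem act_one (f : K) : S.act 1 f = f := by rw [map_one]; rfl

theorem ad_apply (g : Γ) (X : Derivation ℂ K K) (f : K) :
    S.ad g X f = S.act g (X (S.act g⁻¹ f)) := rfl

theorem ad_apply_act (g : Γ) (X : Derivation ℂ K K) (f : K) :
    S.ad g X (S.act g f) = S.act g (X f) := by rw [ad_apply, act_inv_act]

theorem ad_mul (g h : Γ) (X : Derivation ℂ K K) : S.ad (g * h) X = S.ad g (S.ad h X) := by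
  ext f; simp [ad_apply]

theorem ad_one (X : Derivation ℂ K K) : S.ad 1 X = X := by
  ext f; simp [ad_apply]

theorem ad_add (g : Γ) (X Y : Derivation ℂ K K) : S.ad g (X + Y) = S.ad g X + S.ad g Y := by
  ext f; simp [ad_apply]

theorem ad_sub (g : Γ) (X Y : Derivation ℂ K K) : S.ad g (X - Y) = S.ad g X - S.ad g Y := by
  ext f; simp [ad_apply]

theorem ad_zero (g : Γ) : S.ad g 0 = 0 := by
  ext f; simp [ad_apply]

theorem ad_smul (g : Γ) (s : K) (X : Derivation ℂ K K) :
    S.ad g (s • X) = S.act g s • S.ad g X := by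
  ext f; simp [ad_apply]

theorem ad_smul_const (g : Γ) (c : ℂ) (X : Derivation ℂ K K) :
    S.ad g (c • X) = c • S.ad g X := by
  ext f; simp [ad_apply]

theorem ad_inv_ad (g : Γ) (X : Derivation ℂ K K) : S.ad g⁻¹ (S.ad g X) = X := by
  rw [← ad_mul, inv_mul_cancel, ad_one]

theorem ad_ne_zero (g : Γ) {X : Derivation ℂ K K} (hX : X ≠ 0) : S.ad g X ≠ 0 := fun h =>
  hX (by rw [← S.ad_inv_ad g X, h, ad_zero])

theorem ad_mem_level (g : Γ) {X : Derivation ℂ K K} {r : ℤ} (hX : X ∈ S.level r) :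
    S.ad g X ∈ S.level r := fun _ _ hf => S.act_mem g (hX _ _ (S.act_mem g⁻¹ hf))

/-- Write `g X g⁻¹ - X = (g - 1) X g⁻¹ + X (g⁻¹ - 1)`; each summand gains one order from unipotence.
-/
theorem ad_sub_mem_level (g : Γ) {X : Derivation ℂ K K} {r : ℤ} (hX : X ∈ S.level r) :
    S.ad g X - X ∈ S.level (r + 1) := by
  intro n f hf
  have h1 := S.act_sub_mem g (hX _ _ (S.act_mem g⁻¹ hf))
  have h2 := hX _ _ (S.act_sub_mem g⁻¹ hf)
  rw [map_sub] at h2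
  have := (S.F _).add_mem h1 (S.anti (by omega) h2)
  rw [Derivation.sub_apply, ad_apply, ← add_assoc]
  simpa using this

theorem eq_zero_of_forall_mem_level {X : Derivation ℂ K K} (h : ∀ r : ℕ, X ∈ S.level (1 + r)) :
    X = 0 := by
  ext f
  obtain ⟨a, ha⟩ := S.exhaustive f
  refine S.separated _ fun m => ?_
  obtain ⟨N, hN⟩ := Int.exists_nat_add_ge (a + 1) m
  exact S.anti (by omega) (h N a f ha)

/-- A nonzero raising derivation has an exact level. -/
theorem exists_exact_level {X : Derivation ℂ K K} (hX : X ∈ S.raising) (h0 : X ≠ 0) :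
    ∃ r : ℤ, X ∈ S.level r ∧ X ∉ S.level (r + 1) := by
  by_contra! h
  refine h0 (S.eq_zero_of_forall_mem_level fun r => ?_)
  induction r with
  | zero => simpa using hX
  | succ r ih => have := h _ ih; push_cast; rwa [← add_assoc]

/-! ### Rank two -/

theorem apply_eq {X : Derivation ℂ K K} (hX : X ∈ S.raising) (f : K) :
    X f = X S.u * S.du f + X S.v * S.dv f := S.chain_rule X hX f

/-- The vectors `(X u, X v)` and `(Y u, Y v)` of `K²` are both orthogonal to the nonzero vector `(du
f, dv f)`. -/
theorem exists_smul_of_apply_eq_zero {X Y : Derivation ℂ K K} (hX : X ∈ S.raising)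
    (hY : Y ∈ S.raising) (h0 : X ≠ 0) {f : K} (hf : f ∉ Set.range (algebraMap ℂ K))
    (hXf : X f = 0) (hYf : Y f = 0) : ∃ s : K, Y = s • X := by
  rw [S.apply_eq hX] at hXf
  rw [S.apply_eq hY] at hYf
  by_cases hu : S.du f = 0
  · have hv : S.dv f ≠ 0 := fun hv => hf (S.const_of_partials f hu hv)
    have hXv : X S.v = 0 := by simpa [hu, hv] using hXf
    have hYv : Y S.v = 0 := by simpa [hu, hv] using hYf
    have hXu : X S.u ≠ 0 := fun hXu => h0 (by ext f; rw [S.apply_eq hX f, hXu, hXv]; simp)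
    refine ⟨Y S.u / X S.u, ?_⟩
    ext f
    rw [Derivation.smul_apply, S.apply_eq hX f, S.apply_eq hY f, hXv, hYv, smul_eq_mul]
    field_simp; ring
  · have hXv : X S.v ≠ 0 := fun hXv => by
      have hXu : X S.u = 0 := by simpa [hu, hXv] using hXf
      exact h0 (by ext f; rw [S.apply_eq hX f, hXu, hXv]; simp)
    have e1 : X S.u = - (X S.v * S.dv f / S.du f) := by field_simp; linear_combination hXf
    have e2 : Y S.u = - (Y S.v * S.dv f / S.du f) := by field_simp; linear_combination hYf
    refine ⟨Y S.v / X S.v, ?_⟩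
    ext f
    rw [Derivation.smul_apply, S.apply_eq hX f, S.apply_eq hY f, e1, e2, smul_eq_mul]
    field_simp

/-- Cramer's rule in the coordinates `(X u, X v)`. -/
theorem exists_eq_smul_add_smul {X Y U : Derivation ℂ K K} (hX : X ∈ S.raising)
    (hY : Y ∈ S.raising) (hU : U ∈ S.raising) (h0 : X ≠ 0) (hXY : ∀ s : K, Y ≠ s • X) :
    ∃ p q : K, U = p • X + q • Y := by
  have hdet : X S.u * Y S.v - X S.v * Y S.u ≠ 0 := by
    intro hd
    by_cases hXu : X S.u = 0
    · have hXv : X S.v ≠ 0 := fun hXv => h0 (by ext f; rw [S.apply_eq hX f, hXu, hXv]; simp)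
      have hYu : Y S.u = 0 := by simpa [hXu, hXv] using hd
      refine hXY (Y S.v / X S.v) ?_
      ext f
      rw [Derivation.smul_apply, S.apply_eq hX f, S.apply_eq hY f, hXu, hYu, smul_eq_mul]
      field_simp; ring
    · refine hXY (Y S.u / X S.u) ?_
      ext f
      rw [Derivation.smul_apply, S.apply_eq hX f, S.apply_eq hY f, smul_eq_mul]
      field_simp
      linear_combination S.dv f * hd
  refine ⟨(U S.u * Y S.v - U S.v * Y S.u) / (X S.u * Y S.v - X S.v * Y S.u),
    (X S.u * U S.v - X S.v * U S.u) / (X S.u * Y S.v - X S.v * Y S.u), ?_⟩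
  ext f
  rw [Derivation.add_apply, Derivation.smul_apply, Derivation.smul_apply, S.apply_eq hX f,
    S.apply_eq hY f, S.apply_eq hU f, smul_eq_mul, smul_eq_mul, div_mul_eq_mul_div,
    div_mul_eq_mul_div, ← add_div, eq_div_iff hdet]
  ring

theorem mem_range_of_apply_eq_zero {X Y : Derivation ℂ K K} (hX : X ∈ S.raising)
    (hY : Y ∈ S.raising) (h0 : X ≠ 0) (hXY : ∀ s : K, Y ≠ s • X) {f : K}
    (hXf : X f = 0) (hYf : Y f = 0) : f ∈ Set.range (algebraMap ℂ K) := by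
  by_contra hf
  obtain ⟨s, hs⟩ := S.exists_smul_of_apply_eq_zero hX hY h0 hf hXf hYf
  exact hXY s hs

/-! ### Logarithms and commutation -/

theorem log_eq_zero_of_act_eq {g : Γ} {f : K} (h : S.act g f = f) : S.log g f = 0 := by
  refine S.eq_of_forall_sub_mem fun m => ?_
  have h1 : S.Interpolates g f m (Polynomial.C f) := fun n => by
    have : S.act (g ^ n) f = f := by
      induction n with
      | zero => simp
      | succ n ih => rw [pow_succ, act_mul, h, ih]
    rw [this]; simp
  have := h1.logFun_sub_mem
  simpa [log_apply] using this

theorem log_one : S.log 1 = 0 := by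
  ext f; exact S.log_eq_zero_of_act_eq (S.act_one f)

/-- The constants of a derivation. -/
def constants (X : Derivation ℂ K K) : Submodule ℂ K := LinearMap.ker (X : K →ₗ[ℂ] K)

theorem mem_constants {X : Derivation ℂ K K} {f : K} : f ∈ constants X ↔ X f = 0 := Iff.rfl

theorem act_eq_iff {g : Γ} {f : K} : S.act g f = f ↔ S.log g f = 0 := by
  refine ⟨S.log_eq_zero_of_act_eq, fun h => ?_⟩
  have := S.map_act_of_map_log (g := g) (g' := 1) (c := 0) (constants (S.log g))
    (fun f hf => by
      have h1 : S.log g f = 0 := hf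
      rw [h1]; exact zero_mem _) LinearMap.id
    (fun n f hf => by simpa using hf)
    (fun f hf => by
      have h1 : S.log g f = 0 := hf
      simp [S.log_one, h1]) h
  simpa using this

/-- Elements with logarithms equal on a stable subspace agree there. -/
theorem act_eq_act_of_log_eq {g h : Γ} (W : Submodule ℂ K) (hW : ∀ f ∈ W, S.log g f ∈ W)
    (hgh : ∀ f ∈ W, S.log g f = S.log h f) {f : K} (hf : f ∈ W) : S.act g f = S.act h f :=
  S.map_act_of_map_log (c := 0) W hW LinearMap.id (fun n f hf => by simpa using hf) hgh hf

theorem log_injective : Function.Injective S.log := fun g h hgh => S.injective <| by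
  ext f
  exact S.act_eq_act_of_log_eq ⊤ (fun _ _ => trivial) (fun f _ => by rw [hgh]) trivial

theorem log_ne_zero {g : Γ} (hg : g ≠ 1) : S.log g ≠ 0 := fun h =>
  hg (S.log_injective (by rw [h, log_one]))

theorem ad_log (g h : Γ) : S.ad g (S.log h) = S.log (g * h * g⁻¹) := by
  ext f
  have := S.map_log_of_map_act (g := h) (g' := g * h * g⁻¹) (c := 0) ⊤ (fun _ _ => trivial)
    (S.act g).toLinearMap (fun n f hf => by simpa using S.act_mem g hf)
    (fun f _ => by simp) (f := S.act g⁻¹ f) trivial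
  simpa [ad_apply] using this

theorem ad_eq_iff {g : Γ} {X : Derivation ℂ K K} (hX : X ∈ S.raising) :
    S.ad g X = X ↔ ∀ f, X (S.log g f) = S.log g (X f) := by
  constructor
  · intro h f
    exact S.map_log_of_map_act (c := 1) ⊤ (fun _ _ => trivial) (X : K →ₗ[ℂ] K) hX
      (fun f _ => by
        have := S.ad_apply_act g X f
        rw [h] at this; exact this) trivial
  · intro h
    ext f
    have := S.map_act_of_map_log (g := g) (g' := g) (c := 1) ⊤ (fun _ _ => trivial)
      (X : K →ₗ[ℂ] K) hX (fun f _ => h f) (f := S.act g⁻¹ f) trivial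
    have h2 : X (S.act g (S.act g⁻¹ f)) = S.act g (X (S.act g⁻¹ f)) := this
    rw [ad_apply, ← h2, act_act_inv]

theorem commute_iff_ad {g h : Γ} : g * h = h * g ↔ S.ad g (S.log h) = S.log h := by
  rw [ad_log, S.log_injective.eq_iff, mul_inv_eq_iff_eq_mul]

theorem commute_iff_log {g h : Γ} :
    g * h = h * g ↔ ∀ f, S.log h (S.log g f) = S.log g (S.log h f) := by
  rw [S.commute_iff_ad, S.ad_eq_iff (S.log_mem_raising h)]

/-- The transfer from group elements to logarithms is applied to `y`, then to `x`. -/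
theorem log_comm_of_act_comm {x y : Γ} (W : Submodule ℂ K) (hx : ∀ f ∈ W, S.act x f ∈ W)
    (hy : ∀ f ∈ W, S.act y f ∈ W) (h : ∀ f ∈ W, S.act x (S.act y f) = S.act y (S.act x f))
    {f : K} (hf : f ∈ W) : S.log x (S.log y f) = S.log y (S.log x f) := by
  have h1 : ∀ f ∈ W, S.act x (S.log y f) = S.log y (S.act x f) := fun f hf =>
    S.map_log_of_map_act (c := 0) W hy (S.act x).toLinearMap
      (fun n f hf => by simpa using S.act_mem x hf) h hf
  exact (S.map_log_of_map_act (c := 1) W hx (S.log y : K →ₗ[ℂ] K) (S.log_mem_raising y)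
    (fun f hf => (h1 f hf).symm) hf).symm

theorem act_comm_of_log_comm {x y : Γ} (W : Submodule ℂ K) (hx : ∀ f ∈ W, S.log x f ∈ W)
    (hy : ∀ f ∈ W, S.log y f ∈ W) (h : ∀ f ∈ W, S.log x (S.log y f) = S.log y (S.log x f))
    {f : K} (hf : f ∈ W) : S.act x (S.act y f) = S.act y (S.act x f) := by
  have h1 : ∀ f ∈ W, S.log x (S.act y f) = S.act y (S.log x f) := fun f hf =>
    S.map_act_of_map_log (c := 1) W hy (S.log x : K →ₗ[ℂ] K) (S.log_mem_raising x) h hf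
  exact (S.map_act_of_map_log (c := 0) W hx (S.act y).toLinearMap
      (fun n f hf => by simpa using S.act_mem y hf) (fun f hf => (h1 f hf).symm) hf).symm

theorem log_mem_constants {X : Derivation ℂ K K} (hX : X ∈ S.raising) {g : Γ}
    (h : ∀ f ∈ constants X, S.act g f ∈ constants X) {f : K} (hf : f ∈ constants X) :
    S.log g f ∈ constants X := by
  -- On the constants of `X` both `X ∘ g` and `X` vanish, so `X` intertwines `g` with the identity,
  -- whose logarithm is zero.
  have := S.map_log_of_map_act (g := g) (g' := 1) (c := 1) (constants X) h (X : K →ₗ[ℂ] K) hX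
    (fun f hf => by
      have h1 : X (S.act g f) = 0 := h f hf
      have h2 : X f = 0 := hf
      simp [h1, h2]) hf
  have h2 : X f = 0 := hf
  simpa [h2, mem_constants] using this

/-! ### Unipotence -/

/-- A unipotent map has no eigenvalue but `1`: if `c ≠ 1`, then on `W` the derivation `U` is a
multiple of `ad g U - U`, which gains one order, so iterating makes `U` vanish on `W`. The subspace
`W` allows eigenvalue equations valid only on constants of another derivation. -/
theorem eq_one_of_ad_eq_smul {g : Γ} {U : Derivation ℂ K K} (hU : U ∈ S.raising)
    (W : Submodule ℂ K) (hW : ∀ f ∈ W, S.act g⁻¹ f ∈ W) {c : ℂ}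
    (h : ∀ f ∈ W, S.ad g U f = c • U f) {f : K} (hf : f ∈ W) (hUf : U f ≠ 0) : c = 1 := by
  by_contra hc
  have key : ∀ r : ℕ, ∀ n, ∀ f ∈ W, f ∈ S.F n → U f ∈ S.F (n + 1 + r) := by
    intro r
    induction r with
    | zero => intro n f _ hf; simpa using hU n f hf
    | succ r ih =>
      intro n f hfW hf
      have h1 := S.act_sub_mem g (ih n _ (hW f hfW) (S.act_mem g⁻¹ hf))
      have h2 := ih (n + 1) _ (W.sub_mem (hW f hfW) hfW) (S.act_sub_mem g⁻¹ hf)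
      rw [map_sub] at h2
      have h3 := (S.F _).add_mem h1 (S.anti (by omega) h2)
      have h4 := h f hfW
      rw [ad_apply] at h4
      rw [h4, sub_add_sub_cancel] at h3
      have h5 : c • U f - U f = (c - 1) • U f := by rw [sub_smul, one_smul]
      rw [h5] at h3
      have h6 := (S.F _).smul_mem (c - 1)⁻¹ h3
      rw [smul_smul, inv_mul_cancel₀ (sub_ne_zero.mpr hc), one_smul] at h6
      push_cast
      rwa [← add_assoc]
  obtain ⟨a, ha⟩ := S.exhaustive f
  refine hUf (S.separated _ fun m => ?_)
  obtain ⟨N, hN⟩ := Int.exists_nat_add_ge (a + 1) m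
  exact S.anti hN (key N a f hf ha)

/-! ### Multiples of a derivation -/

/-- From `[sX, X] = -X(s) X`. -/
theorem apply_eq_zero_of_smul_comm {X : Derivation ℂ K K} (h0 : X ≠ 0) {s : K}
    (h : ∀ f, (s • X) (X f) = X ((s • X) f)) : X s = 0 := by
  obtain ⟨f, hf⟩ : ∃ f, X f ≠ 0 := by
    by_contra! h'
    exact h0 (by ext f; simpa using h' f)
  have := h f
  simp only [Derivation.smul_apply, smul_eq_mul, Derivation.leibniz] at this
  have h2 : X f * X s = 0 := by linear_combination -this
  simpa [hf] using h2

theorem smul_comm_smul {X : Derivation ℂ K K} {s t : K} (hs : X s = 0) (ht : X t = 0) (f : K) :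
    (s • X) ((t • X) f) = (t • X) ((s • X) f) := by
  simp only [Derivation.smul_apply, smul_eq_mul, Derivation.leibniz, hs, ht]
  ring

theorem eq_of_smul_eq_smul {X : Derivation ℂ K K} (h0 : X ≠ 0) {s t : K} (h : s • X = t • X) :
    s = t := by
  obtain ⟨f, hf⟩ : ∃ f, X f ≠ 0 := by
    by_contra! h'
    exact h0 (by ext f; simpa using h' f)
  have := congrArg (fun D : Derivation ℂ K K => D f) h
  simp only [Derivation.smul_apply, smul_eq_mul] at this
  exact mul_right_cancel₀ hf this

end LogAction


/-! ### Groups fixing a nonconstant element, their centralizers and normalizers -/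

/-- The centralizer of `x` in `T`. -/
def Subgroup.centIn {Γ : Type*} [Group Γ] (T : Subgroup Γ) (x : Γ) : Subgroup Γ :=
  T ⊓ Subgroup.centralizer {x}

theorem Subgroup.mem_centIn {Γ : Type*} [Group Γ] {T : Subgroup Γ} {x y : Γ} :
    y ∈ T.centIn x ↔ y ∈ T ∧ y * x = x * y := by
  rw [Subgroup.centIn, Subgroup.mem_inf, Subgroup.mem_centralizer_singleton_iff]

theorem conj_mul_conj {Γ : Type*} [Group Γ] (g x y : Γ) :
    g * (x * y) * g⁻¹ = (g * x * g⁻¹) * (g * y * g⁻¹) := by group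

theorem conj_commute_iff {Γ : Type*} [Group Γ] (g x y : Γ) :
    (g * x * g⁻¹) * (g * y * g⁻¹) = (g * y * g⁻¹) * (g * x * g⁻¹) ↔ x * y = y * x := by
  rw [← conj_mul_conj, ← conj_mul_conj, mul_left_inj, mul_right_inj]

namespace LogAction

variable {Γ K : Type*} [Group Γ] [Field K] [Algebra ℂ K] (S : LogAction Γ K)

/-- The group of elements fixing `φ`. -/
def fixer (φ : K) : Subgroup Γ where
  carrier := {g | S.act g φ = φ}
  mul_mem' {g h} hg hh := by
    have hg : S.act g φ = φ := hg
    have hh : S.act h φ = φ := hh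
    change S.act (g * h) φ = φ
    rw [act_mul, hh, hg]
  one_mem' := S.act_one φ
  inv_mem' {g} hg := by
    have hg : S.act g φ = φ := hg
    change S.act g⁻¹ φ = φ
    conv_lhs => rw [← hg, act_inv_act]

theorem mem_fixer {φ : K} {g : Γ} : g ∈ S.fixer φ ↔ S.act g φ = φ := Iff.rfl

theorem conj_mem_fixer {φ : K} {g b : Γ} :
    b * g * b⁻¹ ∈ S.fixer (S.act b φ) ↔ g ∈ S.fixer φ := by
  rw [mem_fixer, mem_fixer, act_mul, act_mul, act_inv_act, EmbeddingLike.apply_eq_iff_eq]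

theorem act_notMem_range {φ : K} (hφ : φ ∉ Set.range (algebraMap ℂ K)) (b : Γ) :
    S.act b φ ∉ Set.range (algebraMap ℂ K) := by
  rintro ⟨c, hc⟩
  refine hφ ⟨c, ?_⟩
  rw [← S.act_inv_act b φ, ← hc, AlgEquiv.commutes]

/-- Derivations preserving the constants of `X` and commuting with a nonzero one are proportional
there. -/
theorem exists_const_smul_on_constants {X : Derivation ℂ K K} (hX : X ∈ S.raising) (h0 : X ≠ 0)
    {x y : Γ} (hx : ∀ f ∈ constants X, S.log x f ∈ constants X)
    (hy : ∀ f ∈ constants X, S.log y f ∈ constants X) {φ : K} (hφ : φ ∈ constants X)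
    (hxφ : S.log x φ ≠ 0) (hc : S.log x (S.log y φ) = S.log y (S.log x φ)) :
    ∃ c : ℂ, ∀ f ∈ constants X, S.log y f = c • S.log x f := by
  have hφ0 : X φ = 0 := hφ
  have hind : ∀ s : K, S.log x ≠ s • X := fun s hs => hxφ (by
    rw [hs, Derivation.smul_apply, hφ0, smul_zero])
  obtain ⟨p, q, hpq⟩ := S.exists_eq_smul_add_smul hX (S.log_mem_raising x)
    (S.log_mem_raising y) h0 hind
  have hk : ∀ f ∈ constants X, S.log y f = q * S.log x f := fun f hf => by
    have hf0 : X f = 0 := hf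
    rw [hpq, Derivation.add_apply, Derivation.smul_apply, Derivation.smul_apply, hf0]
    simp
  -- The coefficient `q` is killed by `X` because `log y` preserves the constants of `X`, and by
  -- `log x` because of commutation at `φ`; as `X` and `log x` are independent, `q` is constant.
  have e0 : X q = 0 := by
    have h2 : X (S.log y φ) = 0 := hy φ hφ
    have h3 : X (S.log x φ) = 0 := hx φ hφ
    rw [hk φ hφ, Derivation.leibniz, h3] at h2
    simpa [hxφ] using h2
  have e1 : S.log x q = 0 := by
    rw [hk φ hφ, hk _ (hx φ hφ), Derivation.leibniz] at hc
    simpa [hxφ] using hc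
  obtain ⟨c, hc⟩ := S.mem_range_of_apply_eq_zero hX (S.log_mem_raising x) h0 hind e0 e1
  exact ⟨c, fun f hf => by rw [hk f hf, ← hc, Algebra.smul_def]⟩

theorem act_commutator_eq {y z : Γ} (W : Submodule ℂ K) (hy : ∀ f ∈ W, S.act y⁻¹ f ∈ W)
    (hz : ∀ f ∈ W, S.act z⁻¹ f ∈ W)
    (h : ∀ f ∈ W, S.act y (S.act z f) = S.act z (S.act y f)) {φ : K} (hφ : φ ∈ W) :
    S.act ⁅y, z⁆ φ = φ := by
  have := h _ (hy _ (hz _ hφ))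
  rw [commutatorElement_def, act_mul, act_mul, act_mul, this, act_act_inv, act_act_inv]

section Fixer

variable {S} {φ : K} (hφ : φ ∉ Set.range (algebraMap ℂ K))
include hφ

theorem exists_log_eq_smul {x y : Γ} (hx : x ∈ S.fixer φ) (hy : y ∈ S.fixer φ) (h1 : x ≠ 1) :
    ∃ s : K, S.log y = s • S.log x :=
  S.exists_smul_of_apply_eq_zero (S.log_mem_raising x) (S.log_mem_raising y) (S.log_ne_zero h1) hφ
    (S.act_eq_iff.mp hx) (S.act_eq_iff.mp hy)

theorem act_eq_of_mem_fixer {x y : Γ} (hx : x ∈ S.fixer φ) (hy : y ∈ S.fixer φ) (h1 : x ≠ 1)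
    {f : K} (hf : S.log x f = 0) : S.act y f = f := by
  obtain ⟨s, hs⟩ := exists_log_eq_smul hφ hx hy h1
  rw [act_eq_iff, hs, Derivation.smul_apply, hf, smul_zero]

omit hφ in
theorem commute_iff_of_log_eq_smul {x y : Γ} (h1 : x ≠ 1) {s : K} (hs : S.log y = s • S.log x) :
    x * y = y * x ↔ S.log x s = 0 := by
  rw [S.commute_iff_log, hs]
  refine ⟨apply_eq_zero_of_smul_comm (S.log_ne_zero h1), fun h f => ?_⟩
  have := smul_comm_smul (X := S.log x) (s := s) (t := 1) h (by simp) f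
  simpa using this

/-- Commuting is transitive on nontrivial elements of `fixer φ`. -/
theorem commute_trans {x y z : Γ} (hx : x ∈ S.fixer φ) (hy : y ∈ S.fixer φ) (hz : z ∈ S.fixer φ)
    (h1 : y ≠ 1) (hxy : x * y = y * x) (hyz : y * z = z * y) : x * z = z * x := by
  obtain ⟨s, hs⟩ := exists_log_eq_smul hφ hy hx h1
  obtain ⟨t, ht⟩ := exists_log_eq_smul hφ hy hz h1
  rw [S.commute_iff_log, hs, ht]
  exact fun f => smul_comm_smul ((commute_iff_of_log_eq_smul h1 ht).mp hyz)
    ((commute_iff_of_log_eq_smul h1 hs).mp hxy.symm) f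

/-- A nontrivial `x` in `fixer φ` determines this group: its elements act trivially on all constants
of `log x`, among which is `ψ`. -/
theorem fixer_eq_of_mem {ψ : K} (hψ : ψ ∉ Set.range (algebraMap ℂ K)) {x : Γ}
    (h1 : x ≠ 1) (hx : x ∈ S.fixer φ) (hx' : x ∈ S.fixer ψ) : S.fixer φ = S.fixer ψ := by
  ext y
  exact ⟨fun hy => act_eq_of_mem_fixer hφ hx hy h1 (S.act_eq_iff.mp hx'),
    fun hy => act_eq_of_mem_fixer hψ hx' hy h1 (S.act_eq_iff.mp hx)⟩

/-- Conjugation by `b` carries `fixer φ` to `fixer (b φ)`; the two share the nontrivial element `b x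
b⁻¹`, so they coincide. -/
theorem mem_normalizer_of_conj_mem {x b : Γ} (h1 : x ≠ 1) (hx : x ∈ S.fixer φ)
    (hb : b * x * b⁻¹ ∈ S.fixer φ) : b ∈ Subgroup.normalizer (S.fixer φ : Set Γ) := by
  have h := fixer_eq_of_mem hφ (S.act_notMem_range hφ b) (x := b * x * b⁻¹)
    (by simpa using h1) hb (S.conj_mem_fixer.mpr hx)
  rw [Subgroup.mem_normalizer_iff]
  intro g
  conv_rhs => rw [h]
  exact S.conj_mem_fixer.symm

theorem act_mem_constants_of_mem_normalizer {x n : Γ} (h1 : x ≠ 1) (hx : x ∈ S.fixer φ)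
    (hn : n ∈ Subgroup.normalizer (S.fixer φ : Set Γ)) {f : K} (hf : f ∈ constants (S.log x)) :
    S.act n f ∈ constants (S.log x) := by
  rw [mem_constants, ← act_eq_iff, ← act_mul]
  have h2 : n⁻¹ * x * n ∈ S.fixer φ := (Subgroup.mem_normalizer_iff''.mp hn x).mp hx
  have h3 := act_eq_of_mem_fixer hφ hx h2 h1 hf
  have : x * n = n * (n⁻¹ * x * n) := by group
  rw [this, act_mul, h3]

theorem log_mem_constants_of_mem_normalizer {x n : Γ} (h1 : x ≠ 1) (hx : x ∈ S.fixer φ)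
    (hn : n ∈ Subgroup.normalizer (S.fixer φ : Set Γ)) {f : K} (hf : f ∈ constants (S.log x)) :
    S.log n f ∈ constants (S.log x) :=
  S.log_mem_constants (S.log_mem_raising x)
    (fun _ hf => act_mem_constants_of_mem_normalizer hφ h1 hx hn hf) hf

theorem act_comm_of_commutator_mem {x0 x y : Γ} (h1 : x0 ≠ 1) (hx0 : x0 ∈ S.fixer φ)
    (hx : x ∈ Subgroup.normalizer (S.fixer φ : Set Γ)) (hy : y ∈ Subgroup.normalizer (S.fixer φ : Set Γ))
    (hxy : ⁅x, y⁆ ∈ S.fixer φ) {f : K} (hf : f ∈ constants (S.log x0)) :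
    S.act x (S.act y f) = S.act y (S.act x f) := by
  have h2 := act_eq_of_mem_fixer hφ hx0 hxy h1
    (act_mem_constants_of_mem_normalizer hφ h1 hx0 hy
      (act_mem_constants_of_mem_normalizer hφ h1 hx0 hx hf))
  rw [← h2, ← act_mul, ← act_mul, ← act_mul]
  have : x * y = ⁅x, y⁆ * (y * x) := by rw [commutatorElement_def]; group
  rw [this, mul_assoc]

/-- On the field fixed by `fixer φ`, derivations commuting with a nonzero one are proportional. -/
theorem exists_log_eq_const_smul {x0 x y : Γ} (h1 : x0 ≠ 1) (hx0 : x0 ∈ S.fixer φ)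
    (hx : x ∈ Subgroup.normalizer (S.fixer φ : Set Γ)) (hxT : x ∉ S.fixer φ) (hy : y ∈ Subgroup.normalizer (S.fixer φ : Set Γ))
    (hxy : ⁅x, y⁆ ∈ S.fixer φ) : ∃ c : ℂ, ∀ f ∈ constants (S.log x0), S.log y f = c • S.log x f := by
  have hφk : φ ∈ constants (S.log x0) := S.act_eq_iff.mp hx0
  exact S.exists_const_smul_on_constants (S.log_mem_raising x0) (S.log_ne_zero h1)
    (fun f hf => log_mem_constants_of_mem_normalizer hφ h1 hx0 hx hf)
    (fun f hf => log_mem_constants_of_mem_normalizer hφ h1 hx0 hy hf) hφk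
    (fun h => hxT (S.act_eq_iff.mpr h))
    (S.log_comm_of_act_comm (constants (S.log x0))
      (fun f hf => act_mem_constants_of_mem_normalizer hφ h1 hx0 hx hf)
      (fun f hf => act_mem_constants_of_mem_normalizer hφ h1 hx0 hy hf)
      (fun f hf => act_comm_of_commutator_mem hφ h1 hx0 hx hy hxy hf) hφk)

theorem commutator_mem_of_act_comm {x0 y z : Γ} (h1 : x0 ≠ 1) (hx0 : x0 ∈ S.fixer φ)
    (hy : y ∈ Subgroup.normalizer (S.fixer φ : Set Γ)) (hz : z ∈ Subgroup.normalizer (S.fixer φ : Set Γ))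
    (h : ∀ f ∈ constants (S.log x0), S.act y (S.act z f) = S.act z (S.act y f)) :
    ⁅y, z⁆ ∈ S.fixer φ := by
  have hφk : φ ∈ constants (S.log x0) := S.act_eq_iff.mp hx0
  exact S.act_commutator_eq _
    (fun f hf => act_mem_constants_of_mem_normalizer hφ h1 hx0 (inv_mem hy) hf)
    (fun f hf => act_mem_constants_of_mem_normalizer hφ h1 hx0 (inv_mem hz) hf) h hφk

/-- Centralizers of nontrivial elements in the quotient of the normalizer of `fixer φ` by `fixer φ`
are abelian. -/
theorem commutator_mem_trans {x0 x y z : Γ} (h1 : x0 ≠ 1) (hx0 : x0 ∈ S.fixer φ)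
    (hx : x ∈ Subgroup.normalizer (S.fixer φ : Set Γ)) (hxT : x ∉ S.fixer φ) (hy : y ∈ Subgroup.normalizer (S.fixer φ : Set Γ))
    (hz : z ∈ Subgroup.normalizer (S.fixer φ : Set Γ)) (hxy : ⁅x, y⁆ ∈ S.fixer φ) (hxz : ⁅x, z⁆ ∈ S.fixer φ) :
    ⁅y, z⁆ ∈ S.fixer φ := by
  obtain ⟨c, hc⟩ := exists_log_eq_const_smul hφ h1 hx0 hx hxT hy hxy
  obtain ⟨d, hd⟩ := exists_log_eq_const_smul hφ h1 hx0 hx hxT hz hxz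
  have hxk := fun f hf => log_mem_constants_of_mem_normalizer hφ h1 hx0 hx (f := f) hf
  refine commutator_mem_of_act_comm hφ h1 hx0 hy hz fun f hf => ?_
  refine S.act_comm_of_log_comm _
    (fun f hf => log_mem_constants_of_mem_normalizer hφ h1 hx0 hy hf)
    (fun f hf => log_mem_constants_of_mem_normalizer hφ h1 hx0 hz hf) (fun f hf => ?_) hf
  rw [hc f hf, hd f hf, Derivation.map_smul, Derivation.map_smul, hc _ (hxk f hf), hd _ (hxk f hf), smul_comm]

/-- Modulo `fixer φ`, an `x` commuting with its conjugate by `h` has `ad h (log x) = c log x` on the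
constants of `log x0`. Unipotence gives `c = 1`, so `h` and `x` commute there. -/
theorem commutator_mem_of_conj {x0 x h : Γ} (h1 : x0 ≠ 1) (hx0 : x0 ∈ S.fixer φ)
    (hx : x ∈ Subgroup.normalizer (S.fixer φ : Set Γ)) (hxT : x ∉ S.fixer φ) (hh : h ∈ Subgroup.normalizer (S.fixer φ : Set Γ))
    (hc : ⁅x, h * x * h⁻¹⁆ ∈ S.fixer φ) : ⁅h, x⁆ ∈ S.fixer φ := by
  have hφk : φ ∈ constants (S.log x0) := S.act_eq_iff.mp hx0
  have hy : h * x * h⁻¹ ∈ Subgroup.normalizer (S.fixer φ : Set Γ) := mul_mem (mul_mem hh hx) (inv_mem hh)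
  obtain ⟨c, hc⟩ := exists_log_eq_const_smul hφ h1 hx0 hx hxT hy hc
  have hUφ : S.log x φ ≠ 0 := fun h => hxT (S.act_eq_iff.mpr h)
  have hc1 : c = 1 := S.eq_one_of_ad_eq_smul (g := h) (S.log_mem_raising x) (constants (S.log x0))
    (fun f hf => act_mem_constants_of_mem_normalizer hφ h1 hx0 (inv_mem hh) hf)
    (fun f hf => by rw [ad_log]; exact hc f hf) hφk hUφ
  have h2 : ∀ f ∈ constants (S.log x0), S.act (h * x * h⁻¹) f = S.act x f := fun f hf =>
    S.act_eq_act_of_log_eq _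
      (fun f hf => log_mem_constants_of_mem_normalizer hφ h1 hx0 hy hf)
      (fun f hf => by rw [hc f hf, hc1, one_smul]) hf
  rw [mem_fixer]
  have h3 := h2 _ (act_mem_constants_of_mem_normalizer hφ h1 hx0 (inv_mem hx) hφk)
  rw [act_act_inv, ← act_mul] at h3
  rw [commutatorElement_def]; exact h3

theorem centIn_eq_of_commute {x y : Γ} (hx : x ∈ S.fixer φ) (hy : y ∈ S.fixer φ) (hx1 : x ≠ 1)
    (hy1 : y ≠ 1) (hxy : x * y = y * x) : (S.fixer φ).centIn x = (S.fixer φ).centIn y := by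
  ext z
  rw [Subgroup.mem_centIn, Subgroup.mem_centIn]
  exact ⟨fun ⟨hz, h⟩ => ⟨hz, commute_trans hφ hz hx hy hx1 h hxy⟩,
    fun ⟨hz, h⟩ => ⟨hz, commute_trans hφ hz hy hx hy1 h hxy.symm⟩⟩

/-- By transitivity of commuting, `x` and `g x g⁻¹` have the same centralizer in `fixer φ`. -/
theorem mem_normalizer_centIn {x g : Γ} (hx : x ∈ S.fixer φ) (h1 : x ≠ 1)
    (hg : g ∈ Subgroup.normalizer (S.fixer φ : Set Γ)) (h : g * x * g⁻¹ * x = x * (g * x * g⁻¹)) :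
    g ∈ Subgroup.normalizer ((S.fixer φ).centIn x : Set Γ) := by
  have h2 : g * x * g⁻¹ ∈ S.fixer φ := (Subgroup.mem_normalizer_iff.mp hg x).mp hx
  have h3 := centIn_eq_of_commute hφ h2 hx (by simpa using h1) h1 h
  rw [Subgroup.mem_normalizer_iff]
  intro z
  conv_rhs => rw [← h3]
  rw [Subgroup.mem_centIn, Subgroup.mem_centIn, conj_commute_iff,
    ← Subgroup.mem_normalizer_iff.mp hg z]

omit hφ in
theorem commute_of_mem_normalizer_centIn {x g : Γ} (hx : x ∈ S.fixer φ)
    (hg : g ∈ Subgroup.normalizer ((S.fixer φ).centIn x : Set Γ)) : g * x * g⁻¹ * x = x * (g * x * g⁻¹) :=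
  (Subgroup.mem_centIn.mp ((Subgroup.mem_normalizer_iff.mp hg x).mp
    (Subgroup.mem_centIn.mpr ⟨hx, rfl⟩))).2

theorem commute_of_mem_centIn {x y z : Γ} (hx : x ∈ S.fixer φ) (h1 : x ≠ 1)
    (hy : y ∈ (S.fixer φ).centIn x) (hz : z ∈ (S.fixer φ).centIn x) : y * z = z * y := by
  rw [Subgroup.mem_centIn] at hy hz
  exact commute_trans hφ hy.1 hx hz.1 h1 hy.2 hz.2.symm

omit hφ in
theorem exists_ad_eq_smul_of_log_eq_smul {x g : Γ} (h1 : x ≠ 1)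
    {s : K} (hs : S.log (g * x * g⁻¹) = s • S.log x)
    (hg : g * x * g⁻¹ * x = x * (g * x * g⁻¹)) :
    S.ad g (S.log x) = s • S.log x ∧ S.log x s = 0 :=
  ⟨by rw [ad_log, hs], (commute_iff_of_log_eq_smul h1 hs).mp hg.symm⟩

/-- The normalizer in `fixer φ` of the centralizer of a nontrivial element is metabelian. -/
theorem commutator_mem_centIn {x g h : Γ} (hx : x ∈ S.fixer φ) (h1 : x ≠ 1)
    (hg : g ∈ S.fixer φ) (hh : h ∈ S.fixer φ) (hgN : g ∈ Subgroup.normalizer ((S.fixer φ).centIn x : Set Γ))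
    (hhN : h ∈ Subgroup.normalizer ((S.fixer φ).centIn x : Set Γ)) : ⁅g, h⁆ ∈ (S.fixer φ).centIn x := by
  have key : ∀ g ∈ S.fixer φ, g ∈ Subgroup.normalizer ((S.fixer φ).centIn x : Set Γ) →
      ∃ s : K, s ≠ 0 ∧ S.ad g (S.log x) = s • S.log x ∧ S.log x s = 0 := by
    intro g hg hgN
    obtain ⟨s, hs⟩ := exists_log_eq_smul hφ hx (mul_mem (mul_mem hg hx) (inv_mem hg)) h1
    have h2 := exists_ad_eq_smul_of_log_eq_smul h1 hs (commute_of_mem_normalizer_centIn hx hgN)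
    refine ⟨s, ?_, h2⟩
    rintro rfl
    exact S.ad_ne_zero g (S.log_ne_zero h1) (by rw [h2.1, zero_smul])
  obtain ⟨s, hs0, hs, hsx⟩ := key g hg hgN
  obtain ⟨t, ht0, ht, htx⟩ := key h hh hhN
  have hc : ⁅g, h⁆ ∈ S.fixer φ := by
    rw [commutatorElement_def]
    exact mul_mem (mul_mem (mul_mem hg hh) (inv_mem hg)) (inv_mem hh)
  refine Subgroup.mem_centIn.mpr ⟨hc, S.commute_iff_ad.mpr ?_⟩
  have fix : ∀ y ∈ S.fixer φ, ∀ r : K, S.log x r = 0 → S.act y r = r := fun y hy r hr =>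
    act_eq_of_mem_fixer hφ hx hy h1 hr
  -- The multipliers `s`, `t` are constants of `log x`, hence fixed by all of `fixer φ`. So `gh` and
  -- `hg` have the same multiplier, and `⁅g, h⁆` fixes `log x`.
  have e1 : S.ad (g * h) (S.log x) = (s * t) • S.log x := by
    rw [ad_mul, ht, ad_smul, hs, fix g hg t htx, smul_smul, mul_comm]
  have e2 : S.ad (h * g) (S.log x) = (s * t) • S.log x := by
    rw [ad_mul, hs, ad_smul, ht, fix h hh s hsx, smul_smul]
  have e3 : g * h = ⁅g, h⁆ * (h * g) := by rw [commutatorElement_def]; group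
  rw [e3, ad_mul, e2, ad_smul, map_mul, fix _ hc s hsx, fix _ hc t htx] at e1
  have hst : s * t ≠ 0 := mul_ne_zero hs0 ht0
  exact (smul_right_injective _ hst) e1

end Fixer

/-! ### The group of flows along a derivation -/

/-- The elements that fix `X` and its constants. -/
def leafGroup (X : Derivation ℂ K K) : Subgroup Γ where
  carrier := {g | S.ad g X = X ∧ ∀ f, X f = 0 → S.act g f = f}
  mul_mem' {g h} hg hh := ⟨by rw [ad_mul, hh.1, hg.1],
    fun f hf => by rw [act_mul, hh.2 f hf, hg.2 f hf]⟩
  one_mem' := ⟨S.ad_one X, fun f _ => S.act_one f⟩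
  inv_mem' {g} hg := ⟨by conv_lhs => rw [← hg.1, ad_inv_ad],
    fun f hf => by conv_lhs => rw [← hg.2 f hf, act_inv_act]⟩

theorem eq_zero_of_smul_add_smul_eq_zero {X Y : Derivation ℂ K K} (h0 : X ≠ 0)
    (hXY : ∀ s : K, Y ≠ s • X) {p q : K} (h : p • X + q • Y = 0) : p = 0 ∧ q = 0 := by
  have hq : q = 0 := by
    by_contra hq
    refine hXY (-(q⁻¹ * p)) ?_
    have := congrArg (fun D => q⁻¹ • D) h
    simp only [smul_add, smul_smul, inv_mul_cancel₀ hq, one_smul, smul_zero] at this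
    rw [neg_smul, eq_neg_iff_add_eq_zero, add_comm]; exact this
  subst hq
  refine ⟨?_, rfl⟩
  by_contra hp
  rw [zero_smul, add_zero] at h
  exact h0 ((smul_eq_zero.mp h).resolve_left hp)

/-- If `log g` is independent of `X`, write `log h = p X + q log g`. Commutation with `X` makes `p`,
`q` constants of `X`, which `g` fixes, so the logarithms commute. If neither logarithm is
independent of `X`, both are multiples of `X` by constants of `X`. -/
theorem leafGroup_comm {X : Derivation ℂ K K} (hX : X ∈ S.raising) (h0 : X ≠ 0) {g h : Γ}
    (hg : g ∈ S.leafGroup X) (hh : h ∈ S.leafGroup X) : g * h = h * g := by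
  have main : ∀ g ∈ S.leafGroup X, ∀ h ∈ S.leafGroup X, (∀ s : K, S.log g ≠ s • X) →
      g * h = h * g := by
    intro g hg h hh hind
    obtain ⟨p, q, hpq⟩ := S.exists_eq_smul_add_smul hX (S.log_mem_raising g)
      (S.log_mem_raising h) h0 hind
    have e1 := (S.ad_eq_iff hX).mp hg.1
    have e2 := (S.ad_eq_iff hX).mp hh.1
    have e3 : X p • X + X q • S.log g = 0 := by
      ext f
      have := e2 f
      simp only [hpq, Derivation.add_apply, Derivation.smul_apply, smul_eq_mul, map_add,
        Derivation.leibniz, e1] at this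
      simp only [Derivation.add_apply, Derivation.smul_apply, smul_eq_mul, Derivation.zero_apply]
      linear_combination this
    obtain ⟨hp, hq⟩ := eq_zero_of_smul_add_smul_eq_zero h0 hind e3
    have hp' := S.act_eq_iff.mp (hg.2 p hp)
    have hq' := S.act_eq_iff.mp (hg.2 q hq)
    rw [S.commute_iff_log]
    intro f
    simp only [hpq, Derivation.add_apply, Derivation.smul_apply, smul_eq_mul, map_add,
        Derivation.leibniz, hp', hq', e1]
    ring
  by_cases h1 : ∀ s : K, S.log g ≠ s • X
  · exact main g hg h hh h1
  by_cases h2 : ∀ s : K, S.log h ≠ s • X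
  · exact (main h hh g hg h2).symm
  push Not at h1 h2
  obtain ⟨s, hs⟩ := h1
  obtain ⟨t, ht⟩ := h2
  have e1 := (S.ad_eq_iff hX).mp hg.1
  have e2 := (S.ad_eq_iff hX).mp hh.1
  rw [hs] at e1
  rw [ht] at e2
  rw [S.commute_iff_log, hs, ht]
  exact fun f => smul_comm_smul (apply_eq_zero_of_smul_comm h0 fun f => (e2 f).symm)
    (apply_eq_zero_of_smul_comm h0 fun f => (e1 f).symm) f

theorem ad_inv_eq_smul {X : Derivation ℂ K K} (h0 : X ≠ 0) {b : Γ} {t : K}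
    (h : S.ad b X = t • X) (ht : X t = 0) :
    ∃ t', S.ad b⁻¹ X = t' • X ∧ X t' = 0 ∧ t ≠ 0 := by
  have ht0 : t ≠ 0 := by
    rintro rfl
    exact S.ad_ne_zero b h0 (by rw [h, zero_smul])
  refine ⟨S.act b⁻¹ t⁻¹, ?_, ?_, ht0⟩
  · have h1 : X = t⁻¹ • S.ad b X := by rw [h, smul_smul, inv_mul_cancel₀ ht0, one_smul]
    conv_lhs => rw [h1, ad_smul, ad_inv_ad]
  · have h1 : S.ad b X t⁻¹ = 0 := by
      rw [h, Derivation.smul_apply, Derivation.leibniz_inv, ht]; simp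
    rw [ad_apply] at h1
    exact (map_eq_zero_iff _ (S.act b).injective).mp h1

/-- Scaling `X` preserves its constants, and the multiplier `t`, being one of them, is fixed by the
conjugated elements. -/
theorem mem_normalizer_leafGroup {X : Derivation ℂ K K} (h0 : X ≠ 0) {b : Γ} {t : K}
    (h : S.ad b X = t • X) (ht : X t = 0) : b ∈ Subgroup.normalizer (S.leafGroup X : Set Γ) := by
  have key : ∀ (b : Γ) (t : K), S.ad b X = t • X → X t = 0 → ∀ g ∈ S.leafGroup X,
      b * g * b⁻¹ ∈ S.leafGroup X := by
    intro b t h ht g hg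
    have hfix : ∀ f, X f = 0 → S.act (b * g * b⁻¹) f = f := by
      intro f hf
      have h1 : S.ad b X f = 0 := by rw [h, Derivation.smul_apply, hf, smul_zero]
      rw [ad_apply] at h1
      have h2 := hg.2 _ ((map_eq_zero_iff _ (S.act b).injective).mp h1)
      rw [act_mul, act_mul, h2, act_act_inv]
    refine ⟨?_, hfix⟩
    obtain ⟨-, -, -, ht0⟩ := S.ad_inv_eq_smul h0 h ht
    have e1 : S.ad (b * g * b⁻¹) (S.ad b X) = S.ad b X := by
      rw [← ad_mul, inv_mul_cancel_right, ad_mul, hg.1]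
    rw [h, ad_smul, hfix t ht] at e1
    have := congrArg (fun D => t⁻¹ • D) e1
    simpa [smul_smul, inv_mul_cancel₀ ht0] using this
  obtain ⟨t', h', ht', -⟩ := S.ad_inv_eq_smul h0 h ht
  rw [Subgroup.mem_normalizer_iff]
  refine fun g => ⟨key b t h ht g, fun hg => ?_⟩
  have := key b⁻¹ t' h' ht' _ hg
  have e : b⁻¹ * (b * g * b⁻¹) * b⁻¹⁻¹ = g := by group
  rwa [e] at this

/-! ### Abelian groups of rank two -/

section RankTwo

variable {S} {x y : Γ} (hxy : x * y = y * x) (h1 : x ≠ 1) (hind : ∀ s : K, S.log y ≠ s • S.log x)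
include h1 hind

theorem mem_range_of_act_eq {f : K} (hx : S.act x f = f) (hy : S.act y f = f) :
    f ∈ Set.range (algebraMap ℂ K) :=
  S.mem_range_of_apply_eq_zero (S.log_mem_raising x) (S.log_mem_raising y) (S.log_ne_zero h1) hind
    (S.act_eq_iff.mp hx) (S.act_eq_iff.mp hy)

include hxy

/-- By uniqueness, the coefficients of `U` over `K` are invariant under `x` and `y`; a rank two
group has only constant invariants. -/
theorem exists_eq_const_combination {U : Derivation ℂ K K} (hU : U ∈ S.raising)
    (hxU : S.ad x U = U) (hyU : S.ad y U = U) : ∃ p q : ℂ, U = p • S.log x + q • S.log y := by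
  obtain ⟨p, q, hpq⟩ := S.exists_eq_smul_add_smul (S.log_mem_raising x) (S.log_mem_raising y) hU
    (S.log_ne_zero h1) hind
  have e : ∀ g, S.ad g (S.log x) = S.log x → S.ad g (S.log y) = S.log y → S.ad g U = U →
      S.act g p = p ∧ S.act g q = q := by
    intro g hgx hgy hgU
    have e1 : S.ad g U = S.act g p • S.log x + S.act g q • S.log y := by
      conv_lhs => rw [hpq, ad_add, ad_smul, ad_smul, hgx, hgy]
    rw [hgU] at e1
    have e2 : (S.act g p - p) • S.log x + (S.act g q - q) • S.log y = 0 := by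
      have e3 := e1.symm.trans hpq
      rw [sub_smul, sub_smul, sub_add_sub_comm, e3, sub_self]
    obtain ⟨h2, h3⟩ := eq_zero_of_smul_add_smul_eq_zero (S.log_ne_zero h1) hind e2
    exact ⟨sub_eq_zero.mp h2, sub_eq_zero.mp h3⟩
  have ex := e x (S.commute_iff_ad.mp rfl) (S.commute_iff_ad.mp hxy) hxU
  have ey := e y (S.commute_iff_ad.mp hxy.symm) (S.commute_iff_ad.mp rfl) hyU
  obtain ⟨c, hc⟩ := mem_range_of_act_eq h1 hind ex.1 ey.1
  obtain ⟨d, hd⟩ := mem_range_of_act_eq h1 hind ex.2 ey.2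
  refine ⟨c, d, ?_⟩
  rw [hpq, ← hc, ← hd, algebraMap_smul, algebraMap_smul]

omit h1 hind in
theorem const_combination_comm (p q r s : ℂ) (f : K) :
    (p • S.log x + q • S.log y) ((r • S.log x + s • S.log y) f) =
    (r • S.log x + s • S.log y) ((p • S.log x + q • S.log y) f) := by
  have := S.commute_iff_log.mp hxy f
  simp only [Derivation.add_apply, Derivation.smul_apply, map_add, Derivation.map_smul, this,
    smul_add, smul_smul]
  rw [mul_comm p r, mul_comm p s, mul_comm q r, mul_comm q s]
  abel

theorem commute_of_commute_rank_two {g h : Γ} (hgx : g * x = x * g) (hgy : g * y = y * g)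
    (hhx : h * x = x * h) (hhy : h * y = y * h) : g * h = h * g := by
  obtain ⟨p, q, hpq⟩ := exists_eq_const_combination hxy h1 hind (S.log_mem_raising g)
    (S.commute_iff_ad.mp hgx.symm) (S.commute_iff_ad.mp hgy.symm)
  obtain ⟨r, s, hrs⟩ := exists_eq_const_combination hxy h1 hind (S.log_mem_raising h)
    (S.commute_iff_ad.mp hhx.symm) (S.commute_iff_ad.mp hhy.symm)
  rw [S.commute_iff_log, hpq, hrs]
  exact const_combination_comm hxy r s p q

end RankTwo

end LogAction


/-! ### Derived series and solvability criteria -/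

section DerivedSeries

variable {Γ : Type*} [Group Γ]

/-- The derived series of a subgroup, as subgroups of the ambient group. -/
def Subgroup.derivedTerm (P : Subgroup Γ) : ℕ → Subgroup Γ
  | 0 => P
  | n + 1 => ⁅P.derivedTerm n, P.derivedTerm n⁆

theorem Subgroup.map_derivedSeries_subtype (P : Subgroup Γ) (n : ℕ) :
    (derivedSeries P n).map P.subtype = P.derivedTerm n := by
  induction n with
  | zero => rw [derivedSeries_zero, ← MonoidHom.range_eq_map, Subgroup.range_subtype]; rfl
  | succ n ih => rw [derivedSeries_succ, Subgroup.map_commutator, ih]; rfl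

theorem Subgroup.exists_derivedTerm_eq_bot (P : Subgroup Γ) (h : Group.IsSolvable P) :
    ∃ n, P.derivedTerm n = ⊥ := by
  obtain ⟨n, hn⟩ := h.solvable
  exact ⟨n, by rw [← P.map_derivedSeries_subtype, hn, Subgroup.map_bot]⟩

theorem Subgroup.mem_normalizer_commutator {P : Subgroup Γ} {g : Γ}
    (hg : g ∈ Subgroup.normalizer (P : Set Γ)) :
    g ∈ Subgroup.normalizer ((⁅P, P⁆ : Subgroup Γ) : Set Γ) := by
  rw [Subgroup.mem_normalizer_iff_map_conj_eq] at hg ⊢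
  rw [Subgroup.map_commutator, hg]

theorem Subgroup.mem_normalizer_derivedTerm {P : Subgroup Γ} {g : Γ}
    (hg : g ∈ Subgroup.normalizer (P : Set Γ)) (n : ℕ) :
    g ∈ Subgroup.normalizer (P.derivedTerm n : Set Γ) := by
  induction n with
  | zero => exact hg
  | succ n ih => exact Subgroup.mem_normalizer_commutator ih

theorem Subgroup.derivedTerm_le (P : Subgroup Γ) (n : ℕ) : P.derivedTerm n ≤ P := by
  induction n with
  | zero => exact le_rfl
  | succ n ih => exact (Subgroup.commutator_le_self _).trans ih

theorem Subgroup.derivedTerm_succ_le (P : Subgroup Γ) (n : ℕ) : P.derivedTerm (n + 1) ≤ ⁅P, P⁆ :=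
  Subgroup.commutator_mono (P.derivedTerm_le n) (P.derivedTerm_le n)

theorem commutatorElement_eq_one_iff_comm {x y : Γ} : ⁅x, y⁆ = 1 ↔ x * y = y * x :=
  commutatorElement_eq_one_iff_mul_comm

/-- The last nontrivial term of the derived series. -/
theorem Subgroup.exists_last_derivedTerm (P : Subgroup Γ) (h : Group.IsSolvable P) (hP : P ≠ ⊥) :
    ∃ E ≤ P, E ≠ ⊥ ∧ (∀ x ∈ E, ∀ y ∈ E, x * y = y * x) ∧
      (∀ g ∈ Subgroup.normalizer (P : Set Γ), g ∈ Subgroup.normalizer (E : Set Γ)) ∧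
      ((∀ x ∈ P, ∀ y ∈ P, x * y = y * x) ∨ E ≤ ⁅P, P⁆) := by
  classical
  have hex := P.exists_derivedTerm_eq_bot h
  obtain ⟨n, hn⟩ : ∃ n, Nat.find hex = n + 1 := Nat.exists_eq_succ_of_ne_zero fun h0 =>
    hP (by have := Nat.find_spec hex; rwa [h0] at this)
  have hcomm : ∀ x ∈ P.derivedTerm n, ∀ y ∈ P.derivedTerm n, x * y = y * x := fun x hx y hy => by
    have h1 := Nat.find_spec hex
    rw [hn] at h1
    have h2 : ⁅x, y⁆ ∈ P.derivedTerm (n + 1) := Subgroup.commutator_mem_commutator hx hy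
    rw [h1, Subgroup.mem_bot] at h2
    exact commutatorElement_eq_one_iff_comm.mp h2
  refine ⟨P.derivedTerm n, P.derivedTerm_le n, Nat.find_min hex (by omega), hcomm,
    fun g hg => Subgroup.mem_normalizer_derivedTerm hg n, ?_⟩
  cases n with
  | zero => exact Or.inl hcomm
  | succ n => exact Or.inr (P.derivedTerm_succ_le n)

theorem Subgroup.isSolvable_of_le {P Q : Subgroup Γ} (h : P ≤ Q) (hQ : Group.IsSolvable Q) :
    Group.IsSolvable P :=
  Group.isSolvable_of_isSolvable_injective (Subgroup.inclusion_injective h)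

theorem Subgroup.isSolvable_of_forall_comm {P : Subgroup Γ} (h : ∀ x ∈ P, ∀ y ∈ P, x * y = y * x) :
    Group.IsSolvable P :=
  Group.isSolvable_of_comm fun a b => Subtype.ext (h a a.2 b b.2)

/-- A group whose commutators lie in a solvable group is solvable. -/
theorem Subgroup.isSolvable_of_commutator_mem {P Q : Subgroup Γ} (hQ : Group.IsSolvable Q)
    (h : ∀ x ∈ P, ∀ y ∈ P, ⁅x, y⁆ ∈ Q) : Group.IsSolvable P := by
  have hQP : Group.IsSolvable (Q ⊓ P : Subgroup Γ) := Subgroup.isSolvable_of_le inf_le_left hQ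
  refine Group.isSolvable_of_ker_le_range (Subgroup.inclusion (inf_le_right : Q ⊓ P ≤ P))
    (Abelianization.of (G := P)) ?_
  rw [Abelianization.ker_of, _root_.commutator_def, Subgroup.commutator_le]
  exact fun x _ y _ => ⟨⟨⁅(x : Γ), (y : Γ)⁆, h x x.2 y y.2, (⁅x, y⁆ : P).2⟩, Subtype.ext rfl⟩

theorem Subgroup.exists_mem_ne_one {P : Subgroup Γ} (h : P ≠ ⊥) : ∃ x ∈ P, x ≠ 1 := by
  by_contra! h'
  exact h ((Subgroup.eq_bot_iff_forall P).mpr h')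

theorem Subgroup.mem_normalizer_of_conj {P : Subgroup Γ} {g : Γ} (h : ∀ x ∈ P, g * x * g⁻¹ ∈ P)
    (h' : ∀ x ∈ P, g⁻¹ * x * g ∈ P) : g ∈ Subgroup.normalizer (P : Set Γ) := by
  rw [Subgroup.mem_normalizer_iff]
  refine fun x => ⟨h x, fun hx => ?_⟩
  have := h' _ hx
  have e : g⁻¹ * (g * x * g⁻¹) * g = x := by group
  rwa [e] at this

theorem Subgroup.conj_mem_of_mem_normalizer {P : Subgroup Γ} {g x : Γ}
    (hg : g ∈ Subgroup.normalizer (P : Set Γ)) (hx : x ∈ P) : g * x * g⁻¹ ∈ P :=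
  (Subgroup.mem_normalizer_iff.mp hg x).mp hx

theorem Subgroup.inv_conj_mem_of_mem_normalizer {P : Subgroup Γ} {g x : Γ}
    (hg : g ∈ Subgroup.normalizer (P : Set Γ)) (hx : x ∈ P) : g⁻¹ * x * g ∈ P :=
  (Subgroup.mem_normalizer_iff''.mp hg x).mp hx

theorem Subgroup.closure_union_le_normalizer {Z : Subgroup Γ} {A B : Set Γ} (hA : A ⊆ Z)
    (hB : ∀ b ∈ B, b ∈ Subgroup.normalizer (Z : Set Γ)) :
    Subgroup.closure (A ∪ B) ≤ Subgroup.normalizer (Z : Set Γ) := by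
  rw [Subgroup.closure_le]
  rintro x (hx | hx)
  · exact Subgroup.le_normalizer (hA hx)
  · exact hB x hx

/-- If `B` normalizes `Z ⊇ A` and its elements commute modulo `Z`, then the group generated by
`A ∪ B` is abelian modulo `Z`. -/
theorem Subgroup.commutator_mem_of_mem_closure_union {Z : Subgroup Γ} {A B : Set Γ} (hA : A ⊆ Z)
    (hB : ∀ b ∈ B, b ∈ Subgroup.normalizer (Z : Set Γ))
    (hBB : ∀ b ∈ B, ∀ b' ∈ B, ⁅b, b'⁆ ∈ Z) :
    ∀ x ∈ Subgroup.closure (A ∪ B), ∀ y ∈ Subgroup.closure (A ∪ B), ⁅x, y⁆ ∈ Z := by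
  have hN := Subgroup.closure_union_le_normalizer hA hB
  have left : ∀ z ∈ Z, ∀ y ∈ Subgroup.normalizer (Z : Set Γ), ⁅z, y⁆ ∈ Z := fun z hz y hy => by
    have := mul_mem hz (Subgroup.conj_mem_of_mem_normalizer hy (inv_mem hz))
    rw [commutatorElement_def]
    rwa [← mul_assoc, ← mul_assoc] at this
  have swap : ∀ x y : Γ, ⁅x, y⁆ ∈ Z → ⁅y, x⁆ ∈ Z := fun x y h => by
    rw [← commutatorElement_inv]; exact inv_mem h
  -- commutators with a fixed element form a subgroup
  have key : ∀ y ∈ Subgroup.normalizer (Z : Set Γ), (∀ x ∈ A ∪ B, ⁅x, y⁆ ∈ Z) →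
      ∀ x ∈ Subgroup.closure (A ∪ B), ⁅x, y⁆ ∈ Z := by
    intro y hy hgen x hx
    induction hx using Subgroup.closure_induction with
    | mem x hx => exact hgen x hx
    | one => rw [commutatorElement_one_left]; exact one_mem Z
    | mul x x' hx hx' h h' =>
      have e : ⁅x * x', y⁆ = x * ⁅x', y⁆ * x⁻¹ * ⁅x, y⁆ := by
        simp only [commutatorElement_def]; group
      rw [e]
      exact mul_mem (Subgroup.conj_mem_of_mem_normalizer (hN hx) h') h
    | inv x hx h =>
      have e : ⁅x⁻¹, y⁆ = x⁻¹ * ⁅x, y⁆⁻¹ * x := by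
        simp only [commutatorElement_def]; group
      rw [e]
      exact Subgroup.inv_conj_mem_of_mem_normalizer (hN hx) (inv_mem h)
  have gen : ∀ x ∈ A ∪ B, ∀ y ∈ A ∪ B, ⁅x, y⁆ ∈ Z := by
    rintro x (hx | hx) y hy
    · exact left x (hA hx) y (hN (Subgroup.subset_closure hy))
    · rcases hy with hy | hy
      · exact swap _ _ (left y (hA hy) x (hB x hx))
      · exact hBB x hx y hy
  intro x hx y hy
  -- Pass from generators to the closure in one argument, exchange the arguments, and do it again.
  refine key y (hN hy) (fun x hx => swap _ _ ?_) x hx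
  exact key x (hN (Subgroup.subset_closure hx)) (fun y hy => gen y hy x hx) y hy

theorem Subgroup.isSolvable_closure_union {Z : Subgroup Γ} (hZ : Group.IsSolvable Z) {A B : Set Γ}
    (hA : A ⊆ Z) (hB : ∀ b ∈ B, b ∈ Subgroup.normalizer (Z : Set Γ))
    (hBB : ∀ b ∈ B, ∀ b' ∈ B, ⁅b, b'⁆ ∈ Z) : Group.IsSolvable (Subgroup.closure (A ∪ B)) :=
  Subgroup.isSolvable_of_commutator_mem hZ
    (Subgroup.commutator_mem_of_mem_closure_union hA hB hBB)

/-- The elements commuting with `A` modulo `T`. -/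
def Subgroup.centMod (T : Subgroup Γ) (A : Set Γ) : Subgroup Γ where
  carrier := {g | g ∈ Subgroup.normalizer (T : Set Γ) ∧ ∀ a ∈ A, ⁅a, g⁆ ∈ T}
  mul_mem' {g h} hg hh := ⟨mul_mem hg.1 hh.1, fun a ha => by
    have e : ⁅a, g * h⁆ = ⁅a, g⁆ * (g * ⁅a, h⁆ * g⁻¹) := by
      simp only [commutatorElement_def]; group
    rw [e]
    exact mul_mem (hg.2 a ha) (Subgroup.conj_mem_of_mem_normalizer hg.1 (hh.2 a ha))⟩
  one_mem' := ⟨one_mem _, fun a _ => by rw [commutatorElement_one_right]; exact one_mem T⟩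
  inv_mem' {g} hg := ⟨inv_mem hg.1, fun a ha => by
    have e : ⁅a, g⁻¹⁆ = g⁻¹ * ⁅a, g⁆⁻¹ * g := by
      simp only [commutatorElement_def]; group
    rw [e]
    exact Subgroup.inv_conj_mem_of_mem_normalizer hg.1 (inv_mem (hg.2 a ha))⟩

end DerivedSeries

/-! ### Invariants of solvable groups -/

namespace LogAction

variable {Γ K : Type*} [Group Γ] [Field K] [Algebra ℂ K] {S : LogAction Γ K}

/-- A solvable group normalizing `fixer φ` is abelian modulo `fixer φ`. -/
theorem commutator_le_fixer {φ : K} (hφ : φ ∉ Set.range (algebraMap ℂ K)) {x0 : Γ} (h1 : x0 ≠ 1)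
    (hx0 : x0 ∈ S.fixer φ) {H : Subgroup Γ} (hH : Group.IsSolvable H)
    (hN : H ≤ Subgroup.normalizer (S.fixer φ : Set Γ)) : ⁅H, H⁆ ≤ S.fixer φ := by
  classical
  have hex : ∃ n, H.derivedTerm n ≤ S.fixer φ := by
    obtain ⟨n, hn⟩ := H.exists_derivedTerm_eq_bot hH
    exact ⟨n, by rw [hn]; exact bot_le⟩
  have hspec := Nat.find_spec hex
  cases hn : Nat.find hex with
  | zero =>
    rw [hn] at hspec
    exact (Subgroup.commutator_le_self H).trans hspec
  | succ m =>
    rw [hn] at hspec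
    -- Choose `x` outside `fixer φ` in the last derived term not contained in it. It commutes with
    -- its conjugates modulo `fixer φ`, so it is central in `H` modulo `fixer φ`, and its
    -- centralizer there is abelian.
    obtain ⟨x, hx, hxT⟩ := SetLike.not_le_iff_exists.mp (Nat.find_min hex (show m < _ by omega))
    have hxH := H.derivedTerm_le m hx
    have hc : ∀ h ∈ H, ⁅x, h⁆ ∈ S.fixer φ := fun h hh => by
      have h2 : h * x * h⁻¹ ∈ H.derivedTerm m := Subgroup.conj_mem_of_mem_normalizer
        (Subgroup.mem_normalizer_derivedTerm (Subgroup.le_normalizer hh) m) hx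
      have h3 := commutator_mem_of_conj hφ h1 hx0 (hN hxH) hxT (hN hh)
        (hspec (Subgroup.commutator_mem_commutator hx h2))
      rw [← commutatorElement_inv]
      exact inv_mem h3
    rw [Subgroup.commutator_le]
    exact fun g hg h hh =>
      commutator_mem_trans hφ h1 hx0 (hN hxH) hxT (hN hg) (hN hh) (hc g hg) (hc h hh)

/-- The centralizer of an abelian group without nonconstant invariants is abelian. -/
theorem commute_of_commute_of_invariants_const {E : Subgroup Γ} (hE : E ≠ ⊥)
    (hcomm : ∀ x ∈ E, ∀ y ∈ E, x * y = y * x)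
    (hconst : ∀ φ : K, (∀ e ∈ E, S.act e φ = φ) → φ ∈ Set.range (algebraMap ℂ K)) {g h : Γ}
    (hg : ∀ e ∈ E, g * e = e * g) (hh : ∀ e ∈ E, h * e = e * h) : g * h = h * g := by
  obtain ⟨e0, he0, h1⟩ := Subgroup.exists_mem_ne_one hE
  -- With two independent logarithms, centralizing logarithms are constant combinations of them.
  -- Otherwise the constants of `log e0` are invariants of `E`, hence complex numbers, and the
  -- centralizer lies in `leafGroup (log e0)`.
  by_cases hr : ∃ e ∈ E, ∀ s : K, S.log e ≠ s • S.log e0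
  · obtain ⟨e, he, hind⟩ := hr
    exact commute_of_commute_rank_two (hcomm _ he0 e he) h1 hind (hg _ he0) (hg e he) (hh _ he0)
      (hh e he)
  · push Not at hr
    have hC : ∀ f, S.log e0 f = 0 → f ∈ Set.range (algebraMap ℂ K) := fun f hf =>
      hconst f fun e he => by
        obtain ⟨s, hs⟩ := hr e he
        rw [act_eq_iff, hs, Derivation.smul_apply, hf, smul_zero]
    have hmem : ∀ g : Γ, (∀ e ∈ E, g * e = e * g) → g ∈ S.leafGroup (S.log e0) := fun g hg =>
      ⟨S.commute_iff_ad.mp (hg _ he0), fun f hf => by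
        obtain ⟨c, hc⟩ := hC f hf
        rw [← hc, AlgEquiv.commutes]⟩
    exact S.leafGroup_comm (S.log_mem_raising _) (S.log_ne_zero h1) (hmem g hg) (hmem h hh)

/-- The derived group of a nonabelian solvable group has a nonconstant invariant. -/
theorem exists_commutator_le_fixer {H : Subgroup Γ} (hH : Group.IsSolvable H)
    (hna : ¬ ∀ x ∈ H, ∀ y ∈ H, x * y = y * x) :
    ∃ φ ∉ Set.range (algebraMap ℂ K), ⁅H, H⁆ ≤ S.fixer φ := by
  have hbot : H ≠ ⊥ := by
    rintro rfl
    refine hna fun x hx y hy => ?_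
    rw [Subgroup.mem_bot.mp hx, Subgroup.mem_bot.mp hy]
  obtain ⟨E, hEH, hE, hEc, hEN, hor⟩ := H.exists_last_derivedTerm hH hbot
  have hED : E ≤ ⁅H, H⁆ := hor.resolve_left hna
  have hconj : ∀ h ∈ H, ∀ e ∈ E, h * e * h⁻¹ ∈ E := fun h hh e he =>
    Subgroup.conj_mem_of_mem_normalizer (hEN h (Subgroup.le_normalizer hh)) he
  by_cases hK : ∃ φ ∉ Set.range (algebraMap ℂ K), ∀ e ∈ E, S.act e φ = φ
  · obtain ⟨φ, hφ, hEφ⟩ := hK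
    obtain ⟨e0, he0, h1⟩ := Subgroup.exists_mem_ne_one hE
    exact ⟨φ, hφ, commutator_le_fixer hφ h1 (hEφ _ he0) hH fun h hh =>
      mem_normalizer_of_conj_mem hφ h1 (hEφ _ he0) (hEφ _ (hconj h hh _ he0))⟩
  -- Suppose all invariants of `E` are constant. Since `H` is not abelian, it does not centralize
  -- `E`.
  exfalso
  push Not at hK
  have hK' : ∀ φ : K, (∀ e ∈ E, S.act e φ = φ) → φ ∈ Set.range (algebraMap ℂ K) := fun φ h => by
    by_contra hφ
    obtain ⟨e, he, hne⟩ := hK φ hφ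
    exact hne (h e he)
  obtain ⟨h, hh, e, he, hne⟩ : ∃ h ∈ H, ∃ e ∈ E, h * e ≠ e * h := by
    by_contra! hall
    exact hna fun x hx y hy => commute_of_commute_of_invariants_const hE hEc hK'
      (hall x hx) (hall y hy)
  have he2 : h * e * h⁻¹ ∈ E := hconj h hh e he
  set X := S.log e with hX
  set X2 := S.log (h * e * h⁻¹) with hX2
  have hXr : X ∈ S.raising := S.log_mem_raising e
  have hX2r : X2 ∈ S.raising := S.log_mem_raising _
  have h1 : e ≠ 1 := by rintro rfl; simp at hne
  have hX0 : X ≠ 0 := S.log_ne_zero h1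
  have had : S.ad h X = X2 := S.ad_log h e
  have hadE : ∀ e ∈ E, ∀ e' ∈ E, S.ad e' (S.log e) = S.log e := fun e he e' he' =>
    S.commute_iff_ad.mp (hEc e' he' e he)
  have hne2 : X2 ≠ X := fun h2 => hne (by
    rw [← had] at h2
    exact S.commute_iff_ad.mpr h2)
  -- A factor `s` would be `E`-invariant, hence constant, hence `1` by unipotence.
  have hind : ∀ s : K, X2 ≠ s • X := by
    intro s hs
    obtain ⟨c, hc⟩ := hK' s fun e' he' => by
      have h2 := hadE _ he2 e' he'
      rw [← hX2, hs, ad_smul, hadE e he e' he'] at h2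
      exact eq_of_smul_eq_smul hX0 h2
    obtain ⟨f, hf⟩ : ∃ f, X f ≠ 0 := by
      by_contra! h'
      exact hX0 (by ext f; simpa using h' f)
    have hc1 : c = 1 := S.eq_one_of_ad_eq_smul (g := h) hXr ⊤ (fun _ _ => trivial)
      (fun f _ => by rw [had, hs, ← hc, Derivation.smul_apply, algebraMap_smul]) trivial hf
    exact hne2 (by rw [hs, ← hc, hc1, map_one, one_smul])
  -- The `E`-invariant raising derivations are the complex plane spanned by `X` and `Y`, stable
  -- under `H`. Since `Y` has higher level than `X`, the action of `H` is triangular: it fixes `Y`,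
  -- and `X` modulo `Y`.
  set Y := X2 - X with hY
  have hYr : Y ∈ S.raising := Submodule.sub_mem _ hX2r hXr
  have hY0 : Y ≠ 0 := sub_ne_zero.mpr hne2
  have hVE : ∀ U ∈ S.raising, (∀ e ∈ E, S.ad e U = U) → ∃ p q : ℂ, U = p • X + q • Y := by
    intro U hU hfix
    obtain ⟨p, q, hpq⟩ := exists_eq_const_combination (hEc e he _ he2) h1 hind hU (hfix e he)
      (hfix _ he2)
    refine ⟨p + q, q, ?_⟩
    rw [hpq, hY, smul_sub, add_smul]
    abel
  have hfixX : ∀ e' ∈ E, S.ad e' X = X := hadE e he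
  have hfixY : ∀ e' ∈ E, S.ad e' Y = Y := fun e' he' => by
    rw [hY, ad_sub, hfixX e' he', hadE _ he2 e' he']
  have hfixad : ∀ g ∈ H, ∀ U, (∀ e ∈ E, S.ad e U = U) → ∀ e ∈ E, S.ad e (S.ad g U) = S.ad g U := by
    intro g hg U hU e he
    have h2 := hU _ (Subgroup.inv_conj_mem_of_mem_normalizer (hEN g (Subgroup.le_normalizer hg)) he)
    have e1 : e * g = g * (g⁻¹ * e * g) := by group
    rw [← ad_mul, e1, ad_mul, h2]
  obtain ⟨r, hr, hr'⟩ := S.exists_exact_level hXr hX0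
  have hYl : Y ∈ S.level (r + 1) := by rw [hY, ← had]; exact S.ad_sub_mem_level h hr
  have hlev : ∀ U ∈ S.level (r + 1), U ∈ S.raising → (∀ e ∈ E, S.ad e U = U) →
      ∃ q : ℂ, U = q • Y := by
    intro U hU hUr hfix
    obtain ⟨p, q, hpq⟩ := hVE U hUr hfix
    have hp : p = 0 := by
      by_contra hp
      refine hr' ?_
      have h2 : p • X ∈ S.level (r + 1) := by
        have : p • X = U - q • Y := by rw [hpq]; abel
        rw [this]
        exact Submodule.sub_mem _ hU (Submodule.smul_mem _ q hYl)
      have h3 := Submodule.smul_mem _ p⁻¹ h2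
      rwa [smul_smul, inv_mul_cancel₀ hp, one_smul] at h3
    exact ⟨q, by rw [hpq, hp, zero_smul, zero_add]⟩
  have hsubfix : ∀ g ∈ H, ∀ U, (∀ e ∈ E, S.ad e U = U) →
      ∀ e ∈ E, S.ad e (S.ad g U - U) = S.ad g U - U := fun g hg U hU e he => by
    rw [ad_sub, hU e he, hfixad g hg U hU e he]
  have hgX : ∀ g ∈ H, ∃ q : ℂ, S.ad g X - X = q • Y := fun g hg =>
    hlev _ (S.ad_sub_mem_level g hr) (Submodule.sub_mem _ (S.ad_mem_level g hXr) hXr)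
      (hsubfix g hg X hfixX)
  have hgY : ∀ g ∈ H, S.ad g Y = Y := by
    intro g hg
    obtain ⟨q, hq⟩ := hlev (S.ad g Y - Y)
      (Submodule.sub_mem _ (S.ad_mem_level g hYl) hYl)
      (Submodule.sub_mem _ (S.ad_mem_level g hYr) hYr) (hsubfix g hg Y hfixY)
    have hq' : S.ad g Y = (1 + q) • Y := by rw [add_smul, one_smul, ← hq]; abel
    obtain ⟨f, hf⟩ : ∃ f, Y f ≠ 0 := by
      by_contra! h'
      exact hY0 (by ext f; simpa using h' f)
    have := S.eq_one_of_ad_eq_smul (g := g) hYr ⊤ (fun _ _ => trivial)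
      (fun f _ => by rw [hq', Derivation.smul_apply]) trivial hf
    rw [hq', this, one_smul]
  -- If `Y` has only complex constants, then `H` lies in the abelian group `leafGroup Y`. Otherwise
  -- some `e'` in `E` moves a nonconstant `φ` killed by `Y`.
  by_cases hYc : ∀ f, Y f = 0 → f ∈ Set.range (algebraMap ℂ K)
  · refine hna fun x hx y hy => S.leafGroup_comm hYr hY0 ?_ ?_
    · exact ⟨hgY x hx, fun f hf => by obtain ⟨c, hc⟩ := hYc f hf; rw [← hc, AlgEquiv.commutes]⟩
    · exact ⟨hgY y hy, fun f hf => by obtain ⟨c, hc⟩ := hYc f hf; rw [← hc, AlgEquiv.commutes]⟩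
  push Not at hYc
  obtain ⟨φ, hYφ, hφ⟩ := hYc
  obtain ⟨e', he', hmove⟩ := hK φ hφ
  have hact : ∀ g ∈ H, ∀ f ∈ constants Y, S.act g f ∈ constants Y := fun g hg f hf => by
    have h2 := S.ad_apply_act g Y f
    have h3 : Y f = 0 := hf
    rw [hgY g hg, h3, map_zero] at h2
    exact h2
  have hlog : ∀ g ∈ H, ∀ f ∈ constants Y, S.log g f ∈ constants Y := fun g hg f hf =>
    S.log_mem_constants hYr (hact g hg) hf
  have hadU : ∀ g ∈ H, ∃ c : ℂ, S.ad g (S.log e') = S.log e' + c • Y := by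
    intro g hg
    obtain ⟨p, q, hpq⟩ := hVE _ (S.log_mem_raising e') (hadE e' he')
    obtain ⟨c, hc⟩ := hgX g hg
    refine ⟨p * c, ?_⟩
    rw [hpq, ad_add, ad_smul_const, ad_smul_const, hgY g hg, sub_eq_iff_eq_add.mp hc, smul_add,
      smul_smul]
    abel
  -- Conjugation by `g` changes `log e'` by a multiple of `Y`, invisible on the constants of `Y`.
  -- Hence every `log g` is there a complex multiple of `log e'`, and `⁅H, H⁆` fixes `φ`.
  have hcommU : ∀ g ∈ H, ∀ f ∈ constants Y, S.log e' (S.log g f) = S.log g (S.log e' f) := by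
    intro g hg f hf
    obtain ⟨c, hc⟩ := hadU g hg
    refine S.map_log_of_map_act (c := 1) (constants Y) (hact g hg) (S.log e' : K →ₗ[ℂ] K)
      (S.log_mem_raising e') (fun f hf => ?_) hf
    have h2 := S.ad_apply_act g (S.log e') f
    have h3 : Y (S.act g f) = 0 := hact g hg f hf
    rw [hc, Derivation.add_apply, Derivation.smul_apply, h3, smul_zero, add_zero] at h2
    exact h2
  have hUφ : S.log e' φ ≠ 0 := fun h2 => hmove (S.act_eq_iff.mpr h2)
  have hprop : ∀ g ∈ H, ∃ c : ℂ, ∀ f ∈ constants Y, S.log g f = c • S.log e' f := fun g hg =>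
    S.exists_const_smul_on_constants hYr hY0 (hlog e' (hEH he')) (hlog g hg) hYφ hUφ
      (hcommU g hg φ hYφ)
  have hfix : ⁅H, H⁆ ≤ S.fixer φ := by
    rw [Subgroup.commutator_le]
    intro x hx y hy
    obtain ⟨c, hc⟩ := hprop x hx
    obtain ⟨d, hd⟩ := hprop y hy
    refine S.act_commutator_eq (constants Y) (hact _ (inv_mem hx)) (hact _ (inv_mem hy))
      (fun f hf => S.act_comm_of_log_comm _ (hlog x hx) (hlog y hy) (fun f hf => ?_) hf) hYφ
    have hk := hlog e' (hEH he') f hf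
    rw [hc f hf, hd f hf, Derivation.map_smul, Derivation.map_smul, hc _ hk, hd _ hk, smul_comm]
  -- But `e'` belongs to `E ≤ ⁅H, H⁆` and moves `φ`.
  exact hmove (hfix (hED he'))

end LogAction


/-! ### Commutator towers: the nonabelian and rank one cases -/

/-- A subgroup `A` and a set `B` such that `B` conjugates `A` into the group `H`, the commutators of
`B` lie in `A`, and every element of `B` not commuting with `A` conjugates some nontrivial element of
`A` into `A`. -/
structure IsCommutatorTower {Γ : Type*} [Group Γ] (A H : Subgroup Γ) (B : Set Γ) : Prop where
  le : A ≤ H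
  conj_mem : ∀ b ∈ B, ∀ a ∈ A, b * a * b⁻¹ ∈ H
  inv_conj_mem : ∀ b ∈ B, ∀ a ∈ A, b⁻¹ * a * b ∈ H
  commutator_mem : ∀ b ∈ B, ∀ b' ∈ B, ⁅b, b'⁆ ∈ A
  commute_or : ∀ b ∈ B, (∀ a ∈ A, b * a = a * b) ∨ ∃ a ∈ A, a ≠ 1 ∧ b⁻¹ * a * b ∈ A

theorem commutator_conj {Γ : Type*} [Group Γ] (g x y : Γ) :
    g * ⁅x, y⁆ * g⁻¹ = ⁅g * x * g⁻¹, g * y * g⁻¹⁆ := by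
  simp only [commutatorElement_def]; group

theorem Subgroup.commutatorElement_mem {Γ : Type*} [Group Γ] {P : Subgroup Γ} {x y : Γ} (hx : x ∈ P)
    (hy : y ∈ P) : ⁅x, y⁆ ∈ P :=
  P.mul_mem (P.mul_mem (P.mul_mem hx hy) (P.inv_mem hx)) (P.inv_mem hy)

namespace LogAction

variable {Γ K : Type*} [Group Γ] [Field K] [Algebra ℂ K] {S : LogAction Γ K}

/-- A nonabelian solvable group normalizes some `fixer φ` containing its derived group, and the
centralizer therein of one of its elements. -/
theorem exists_le_normalizer_centIn (S : LogAction Γ K) {H : Subgroup Γ} (hH : Group.IsSolvable H)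
    {u v : Γ} (hu : u ∈ H) (hv : v ∈ H) (huv : u * v ≠ v * u) :
    ∃ φ ∉ Set.range (algebraMap ℂ K), ⁅H, H⁆ ≤ S.fixer φ ∧
      H ≤ Subgroup.normalizer (S.fixer φ : Set Γ) ∧ ∃ x ∈ H, x ∈ S.fixer φ ∧ x ≠ 1 ∧
        H ≤ Subgroup.normalizer ((S.fixer φ).centIn x : Set Γ) := by
  obtain ⟨φ, hφ, hT⟩ := exists_commutator_le_fixer (S := S) hH fun h => huv (h u hu v hv)
  have hd : ⁅u, v⁆ ∈ S.fixer φ := hT (Subgroup.commutator_mem_commutator hu hv)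
  have hd1 : ⁅u, v⁆ ≠ 1 := fun h => huv (commutatorElement_eq_one_iff_comm.mp h)
  have hdH : ⁅u, v⁆ ∈ H :=
    Subgroup.commutator_le_self H (Subgroup.commutator_mem_commutator hu hv)
  have hN : H ≤ Subgroup.normalizer (S.fixer φ : Set Γ) := fun h hh => by
    refine mem_normalizer_of_conj_mem hφ hd1 hd ?_
    rw [commutator_conj]
    exact hT (Subgroup.commutator_mem_commutator (mul_mem (mul_mem hh hu) (inv_mem hh))
      (mul_mem (mul_mem hh hv) (inv_mem hh)))
  have hP : Group.IsSolvable (H ⊓ S.fixer φ : Subgroup Γ) :=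
    Subgroup.isSolvable_of_le inf_le_left hH
  have hPbot : H ⊓ S.fixer φ ≠ ⊥ := fun h => hd1 (by
    have : ⁅u, v⁆ ∈ H ⊓ S.fixer φ := ⟨hdH, hd⟩
    rwa [h, Subgroup.mem_bot] at this)
  -- `H` normalizes the abelian group `E`, so any nontrivial `x` in `E` commutes with its conjugates
  -- by `H`, as `mem_normalizer_centIn` requires.
  obtain ⟨E, hEP, hE, hEc, hEN, -⟩ := (H ⊓ S.fixer φ).exists_last_derivedTerm hP hPbot
  obtain ⟨x, hx, hx1⟩ := Subgroup.exists_mem_ne_one hE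
  refine ⟨φ, hφ, hT, hN, x, (hEP hx).1, (hEP hx).2, hx1, fun h hh => ?_⟩
  have hhP : h ∈ Subgroup.normalizer ((H ⊓ S.fixer φ : Subgroup Γ) : Set Γ) :=
    Subgroup.mem_normalizer_of_conj
      (fun z hz => ⟨H.mul_mem (H.mul_mem hh hz.1) (H.inv_mem hh),
        Subgroup.conj_mem_of_mem_normalizer (hN hh) hz.2⟩)
      (fun z hz => ⟨H.mul_mem (H.mul_mem (H.inv_mem hh) hz.1) hh,
        Subgroup.inv_conj_mem_of_mem_normalizer (hN hh) hz.2⟩)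
  exact mem_normalizer_centIn hφ (hEP hx).2 hx1 (hN hh)
    (hEc _ (Subgroup.conj_mem_of_mem_normalizer (hEN h hhP) hx) _ hx)

section Fixer

variable {φ : K} (hφ : φ ∉ Set.range (algebraMap ℂ K))
include hφ

theorem isSolvable_centIn {x : Γ} (hx : x ∈ S.fixer φ) (h1 : x ≠ 1) :
    Group.IsSolvable ((S.fixer φ).centIn x) :=
  Subgroup.isSolvable_of_forall_comm fun _ hy _ hz => commute_of_mem_centIn hφ hx h1 hy hz

theorem isSolvable_of_abelian_mod_fixer {x : Γ} (hx : x ∈ S.fixer φ) (h1 : x ≠ 1)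
    {W : Subgroup Γ} (hW : ∀ y ∈ W, ∀ z ∈ W, ⁅y, z⁆ ∈ S.fixer φ)
    (hN : W ≤ Subgroup.normalizer ((S.fixer φ).centIn x : Set Γ)) : Group.IsSolvable W := by
  have hM : Group.IsSolvable (S.fixer φ ⊓
      Subgroup.normalizer ((S.fixer φ).centIn x : Set Γ) : Subgroup Γ) :=
    Subgroup.isSolvable_of_commutator_mem (isSolvable_centIn hφ hx h1) fun y hy z hz =>
      commutator_mem_centIn hφ hx h1 hy.1 hz.1 hy.2 hz.2
  refine Subgroup.isSolvable_of_commutator_mem hM fun y hy z hz => ⟨hW y hy z hz,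
    Subgroup.commutatorElement_mem (hN hy) (hN hz)⟩

/-- Solvability when everything normalizes `fixer φ` and a centralizer in it. -/
theorem isSolvable_closure_of_le_normalizer {x : Γ} (hx : x ∈ S.fixer φ) (h1 : x ≠ 1)
    {A : Subgroup Γ} {B : Set Γ} (hA : ∀ a ∈ A, ∀ a' ∈ A, ⁅a, a'⁆ ∈ S.fixer φ)
    (hAB : ∀ b ∈ B, ∀ a ∈ A, ∀ a' ∈ A, ⁅a, b * a' * b⁻¹⁆ ∈ S.fixer φ)
    (hBB : ∀ b ∈ B, ∀ b' ∈ B, ⁅b, b'⁆ ∈ A)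
    (hAN : A ≤ Subgroup.normalizer (S.fixer φ : Set Γ))
    (hBN : B ⊆ Subgroup.normalizer (S.fixer φ : Set Γ))
    (hAN' : A ≤ Subgroup.normalizer ((S.fixer φ).centIn x : Set Γ))
    (hBN' : B ⊆ Subgroup.normalizer ((S.fixer φ).centIn x : Set Γ)) :
    Group.IsSolvable (Subgroup.closure (A ∪ B)) := by
  -- It suffices to find `Z` containing `A`, normalized by `B` and abelian modulo `fixer φ`: the
  -- commutators of the whole group then lie in `Z ⊓ N`, solvable by the preceding lemma.
  have main : ∀ Z : Subgroup Γ, A ≤ Z → (∀ b ∈ B, b ∈ Subgroup.normalizer (Z : Set Γ)) →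
      (∀ y ∈ Z, ∀ z ∈ Z, ⁅y, z⁆ ∈ S.fixer φ) → Group.IsSolvable (Subgroup.closure (A ∪ B)) := by
    intro Z hAZ hBZ hZ
    set N := Subgroup.normalizer ((S.fixer φ).centIn x : Set Γ)
    have hGN : Subgroup.closure (A ∪ B) ≤ N :=
      (Subgroup.closure_le _).mpr (Set.union_subset hAN' hBN')
    have hZN : Group.IsSolvable (Z ⊓ N : Subgroup Γ) :=
      isSolvable_of_abelian_mod_fixer hφ hx h1 (fun y hy z hz => hZ y hy.1 z hz.1) inf_le_right
    refine Subgroup.isSolvable_of_commutator_mem hZN fun y hy z hz => ⟨?_, ?_⟩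
    · exact Subgroup.commutator_mem_of_mem_closure_union hAZ hBZ
        (fun b hb b' hb' => hAZ (hBB b hb b' hb')) y hy z hz
    · exact Subgroup.commutatorElement_mem (hGN hy) (hGN hz)
  by_cases hAT : A ≤ S.fixer φ
  · refine main _ hAT hBN fun y hy z hz => Subgroup.commutatorElement_mem hy hz
  obtain ⟨a0, ha0, ha0T⟩ := SetLike.not_le_iff_exists.mp hAT
  have conj_notMem : ∀ b ∈ Subgroup.normalizer (S.fixer φ : Set Γ), b * a0 * b⁻¹ ∉ S.fixer φ :=
    fun b hb h => ha0T ((Subgroup.mem_normalizer_iff.mp hb a0).mpr h)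
  have swap : ∀ x y : Γ, ⁅x, y⁆ ∈ S.fixer φ → ⁅y, x⁆ ∈ S.fixer φ := fun x y h => by
    rw [← commutatorElement_inv]; exact inv_mem h
  -- If `A` is not inside `fixer φ`, take for `Z` the elements commuting with `A` modulo `fixer φ`.
  -- Both `b z b⁻¹` and the elements of `A` commute, modulo `fixer φ`, with `b a0 b⁻¹`, which is
  -- nontrivial there, so transitivity applies.
  have stable : ∀ b ∈ Subgroup.normalizer (S.fixer φ : Set Γ),
      (∀ a ∈ A, ⁅a, b * a0 * b⁻¹⁆ ∈ S.fixer φ) → ∀ z ∈ (S.fixer φ).centMod (A : Set Γ),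
      b * z * b⁻¹ ∈ (S.fixer φ).centMod (A : Set Γ) := by
    intro b hb hab z hz
    have hzb : b * z * b⁻¹ ∈ Subgroup.normalizer (S.fixer φ : Set Γ) :=
      mul_mem (mul_mem hb hz.1) (inv_mem hb)
    refine ⟨hzb, fun a ha => ?_⟩
    refine commutator_mem_trans hφ h1 hx (mul_mem (mul_mem hb (hAN ha0)) (inv_mem hb))
      (conj_notMem b hb) (hAN ha) hzb (swap _ _ (hab a ha)) ?_
    rw [← commutator_conj]
    exact Subgroup.conj_mem_of_mem_normalizer hb (hz.2 a0 ha0)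
  refine main ((S.fixer φ).centMod (A : Set Γ)) (fun a ha => ⟨hAN ha, fun a' ha' => hA a' ha' a ha⟩)
    (fun b hb => Subgroup.mem_normalizer_of_conj ?_ ?_) fun y hy z hz =>
      commutator_mem_trans hφ h1 hx (hAN ha0) ha0T hy.1 hz.1 (hy.2 a0 ha0) (hz.2 a0 ha0)
  · exact stable b (hBN hb) fun a ha => hAB b hb a ha a0 ha0
  · have := stable b⁻¹ (inv_mem (hBN hb)) fun a ha => by
      have h2 := Subgroup.inv_conj_mem_of_mem_normalizer (hBN hb) (hAB b hb a0 ha0 a ha)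
      have e : b⁻¹ * ⁅a0, b * a * b⁻¹⁆ * b = ⁅b⁻¹ * a0 * b⁻¹⁻¹, a⁆ := by
        simp only [commutatorElement_def]; group
      rw [e] at h2
      exact swap _ _ h2
    simpa using this

end Fixer

variable {A H : Subgroup Γ} {B : Set Γ}

/-- The abelian group `leafGroup (log a0)` contains `A`, and `commute_or` makes `B` normalize it:
when `b` carries one nontrivial element of `A` to another, it multiplies `log a0` by one of its
constants. -/
theorem isSolvable_closure_of_rank_one (hT : IsCommutatorTower A H B)
    (hA : ∀ a ∈ A, ∀ a' ∈ A, a * a' = a' * a) {a0 : Γ} (ha0 : a0 ∈ A) (h1 : a0 ≠ 1)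
    (hr : ∀ a ∈ A, ∃ s : K, S.log a = s • S.log a0) :
    Group.IsSolvable (Subgroup.closure (A ∪ B)) := by
  set X := S.log a0 with hX
  have hX0 : X ≠ 0 := S.log_ne_zero h1
  have hXr : X ∈ S.raising := S.log_mem_raising a0
  have hZ : Group.IsSolvable (S.leafGroup X) :=
    Subgroup.isSolvable_of_forall_comm fun _ hy _ hz => S.leafGroup_comm hXr hX0 hy hz
  refine Subgroup.isSolvable_closure_union hZ (fun a ha => ⟨?_, fun f hf => ?_⟩) ?_ ?_
  · exact S.commute_iff_ad.mp (hA a ha a0 ha0)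
  · obtain ⟨s, hs⟩ := hr a ha
    rw [act_eq_iff, hs, Derivation.smul_apply, hf, smul_zero]
  · intro b hb
    rcases hT.commute_or b hb with hc | ⟨α, hα, hα1, hβ⟩
    · exact S.mem_normalizer_leafGroup hX0 (t := 1)
        (by rw [one_smul]; exact S.commute_iff_ad.mp (hc a0 ha0)) X.map_one_eq_zero
    · obtain ⟨s, hs⟩ := hr α hα
      obtain ⟨s', hs'⟩ := hr _ hβ
      have e1 : S.act b s' • S.ad b X = s • X := by
        rw [← ad_smul, ← hs', ad_log, ← hs]
        congr 1; group
      have hs0 : s ≠ 0 := by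
        rintro rfl
        exact S.log_ne_zero hα1 (by rw [hs, zero_smul])
      have hXs : X s = 0 := (commute_iff_of_log_eq_smul h1 hs).mp (hA _ ha0 _ hα)
      have hXs' : X s' = 0 := (commute_iff_of_log_eq_smul h1 hs').mp (hA _ ha0 _ hβ)
      have hs'0 : S.act b s' ≠ 0 := by
        intro h
        rw [h, zero_smul] at e1
        exact smul_ne_zero hs0 hX0 e1.symm
      have e2 : S.ad b X = ((S.act b s')⁻¹ * s) • X := by
        rw [← smul_smul, ← e1, smul_smul, inv_mul_cancel₀ hs'0, one_smul]
      -- `b` carries constants of `X` to constants of `ad b X`, a nonzero multiple of `X`.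
      have e3 : X (S.act b s') = 0 := by
        have h2 := S.ad_apply_act b X s'
        rw [hXs', map_zero, e2, Derivation.smul_apply, smul_eq_mul, mul_eq_zero] at h2
        exact h2.resolve_left (mul_ne_zero (inv_ne_zero hs'0) hs0)
      refine S.mem_normalizer_leafGroup hX0 e2 ?_
      rw [Derivation.leibniz, hXs, Derivation.leibniz_inv, e3]
      simp
  · intro b hb b' hb'
    exact ⟨S.commute_iff_ad.mp (hA _ (hT.commutator_mem b hb b' hb') a0 ha0), fun f hf => by
      obtain ⟨s, hs⟩ := hr _ (hT.commutator_mem b hb b' hb')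
      rw [act_eq_iff, hs, Derivation.smul_apply, hf, smul_zero]⟩

/-- Conjugates by `B` of a nontrivial commutator `d` of `A` are commutators of `H`, so `B`
normalizes the group `fixer φ` attached to `H`. It remains to find `z` in it whose centralizer is
normalized by `A` and `B`; either `z = x` or `z = d` works. -/
theorem isSolvable_closure_of_nonabelian (S : LogAction Γ K) (hT : IsCommutatorTower A H B)
    (hH : Group.IsSolvable H)
    {a a' : Γ} (ha : a ∈ A) (ha' : a' ∈ A) (hne : a * a' ≠ a' * a) :
    Group.IsSolvable (Subgroup.closure (A ∪ B)) := by
  obtain ⟨φ, hφ, hD, hN, x, hxH, hx, hx1, hNx⟩ :=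
    S.exists_le_normalizer_centIn hH (hT.le ha) (hT.le ha') hne
  have hDm : ∀ y ∈ H, ∀ z ∈ H, ⁅y, z⁆ ∈ S.fixer φ := fun y hy z hz =>
    hD (Subgroup.commutator_mem_commutator hy hz)
  have hHm : ∀ y ∈ H, ∀ z ∈ H, ⁅y, z⁆ ∈ H := fun y hy z hz =>
    Subgroup.commutator_le_self H (Subgroup.commutator_mem_commutator hy hz)
  have hd1 : ⁅a, a'⁆ ≠ 1 := fun h => hne (commutatorElement_eq_one_iff_comm.mp h)
  have hdT : ⁅a, a'⁆ ∈ S.fixer φ := hDm _ (hT.le ha) _ (hT.le ha')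
  have hdH : ⁅a, a'⁆ ∈ H := hHm _ (hT.le ha) _ (hT.le ha')
  set d := ⁅a, a'⁆ with hd
  have hbd : ∀ b ∈ B, b * d * b⁻¹ ∈ S.fixer φ ∧ b * d * b⁻¹ ∈ H := fun b hb => by
    rw [commutator_conj]
    exact ⟨hDm _ (hT.conj_mem b hb _ ha) _ (hT.conj_mem b hb _ ha'),
      hHm _ (hT.conj_mem b hb _ ha) _ (hT.conj_mem b hb _ ha')⟩
  have hbd' : ∀ b ∈ B, b⁻¹ * d * b ∈ S.fixer φ ∧ b⁻¹ * d * b ∈ H := fun b hb => by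
    have e : b⁻¹ * d * b = ⁅b⁻¹ * a * b, b⁻¹ * a' * b⁆ := by
      simp only [hd, commutatorElement_def]; group
    rw [e]
    exact ⟨hDm _ (hT.inv_conj_mem b hb _ ha) _ (hT.inv_conj_mem b hb _ ha'),
      hHm _ (hT.inv_conj_mem b hb _ ha) _ (hT.inv_conj_mem b hb _ ha')⟩
  have hBN : B ⊆ Subgroup.normalizer (S.fixer φ : Set Γ) := fun b hb =>
    mem_normalizer_of_conj_mem hφ hd1 hdT (hbd b hb).1
  have hAN : A ≤ Subgroup.normalizer (S.fixer φ : Set Γ) := hT.le.trans hN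
  have fin : ∀ z ∈ S.fixer φ, z ≠ 1 →
      A ≤ Subgroup.normalizer ((S.fixer φ).centIn z : Set Γ) →
      B ⊆ Subgroup.normalizer ((S.fixer φ).centIn z : Set Γ) →
      Group.IsSolvable (Subgroup.closure (A ∪ B)) := fun z hz hz1 h2 h3 =>
    isSolvable_closure_of_le_normalizer hφ hz hz1
      (fun a ha a' ha' => hDm a (hT.le ha) a' (hT.le ha'))
      (fun b hb a ha a' ha' => hDm a (hT.le ha) _ (hT.conj_mem b hb a' ha'))
      hT.commutator_mem hAN hBN h2 h3
  set M : Subgroup Γ := S.fixer φ ⊓ Subgroup.normalizer ((S.fixer φ).centIn x : Set Γ) with hM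
  have hPM : ∀ y ∈ H, y ∈ S.fixer φ → y ∈ M := fun y hy hyT => ⟨hyT, hNx hy⟩
  -- noncommuting elements of `M` whose conjugates are in `M`
  have key : ∀ b ∈ B, ∀ u ∈ M, ∀ v ∈ M, b⁻¹ * u * b ∈ M → b⁻¹ * v * b ∈ M → u * v ≠ v * u →
      b ∈ Subgroup.normalizer ((S.fixer φ).centIn x : Set Γ) := by
    intro b hb u hu v hv hu' hv' huv
    have h2 := Subgroup.mem_centIn.mp (commutator_mem_centIn hφ hx hx1 hu.1 hv.1 hu.2 hv.2)
    have h3 := Subgroup.mem_centIn.mp (commutator_mem_centIn hφ hx hx1 hu'.1 hv'.1 hu'.2 hv'.2)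
    refine mem_normalizer_centIn hφ hx hx1 (hBN hb) ?_
    -- The nontrivial element `⁅u, v⁆` commutes with `x` and with `b x b⁻¹`, hence these two
    -- commute.
    have e : ⁅u, v⁆ = b * ⁅b⁻¹ * u * b, b⁻¹ * v * b⁆ * b⁻¹ := by
      simp only [commutatorElement_def]; group
    have h4 : ⁅u, v⁆ * (b * x * b⁻¹) = (b * x * b⁻¹) * ⁅u, v⁆ := by
      rw [e, conj_commute_iff]; exact h3.2
    exact commute_trans hφ (Subgroup.conj_mem_of_mem_normalizer (hBN hb) hx) h2.1 hx
      (fun h => huv (commutatorElement_eq_one_iff_comm.mp h)) h4.symm h2.2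
  have hdM : d ∈ M := hPM d hdH hdT
  have alt : ∀ b ∈ B, b ∉ Subgroup.normalizer ((S.fixer φ).centIn x : Set Γ) →
      b ∈ Subgroup.normalizer ((S.fixer φ).centIn d : Set Γ) := by
    intro b hb hbx
    refine mem_normalizer_centIn hφ hdT hd1 (hBN hb) ?_
    by_contra hc
    refine hbx (key b hb _ (hPM _ (hbd b hb).2 (hbd b hb).1) d hdM ?_
      (hPM _ (hbd' b hb).2 (hbd' b hb).1) hc)
    have e : b⁻¹ * (b * d * b⁻¹) * b = d := by group
    rwa [e]
  by_cases hall : B ⊆ Subgroup.normalizer ((S.fixer φ).centIn x : Set Γ)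
  · exact fin x hx hx1 (hT.le.trans hNx) hall
  -- If `b2` fails for `x`, then `d` works: any failure for `d` yields a noncommuting pair in `M`
  -- whose conjugates by `b2⁻¹` stay in `M`, contradicting `key`.
  obtain ⟨b2, hb2, hb2x⟩ := Set.not_subset.mp hall
  refine fin d hdT hd1 (fun α hα => ?_) fun b1 hb1 => ?_
  · refine mem_normalizer_centIn hφ hdT hd1 (hAN hα) ?_
    by_contra hc
    have hαH := hT.le hα
    have h2 : α * d * α⁻¹ ∈ M := hPM _ (mul_mem (mul_mem hαH hdH) (inv_mem hαH))
      (Subgroup.conj_mem_of_mem_normalizer (hN hαH) hdT)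
    have hβ := hT.inv_conj_mem b2 hb2 α hα
    have hδ := hbd' b2 hb2
    refine hb2x (key b2 hb2 _ h2 d hdM ?_ (hPM _ hδ.2 hδ.1) hc)
    have e : b2⁻¹ * (α * d * α⁻¹) * b2 =
        (b2⁻¹ * α * b2) * (b2⁻¹ * d * b2) * (b2⁻¹ * α * b2)⁻¹ := by group
    rw [e]
    exact hPM _ (mul_mem (mul_mem hβ hδ.2) (inv_mem hβ))
      (Subgroup.conj_mem_of_mem_normalizer (hN hβ) hδ.1)
  · by_contra hb1d
    have hb1x : b1 ∈ Subgroup.normalizer ((S.fixer φ).centIn x : Set Γ) := by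
      by_contra h
      exact hb1d (alt b1 hb1 h)
    have hnc : b1 * d * b1⁻¹ * d ≠ d * (b1 * d * b1⁻¹) := fun h =>
      hb1d (mem_normalizer_centIn hφ hdT hd1 (hBN hb1) h)
    have hMconj : ∀ g, g ∈ Subgroup.normalizer (S.fixer φ : Set Γ) →
        g ∈ Subgroup.normalizer ((S.fixer φ).centIn x : Set Γ) → ∀ y ∈ M, g * y * g⁻¹ ∈ M :=
      fun g hg hg' y hy => ⟨Subgroup.conj_mem_of_mem_normalizer hg hy.1,
        Subgroup.mul_mem _ (Subgroup.mul_mem _ hg' hy.2) (Subgroup.inv_mem _ hg')⟩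
    have h2 : b2 * d * b2⁻¹ ∈ M := hPM _ (hbd b2 hb2).2 (hbd b2 hb2).1
    have hα := hT.commutator_mem b2 hb2 b1 hb1
    -- Exchange `b2` and `b1` at the cost of `⁅b2, b1⁆`, which lies in `A` and so normalizes `M`, as
    -- `b1` does.
    have h3 : b2 * (b1 * d * b1⁻¹) * b2⁻¹ ∈ M := by
      have e : b2 * (b1 * d * b1⁻¹) * b2⁻¹ =
          ⁅b2, b1⁆ * (b1 * (b2 * d * b2⁻¹) * b1⁻¹) * ⁅b2, b1⁆⁻¹ := by
        simp only [commutatorElement_def]; group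
      rw [e]
      exact hMconj _ (hAN hα) (hNx (hT.le hα)) _ (hMconj _ (hBN hb1) hb1x _ h2)
    have h4 : b1 * d * b1⁻¹ ∈ M := hPM _ (hbd b1 hb1).2 (hbd b1 hb1).1
    have e1 : ∀ y, b2⁻¹ * (b2 * y * b2⁻¹) * b2 = y := fun y => by group
    refine hb2x (key b2 hb2 _ h3 _ h2 (by rwa [e1]) (by rwa [e1]) fun h => hnc ?_)
    exact (conj_commute_iff b2 _ _).mp h

end LogAction


/-! ### Commutator towers: the rank two case -/

namespace LogAction

variable {Γ K : Type*} [Group Γ] [Field K] [Algebra ℂ K] {S : LogAction Γ K}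

theorem exists_apply_ne_zero {X : Derivation ℂ K K} (h0 : X ≠ 0) : ∃ f, X f ≠ 0 := by
  by_contra! h'
  exact h0 (by ext f; simpa using h' f)

/-- A raising derivation has no nonzero eigenvalue. -/
theorem eigenvalue_eq_zero {X : Derivation ℂ K K} (hX : X ∈ S.raising) {f : K} (h0 : f ≠ 0) {c : ℂ}
    (h : X f = c • f) : c = 0 := by
  by_contra hc
  obtain ⟨a, ha⟩ := S.exhaustive f
  have key : ∀ r : ℕ, f ∈ S.F (a + r) := by
    intro r
    induction r with
    | zero => simpa using ha
    | succ r ih =>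
      have h2 := hX _ _ ih
      rw [h] at h2
      have h3 := (S.F _).smul_mem c⁻¹ h2
      rw [smul_smul, inv_mul_cancel₀ hc, one_smul] at h3
      push_cast
      rwa [← add_assoc]
  refine h0 (S.separated f fun n => ?_)
  obtain ⟨N, hN⟩ := Int.exists_nat_add_ge a n
  exact S.anti hN (key N)

section RankTwo

variable {a₁ a₂ : Γ} (h12 : a₁ * a₂ = a₂ * a₁) (h1 : a₁ ≠ 1)
  (hind : ∀ s : K, S.log a₂ ≠ s • S.log a₁)
include h12 h1 hind

/-- A derivation that is multiplied by its constants under the action of a rank two abelian group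
is a multiple of an invariant derivation by one of its constants. -/
theorem exists_eq_smul_invariant {X : Derivation ℂ K K} (hX : X ∈ S.raising) (h0 : X ≠ 0)
    (hmul : ∀ a, a = a₁ ∨ a = a₂ → ∃ t : K, S.ad a X = t • X ∧ X t = 0) :
    ∃ (s : K) (p q : ℂ), s ≠ 0 ∧ X = s • (p • S.log a₁ + q • S.log a₂) ∧
      (p • S.log a₁ + q • S.log a₂) s = 0 := by
  have hinv : ∀ a, a = a₁ ∨ a = a₂ → S.ad a (S.log a₁) = S.log a₁ ∧ S.ad a (S.log a₂) = S.log a₂ := by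
    rintro a (rfl | rfl)
    · exact ⟨S.commute_iff_ad.mp rfl, S.commute_iff_ad.mp h12⟩
    · exact ⟨S.commute_iff_ad.mp h12.symm, S.commute_iff_ad.mp rfl⟩
  have main : ∀ (s : K) (p q : ℂ), X = s • (p • S.log a₁ + q • S.log a₂) →
      ∃ (s : K) (p q : ℂ), s ≠ 0 ∧ X = s • (p • S.log a₁ + q • S.log a₂) ∧
      (p • S.log a₁ + q • S.log a₂) s = 0 := by
    intro s p q hs
    set Y := p • S.log a₁ + q • S.log a₂ with hY
    have hYr : Y ∈ S.raising := Submodule.add_mem _ (Submodule.smul_mem _ _ (S.log_mem_raising _))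
      (Submodule.smul_mem _ _ (S.log_mem_raising _))
    have hs0 : s ≠ 0 := fun h => h0 (by rw [hs, h, zero_smul])
    have hY0 : Y ≠ 0 := fun h => h0 (by rw [hs, h, smul_zero])
    refine ⟨s, p, q, hs0, hs, ?_⟩
    have hYa : ∀ a, a = a₁ ∨ a = a₂ → S.ad a Y = Y := fun a ha => by
      rw [hY, ad_add, ad_smul_const, ad_smul_const, (hinv a ha).1, (hinv a ha).2]
    -- Both `s` and `Y s` are multiplied by `t`, so the quotient is an invariant, hence constant; it
    -- is an eigenvalue of `Y`, hence zero.
    have hw : ∀ a, a = a₁ ∨ a = a₂ → S.act a (Y s / s) = Y s / s := by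
      intro a ha
      obtain ⟨t, ht, hXt⟩ := hmul a ha
      rw [hs, ad_smul, hYa a ha, smul_smul] at ht
      have e1 : S.act a s = t * s := eq_of_smul_eq_smul hY0 ht
      have hYt : Y t = 0 := by
        rw [hs, Derivation.smul_apply, smul_eq_mul, mul_eq_zero] at hXt
        exact hXt.resolve_left hs0
      have ht0 : t ≠ 0 := by
        rintro rfl
        rw [zero_mul, map_eq_zero_iff _ (S.act a).injective] at e1
        exact hs0 e1
      have e2 : S.act a (Y s) = Y (S.act a s) := by
        rw [← S.ad_apply_act, hYa a ha]
      rw [map_div₀, e2, e1, Derivation.leibniz, hYt, smul_zero, add_zero, smul_eq_mul,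
        mul_div_mul_left _ _ ht0]
    obtain ⟨c, hc⟩ := mem_range_of_act_eq h1 hind (hw a₁ (Or.inl rfl)) (hw a₂ (Or.inr rfl))
    have hc' : Y s = c • s := by
      rw [Algebra.smul_def, hc, div_mul_cancel₀ _ hs0]
    rw [hc', eigenvalue_eq_zero hYr hs0 hc', zero_smul]
  obtain ⟨p, q, hpq⟩ := S.exists_eq_smul_add_smul (S.log_mem_raising a₁) (S.log_mem_raising a₂) hX
    (S.log_ne_zero h1) hind
  by_cases hp : p = 0
  · exact main q 0 1 (by rw [hpq, hp]; simp)
  -- The two coefficients are multiplied by the same `t`, so their ratio is a complex constant.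
  have hfix : ∀ a, a = a₁ ∨ a = a₂ → S.act a (q / p) = q / p := by
    intro a ha
    obtain ⟨t, ht, -⟩ := hmul a ha
    have e1 : (S.act a p - t * p) • S.log a₁ + (S.act a q - t * q) • S.log a₂ = 0 := by
      rw [hpq, ad_add, ad_smul, ad_smul, (hinv a ha).1, (hinv a ha).2, smul_add, smul_smul,
        smul_smul] at ht
      rw [sub_smul, sub_smul, sub_add_sub_comm, ht, sub_self]
    obtain ⟨e2, e3⟩ := eq_zero_of_smul_add_smul_eq_zero (S.log_ne_zero h1) hind e1
    have ht0 : t ≠ 0 := by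
      rintro rfl
      rw [zero_mul, sub_zero, map_eq_zero_iff _ (S.act a).injective] at e2
      exact hp e2
    rw [map_div₀, sub_eq_zero.mp e2, sub_eq_zero.mp e3, mul_div_mul_left _ _ ht0]
  obtain ⟨c, hc⟩ := mem_range_of_act_eq h1 hind (hfix a₁ (Or.inl rfl)) (hfix a₂ (Or.inr rfl))
  refine main p 1 c ?_
  rw [hpq, smul_add, one_smul, ← algebraMap_smul K c (S.log a₂), smul_smul, hc, mul_div_cancel₀ _ hp]

end RankTwo

variable {A H : Subgroup Γ} {B : Set Γ}

theorem exists_ad_eq_smul_of_mem_normalizer {φ : K} (hφ : φ ∉ Set.range (algebraMap ℂ K)) {x g : Γ}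
    (hx : x ∈ S.fixer φ) (h1 : x ≠ 1) (hg : g ∈ Subgroup.normalizer (S.fixer φ : Set Γ))
    (hg' : g ∈ Subgroup.normalizer ((S.fixer φ).centIn x : Set Γ)) :
    ∃ s : K, S.ad g (S.log x) = s • S.log x ∧ S.log x s = 0 := by
  obtain ⟨s, hs⟩ := exists_log_eq_smul hφ hx (Subgroup.conj_mem_of_mem_normalizer hg hx) h1
  exact ⟨s, exists_ad_eq_smul_of_log_eq_smul h1 hs (commute_of_mem_normalizer_centIn hx hg')⟩

/-- Elements that multiply two invariant derivations of a rank two abelian group by constants of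
these derivations commute with the group. -/
theorem commute_of_ad_eq_smul {a₁ a₂ : Γ} (h12 : a₁ * a₂ = a₂ * a₁) (h1 : a₁ ≠ 1)
    (hind : ∀ s : K, S.log a₂ ≠ s • S.log a₁) {Y Y' : Derivation ℂ K K} (hY : Y ∈ S.raising)
    (hY' : Y' ∈ S.raising) (hY0 : Y ≠ 0) (hY'0 : Y' ≠ 0) (hYY' : ∀ s : K, Y' ≠ s • Y)
    (hinv : ∀ a, a = a₁ ∨ a = a₂ → S.ad a Y = Y ∧ S.ad a Y' = Y')
    (hcomm : ∀ f, Y (Y' f) = Y' (Y f)) {b : Γ} {s s' : K}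
    (hs : S.ad b Y = s • Y) (hs' : S.ad b Y' = s' • Y') (hYs : Y s = 0) (hYs' : Y' s' = 0) {a : Γ}
    (ha₁ : a * a₁ = a₁ * a) (ha₂ : a * a₂ = a₂ * a) : b * a = a * b := by
  have hs0 : s ≠ 0 := by
    rintro rfl
    exact S.ad_ne_zero b hY0 (by rw [hs, zero_smul])
  have hs'0 : s' ≠ 0 := by
    rintro rfl
    exact S.ad_ne_zero b hY'0 (by rw [hs', zero_smul])
  -- Transporting `[Y, Y'] = 0` by `b` gives `[sY, s'Y'] = 0`. Independence then makes `s` and `s'`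
  -- killed by both derivations, hence complex, hence `1` by unipotence.
  have hbr : (-(s' * Y' s)) • Y + (s * Y s') • Y' = 0 := by
    ext f
    have e1 : S.ad b Y (S.ad b Y' f) = S.ad b Y' (S.ad b Y f) := by
      simp only [ad_apply, act_inv_act, hcomm]
    rw [hs, hs'] at e1
    simp only [Derivation.smul_apply, smul_eq_mul, Derivation.leibniz, hcomm] at e1
    simp only [Derivation.add_apply, Derivation.smul_apply, smul_eq_mul, Derivation.zero_apply]
    linear_combination e1
  obtain ⟨e1, e2⟩ := eq_zero_of_smul_add_smul_eq_zero hY0 hYY' hbr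
  have hY's : Y' s = 0 := (mul_eq_zero.mp (neg_eq_zero.mp e1)).resolve_left hs'0
  have hYs'2 : Y s' = 0 := (mul_eq_zero.mp e2).resolve_left hs0
  have const : ∀ U : Derivation ℂ K K, U ∈ S.raising → U ≠ 0 → ∀ t : K, S.ad b U = t • U →
      Y t = 0 → Y' t = 0 → S.ad b U = U := by
    intro U hU hU0 t ht h2 h3
    obtain ⟨c, hc⟩ := S.mem_range_of_apply_eq_zero hY hY' hY0 hYY' h2 h3
    rw [← hc, algebraMap_smul] at ht
    obtain ⟨f, hf⟩ := exists_apply_ne_zero hU0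
    have hc1 : c = 1 := S.eq_one_of_ad_eq_smul (g := b) hU ⊤ (fun _ _ => trivial)
      (fun f _ => by rw [ht, Derivation.smul_apply]) trivial hf
    rw [ht, hc1, one_smul]
  have hbY := const Y hY hY0 s hs hYs hY's
  have hbY' := const Y' hY' hY'0 s' hs' hYs'2 hYs'
  obtain ⟨p, q, hpq⟩ := S.exists_eq_smul_add_smul hY hY' (S.log_mem_raising a) hY0 hYY'
  have hfix : ∀ g, g = a₁ ∨ g = a₂ → S.act g p = p ∧ S.act g q = q := by
    intro g hg
    have hga : S.ad g (S.log a) = S.log a := by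
      rcases hg with rfl | rfl
      · exact S.commute_iff_ad.mp ha₁.symm
      · exact S.commute_iff_ad.mp ha₂.symm
    rw [hpq, ad_add, ad_smul, ad_smul, (hinv g hg).1, (hinv g hg).2] at hga
    have e2 : (S.act g p - p) • Y + (S.act g q - q) • Y' = 0 := by
      rw [sub_smul, sub_smul, sub_add_sub_comm, hga, sub_self]
    obtain ⟨h2, h3⟩ := eq_zero_of_smul_add_smul_eq_zero hY0 hYY' e2
    exact ⟨sub_eq_zero.mp h2, sub_eq_zero.mp h3⟩
  obtain ⟨c, hc⟩ := mem_range_of_act_eq h1 hind (hfix a₁ (Or.inl rfl)).1 (hfix a₂ (Or.inr rfl)).1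
  obtain ⟨d, hd⟩ := mem_range_of_act_eq h1 hind (hfix a₁ (Or.inl rfl)).2 (hfix a₂ (Or.inr rfl)).2
  rw [S.commute_iff_ad, hpq, ad_add, ad_smul, ad_smul, hbY, hbY', ← hc, ← hd, AlgEquiv.commutes,
    AlgEquiv.commutes]

theorem isSolvable_closure_of_rank_two (hT : IsCommutatorTower A H B) (hH : Group.IsSolvable H)
    (hA : ∀ a ∈ A, ∀ a' ∈ A, a * a' = a' * a) {a₁ a₂ : Γ} (ha₁ : a₁ ∈ A) (ha₂ : a₂ ∈ A)
    (h1 : a₁ ≠ 1) (hind : ∀ s : K, S.log a₂ ≠ s • S.log a₁) :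
    Group.IsSolvable (Subgroup.closure (A ∪ B)) := by
  have h12 := hA _ ha₁ _ ha₂
  have hZc : ∀ y ∈ Subgroup.centralizer (A : Set Γ), ∀ z ∈ Subgroup.centralizer (A : Set Γ),
      y * z = z * y := fun y hy z hz => by
    rw [Subgroup.mem_centralizer_iff] at hy hz
    exact commute_of_commute_rank_two h12 h1 hind (hy _ ha₁).symm (hy _ ha₂).symm (hz _ ha₁).symm
      (hz _ ha₂).symm
  have hZstable : ∀ b : Γ, (∀ a ∈ A, ∀ a' ∈ A, a * (b * a' * b⁻¹) = b * a' * b⁻¹ * a) →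
      (∀ a ∈ A, b⁻¹ * a * b ∈ Subgroup.centralizer (A : Set Γ)) ∧
      ∀ z ∈ Subgroup.centralizer (A : Set Γ), b * z * b⁻¹ ∈ Subgroup.centralizer (A : Set Γ) := by
    intro b hb
    have e : ∀ a, a = b * (b⁻¹ * a * b) * b⁻¹ := fun a => by group
    have h2 : ∀ a ∈ A, b⁻¹ * a * b ∈ Subgroup.centralizer (A : Set Γ) := fun a ha => by
      rw [Subgroup.mem_centralizer_iff]
      intro a' ha'
      have h3 := hb a ha a' ha'
      rw [e a, conj_commute_iff] at h3
      exact h3.symm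
    refine ⟨h2, fun z hz => ?_⟩
    rw [Subgroup.mem_centralizer_iff]
    intro a ha
    rw [e a, conj_commute_iff]
    exact hZc _ (h2 a ha) z hz
  -- If `A` commutes with its conjugates by `B`, then `B` normalizes the centralizer of `A`, which
  -- is abelian. Otherwise `H` is nonabelian and provides `φ` and `x`.
  by_cases hall : ∀ b ∈ B, ∀ a ∈ A, ∀ a' ∈ A, a * (b * a' * b⁻¹) = b * a' * b⁻¹ * a
  · refine Subgroup.isSolvable_closure_union (Z := Subgroup.centralizer (A : Set Γ))
      (Subgroup.isSolvable_of_forall_comm hZc)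
      (fun a ha => Subgroup.mem_centralizer_iff.mpr fun a' ha' => hA a' ha' a ha)
      (fun b hb => Subgroup.mem_normalizer_of_conj (hZstable b (hall b hb)).2 ?_)
      (fun b hb b' hb' => Subgroup.mem_centralizer_iff.mpr fun a' ha' =>
        hA a' ha' _ (hT.commutator_mem b hb b' hb'))
    have := (hZstable b⁻¹ fun a ha a' ha' => by
      have h2 := hall b hb a' ha' a ha
      have e : ∀ a, a = b * (b⁻¹ * a * b) * b⁻¹ := fun a => by group
      rw [e a', conj_commute_iff] at h2
      rw [inv_inv]
      exact h2.symm).2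
    simpa using this
  push Not at hall
  obtain ⟨b₂, hb₂, a, ha, a', ha', hne⟩ := hall
  obtain ⟨φ, hφ, hD, hN, x, hxH, hx, hx1, hNx⟩ :=
    S.exists_le_normalizer_centIn hH (hT.le ha) (hT.conj_mem b₂ hb₂ _ ha') hne
  have hDm : ∀ y ∈ H, ∀ z ∈ H, ⁅y, z⁆ ∈ S.fixer φ := fun y hy z hz =>
    hD (Subgroup.commutator_mem_commutator hy hz)
  have hbad : ∀ b ∈ B, ∀ a ∈ A, ∀ a' ∈ A, a * (b * a' * b⁻¹) ≠ b * a' * b⁻¹ * a →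
      b ∈ Subgroup.normalizer (S.fixer φ : Set Γ) := by
    intro b hb a ha a' ha' hne
    rw [← inv_inv b]
    refine inv_mem (mem_normalizer_of_conj_mem hφ
      (fun h => hne (commutatorElement_eq_one_iff_comm.mp h))
      (hDm a (hT.le ha) _ (hT.conj_mem b hb a' ha')) ?_)
    have e : b⁻¹ * ⁅a, b * a' * b⁻¹⁆ * b⁻¹⁻¹ = ⁅b⁻¹ * a * b, a'⁆ := by
      simp only [commutatorElement_def]; group
    rw [e]
    exact hDm _ (hT.inv_conj_mem b hb a ha) _ (hT.le ha')
  have hb₂N := hbad b₂ hb₂ a ha a' ha' hne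
  have hmul : ∀ h ∈ H, ∃ t : K, S.ad h (S.log x) = t • S.log x ∧ S.log x t = 0 := fun h hh =>
    exists_ad_eq_smul_of_mem_normalizer hφ hx hx1 (hN hh) (hNx hh)
  have hlx := S.log_mem_raising x
  have hlx0 := S.log_ne_zero hx1
  obtain ⟨s₀, p, q, hs₀, hxs, hYs₀⟩ := exists_eq_smul_invariant h12 h1 hind hlx hlx0
    (by rintro _ (rfl | rfl)
        · exact hmul _ (hT.le ha₁)
        · exact hmul _ (hT.le ha₂))
  set Y := p • S.log a₁ + q • S.log a₂ with hY
  have hY0 : Y ≠ 0 := fun h => hlx0 (by rw [hxs, h, smul_zero])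
  have hYr : Y ∈ S.raising := Submodule.add_mem _ (Submodule.smul_mem _ _ (S.log_mem_raising _))
      (Submodule.smul_mem _ _ (S.log_mem_raising _))
  have hadA : ∀ g, g * a₁ = a₁ * g → g * a₂ = a₂ * g → ∀ p q : ℂ,
      S.ad g (p • S.log a₁ + q • S.log a₂) = p • S.log a₁ + q • S.log a₂ := fun g h2 h3 p q => by
    rw [ad_add, ad_smul_const, ad_smul_const, S.commute_iff_ad.mp h2, S.commute_iff_ad.mp h3]
  have hYφ : Y φ = 0 := by
    have h2 : S.log x φ = 0 := S.act_eq_iff.mp hx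
    rw [hxs, Derivation.smul_apply, smul_eq_mul, mul_eq_zero] at h2
    exact h2.resolve_left hs₀
  -- elements normalizing `fixer φ` normalize the centralizer
  have hbx : ∀ b ∈ B, b ∈ Subgroup.normalizer (S.fixer φ : Set Γ) →
      b ∈ Subgroup.normalizer ((S.fixer φ).centIn x : Set Γ) := by
    intro b hb hbN
    have e : ∀ a, b * (b⁻¹ * a * b) * b⁻¹ = a := fun a => by group
    have hbT := Subgroup.conj_mem_of_mem_normalizer hbN hx
    -- Describing `log x` through `b⁻¹ A b` and conjugating by `b` writes `log (b x b⁻¹)` as a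
    -- multiple of an `A`-invariant derivation `Y'`. Both `Y` and `Y'` kill `φ`, so they differ by a
    -- complex factor, and `x` commutes with `b x b⁻¹`.
    obtain ⟨s, p', q', hs, hxs', hYs⟩ := exists_eq_smul_invariant (S := S)
      (a₁ := b⁻¹ * a₁ * b) (a₂ := b⁻¹ * a₂ * b)
      (by rw [← conj_commute_iff b, e, e, h12]) (fun h => h1 (by rw [← e a₁, h]; group))
      (fun s hs => hind (S.act b s) (by
        rw [← e a₂, ← ad_log, hs, ad_smul, ad_log, e])) hlx hlx0
      (by rintro _ (rfl | rfl)
          · exact hmul _ (hT.inv_conj_mem b hb _ ha₁)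
          · exact hmul _ (hT.inv_conj_mem b hb _ ha₂))
    set Y' := p' • S.log a₁ + q' • S.log a₂ with hY'
    have hbY : S.ad b (p' • S.log (b⁻¹ * a₁ * b) + q' • S.log (b⁻¹ * a₂ * b)) = Y' := by
      rw [ad_add, ad_smul_const, ad_smul_const, ad_log, ad_log, e, e]
    have hlog : S.log (b * x * b⁻¹) = S.act b s • Y' := by
      rw [← ad_log, hxs', ad_smul, hbY]
    have hbs : S.act b s ≠ 0 := fun h => hs ((map_eq_zero_iff _ (S.act b).injective).mp h)
    have hY's : Y' (S.act b s) = 0 := by rw [← hbY, ad_apply_act, hYs, map_zero]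
    have hY'r : Y' ∈ S.raising := Submodule.add_mem _
      (Submodule.smul_mem _ _ (S.log_mem_raising _)) (Submodule.smul_mem _ _ (S.log_mem_raising _))
    have hY'φ : Y' φ = 0 := by
      have h2 : S.log (b * x * b⁻¹) φ = 0 := S.act_eq_iff.mp hbT
      rw [hlog, Derivation.smul_apply, smul_eq_mul, mul_eq_zero] at h2
      exact h2.resolve_left hbs
    obtain ⟨u, hu⟩ := S.exists_smul_of_apply_eq_zero hYr hY'r hY0 hφ hYφ hY'φ
    have hufix : ∀ g, g * a₁ = a₁ * g → g * a₂ = a₂ * g → S.act g u = u := fun g h2 h3 => by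
      have h4 := hadA g h2 h3 p' q'
      rw [← hY', hu, ad_smul, hadA g h2 h3 p q] at h4
      exact eq_of_smul_eq_smul hY0 h4
    obtain ⟨c, hc⟩ := mem_range_of_act_eq h1 hind (hufix a₁ rfl h12) (hufix a₂ h12.symm rfl)
    have hYu : ∀ f, Y' f = 0 → Y f = 0 := fun f hf => by
      rw [hu, Derivation.smul_apply, smul_eq_mul, mul_eq_zero] at hf
      refine hf.resolve_left ?_
      rintro rfl
      refine S.log_ne_zero (g := b * x * b⁻¹) (by simpa using hx1) ?_
      rw [hlog, hu, zero_smul, smul_zero]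
    refine mem_normalizer_centIn hφ hx hx1 hbN ?_
    rw [S.commute_iff_log, hlog, hxs, hu, smul_smul]
    refine smul_comm_smul hYs₀ ?_
    rw [Derivation.leibniz, hYu _ hY's, ← hc, Derivation.map_algebraMap]
    simp
  by_cases hBN : B ⊆ Subgroup.normalizer (S.fixer φ : Set Γ)
  · exact isSolvable_closure_of_le_normalizer hφ hx hx1
      (fun a ha a' ha' => hDm a (hT.le ha) a' (hT.le ha'))
      (fun b hb a ha a' ha' => hDm a (hT.le ha) _ (hT.conj_mem b hb a' ha'))
      hT.commutator_mem (hT.le.trans hN) hBN (hT.le.trans hNx) fun b hb => hbx b hb (hBN hb)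
  -- If `b₁` does not normalize `fixer φ`, then `ad b₁ Y` is an `A`-invariant derivation independent
  -- of `Y`. The element `b₂` multiplies both by constants of theirs, hence commutes with `A`,
  -- contrary to its choice.
  exfalso
  obtain ⟨b₁, hb₁, hb₁N⟩ := Set.not_subset.mp hBN
  have hgood : ∀ a ∈ A, b₁⁻¹ * a * b₁ ∈ Subgroup.centralizer (A : Set Γ) :=
    (hZstable b₁ fun a ha a' ha' => by
      by_contra h
      exact hb₁N (hbad b₁ hb₁ a ha a' ha' h)).1
  have hb₁A : ∀ a ∈ A, S.ad a (S.ad b₁ Y) = S.ad b₁ Y := fun a ha => by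
    have h2 := Subgroup.mem_centralizer_iff.mp (hgood a ha)
    have e : a * b₁ = b₁ * (b₁⁻¹ * a * b₁) := by group
    rw [← ad_mul, e, ad_mul, hY, hadA _ (h2 _ ha₁).symm (h2 _ ha₂).symm]
  have hb₁r : S.ad b₁ Y ∈ S.raising := S.ad_mem_level b₁ hYr
  have hb₁ind : ∀ r : K, S.ad b₁ Y ≠ r • Y := fun r hr => by
    refine hb₁N (mem_normalizer_of_conj_mem hφ hx1 hx (S.act_eq_iff.mpr ?_))
    rw [← ad_log, hxs, ad_smul, hr, Derivation.smul_apply, Derivation.smul_apply, hYφ, smul_zero,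
      smul_zero]
  obtain ⟨t, ht, hxt⟩ := exists_ad_eq_smul_of_mem_normalizer hφ hx hx1 hb₂N (hbx b₂ hb₂ hb₂N)
  have hYt : Y t = 0 := by
    rw [hxs, Derivation.smul_apply, smul_eq_mul, mul_eq_zero] at hxt
    exact hxt.resolve_left hs₀
  have hb₂s₀ : S.act b₂ s₀ ≠ 0 := fun h => hs₀ ((map_eq_zero_iff _ (S.act b₂).injective).mp h)
  obtain ⟨s, hs, hYs⟩ : ∃ s : K, S.ad b₂ Y = s • Y ∧ Y s = 0 := by
    have e1 : S.ad b₂ Y = ((S.act b₂ s₀)⁻¹ * (t * s₀)) • Y := by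
      rw [hxs, ad_smul, smul_smul] at ht
      rw [← smul_smul, ← ht, smul_smul, inv_mul_cancel₀ hb₂s₀, one_smul]
    have hu0 : (S.act b₂ s₀)⁻¹ * (t * s₀) ≠ 0 := fun h =>
      S.ad_ne_zero b₂ hY0 (by rw [e1, h, zero_smul])
    refine ⟨_, e1, ?_⟩
    have e2 : Y (S.act b₂ s₀) = 0 := by
      have h2 := S.ad_apply_act b₂ Y s₀
      rw [hYs₀, map_zero, e1, Derivation.smul_apply, smul_eq_mul, mul_eq_zero] at h2
      exact h2.resolve_left hu0
    rw [Derivation.leibniz, Derivation.leibniz, hYt, hYs₀, Derivation.leibniz_inv, e2]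
    simp
  have hα := hT.commutator_mem b₂ hb₂ b₁ hb₁
  have hs' : S.ad b₂ (S.ad b₁ Y) = S.act ⁅b₂, b₁⁆ (S.act b₁ s) • S.ad b₁ Y := by
    -- The commutator lies in `A`, hence fixes `ad b₁ Y`.
    have e : b₂ * b₁ = ⁅b₂, b₁⁆ * b₁ * b₂ := by rw [commutatorElement_def]; group
    rw [← ad_mul, e, ad_mul, hs, ad_smul, ad_mul, hb₁A _ hα, act_mul]
  have hYs' : S.ad b₁ Y (S.act ⁅b₂, b₁⁆ (S.act b₁ s)) = 0 := by
    have h2 := S.ad_apply_act ⁅b₂, b₁⁆ (S.ad b₁ Y) (S.act b₁ s)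
    rwa [hb₁A _ hα, ad_apply_act, hYs, map_zero, map_zero] at h2
  have hcomm : ∀ f, Y (S.ad b₁ Y f) = S.ad b₁ Y (Y f) := by
    obtain ⟨p', q', hpq⟩ := exists_eq_const_combination h12 h1 hind hb₁r (hb₁A _ ha₁) (hb₁A _ ha₂)
    rw [hpq]
    exact const_combination_comm h12 p q p' q'
  have hfin : ∀ a ∈ A, b₂ * a = a * b₂ := fun a ha =>
    commute_of_ad_eq_smul h12 h1 hind hYr hb₁r hY0 (S.ad_ne_zero b₁ hY0) hb₁ind
      (by rintro _ (rfl | rfl)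
          · exact ⟨hadA _ rfl h12 p q, hb₁A _ ha₁⟩
          · exact ⟨hadA _ h12.symm rfl p q, hb₁A _ ha₂⟩)
      hcomm hs hs' hYs hYs' (hA a ha _ ha₁) (hA a ha _ ha₂)
  apply hne
  rw [hfin a' ha', mul_inv_cancel_right, hA a ha a' ha']

theorem isSolvable_closure_of_tower (S : LogAction Γ K) (hT : IsCommutatorTower A H B)
    (hH : Group.IsSolvable H) : Group.IsSolvable (Subgroup.closure (A ∪ B)) := by
  by_cases hA : ∀ a ∈ A, ∀ a' ∈ A, a * a' = a' * a
  · by_cases hbot : A = ⊥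
    · have hZ : Group.IsSolvable A := Subgroup.isSolvable_of_forall_comm hA
      refine Subgroup.isSolvable_closure_union hZ subset_rfl (fun b hb => ?_) hT.commutator_mem
      rw [hbot]
      exact Subgroup.mem_normalizer_of_conj (by simp) (by simp)
    · obtain ⟨a₁, ha₁, h1⟩ := Subgroup.exists_mem_ne_one hbot
      by_cases hr : ∃ a ∈ A, ∀ s : K, S.log a ≠ s • S.log a₁
      · obtain ⟨a₂, ha₂, hind⟩ := hr
        exact isSolvable_closure_of_rank_two hT hH hA ha₁ ha₂ h1 hind
      · push Not at hr
        exact isSolvable_closure_of_rank_one hT hA ha₁ h1 hr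
  · push Not at hA
    obtain ⟨a, ha, a', ha', hne⟩ := hA
    exact isSolvable_closure_of_nonabelian S hT hH ha ha' hne

end LogAction

/-! ### Descending induction along the sets `S(j)` -/

section Ghys

variable {Γ : Type*} [Group Γ]

theorem commutatorElement_mem_signedCommutators {A B : Set Γ} {x y : Γ} (hx : x ∈ A) (hy : y ∈ B) :
    ⁅x, y⁆ ∈ signedCommutators A B :=
  ⟨x, hx, y, hy, x, y, Or.inl rfl, Or.inl rfl, commutatorElement_def x y⟩

/-- The set with which `S(j)` is commutated to get `S(j+1)`. -/
theorem exists_ghysSeq_succ (T : Set Γ) (j : ℕ) : ∃ D : Set Γ, ghysSeq T j ⊆ D ∧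
    ghysSeq T (j + 1) = signedCommutators (ghysSeq T j) D := by
  cases j with
  | zero => exact ⟨T, subset_rfl, rfl⟩
  | succ j => exact ⟨_, Set.subset_union_left, rfl⟩

theorem isCommutatorTower_ghysSeq (T : Set Γ) (j : ℕ) :
    IsCommutatorTower (Subgroup.closure (ghysSeq T (j + 1)))
      (Subgroup.closure (ghysSeq T (j + 2) ∪ ghysSeq T (j + 1))) (ghysSeq T j) := by
  set A := ghysSeq T (j + 1) with hA
  set H := Subgroup.closure (ghysSeq T (j + 2) ∪ A) with hH
  have hle : Subgroup.closure A ≤ H := Subgroup.closure_mono Set.subset_union_right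
  obtain ⟨D, hD, hAD⟩ := exists_ghysSeq_succ T j
  have hsub : ∀ a ∈ A, ∀ b ∈ ghysSeq T j, ∀ c, c = b ∨ c = b⁻¹ → c * a * c⁻¹ ∈ H := by
    intro a ha b hb c hc
    have h1 : a⁻¹ * c * a⁻¹⁻¹ * c⁻¹ ∈ H := Subgroup.subset_closure
      (Or.inl ⟨a, ha, b, Or.inr hb, a⁻¹, c, Or.inr rfl, hc, rfl⟩)
    have h2 := H.mul_mem (hle (Subgroup.subset_closure ha)) h1
    -- Here the term `S(j)` in the recursion for `S(j+2)` is essential: `[a⁻¹, b^{±1}]` belongs to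
    -- `S(j+2)`.
    have e : a * (a⁻¹ * c * a⁻¹⁻¹ * c⁻¹) = c * a * c⁻¹ := by group
    rwa [e] at h2
  have hconj : ∀ b ∈ ghysSeq T j, ∀ c, c = b ∨ c = b⁻¹ → ∀ a ∈ Subgroup.closure A,
      c * a * c⁻¹ ∈ H := by
    intro b hb c hc a ha
    have : Subgroup.closure A ≤ H.comap (MulAut.conj c).toMonoidHom :=
      (Subgroup.closure_le _).mpr fun a ha => hsub a ha b hb c hc
    exact this ha
  refine ⟨hle, fun b hb => hconj b hb b (Or.inl rfl), fun b hb a ha => ?_, fun b hb b' hb' => ?_,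
    fun b hb => ?_⟩
  · simpa using hconj b hb b⁻¹ (Or.inr rfl) a ha
  · refine Subgroup.subset_closure ?_
    rw [hA, hAD]
    exact commutatorElement_mem_signedCommutators hb (hD hb')
  -- If `b` commutes with `D`, it commutes with `A`, generated by commutators of elements of `D` and
  -- their inverses. Otherwise `⁅b, d⁆ ≠ 1` is conjugated by `b⁻¹` to the inverse of `[b⁻¹, d]`,
  -- again in `A`.
  · by_cases hc : ∀ d ∈ D, ⁅b, d⁆ = 1
    · left
      have hcent : Subgroup.closure A ≤ Subgroup.centralizer {b} := by
        rw [Subgroup.closure_le, hA, hAD]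
        have hDc : ∀ d ∈ D, ∀ c, c = d ∨ c = d⁻¹ → c ∈ Subgroup.centralizer {b} := by
          intro d hd c hcd
          have h1 : d ∈ Subgroup.centralizer {b} := Subgroup.mem_centralizer_singleton_iff.mpr
            (commutatorElement_eq_one_iff_comm.mp (hc d hd)).symm
          rcases hcd with rfl | rfl
          · exact h1
          · exact inv_mem h1
        rintro _ ⟨F₁, h₁, F₂, h₂, y, z, hy, hz, rfl⟩
        have hy' := hDc F₁ (hD h₁) y hy
        have hz' := hDc F₂ h₂ z hz
        exact mul_mem (mul_mem (mul_mem hy' hz') (inv_mem hy')) (inv_mem hz')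
      exact fun a ha => (Subgroup.mem_centralizer_singleton_iff.mp (hcent ha)).symm
    · right
      push Not at hc
      obtain ⟨d, hd, hne⟩ := hc
      refine ⟨⁅b, d⁆, Subgroup.subset_closure ?_, hne, ?_⟩
      · rw [hA, hAD]
        exact commutatorElement_mem_signedCommutators hb hd
      · have e : b⁻¹ * ⁅b, d⁆ * b = (b⁻¹ * d * b⁻¹⁻¹ * d⁻¹)⁻¹ := by
          simp only [commutatorElement_def]; group
        rw [e]
        refine inv_mem (Subgroup.subset_closure ?_)
        rw [hA, hAD]
        exact ⟨b, hb, d, hd, b⁻¹, d, Or.inr rfl, Or.inl rfl, rfl⟩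

/-- Pseudo-solvable groups acting with logarithms are solvable. -/
theorem LogAction.isSolvable_of_isPseudoSolvable {K : Type*} [Field K] [Algebra ℂ K]
    (S : LogAction Γ K) {G : Subgroup Γ} (hG : IsPseudoSolvable G) : Group.IsSolvable G := by
  obtain ⟨T, -, rfl, N, hN⟩ := hG
  -- Induction on `n = N - j`; for `j = N` both sets are trivial.
  have key : ∀ n j, j + n = N →
      Group.IsSolvable (Subgroup.closure (ghysSeq T (j + 1) ∪ ghysSeq T j)) := by
    intro n
    induction n with
    | zero =>
      intro j hj
      have h1 : Subgroup.closure (ghysSeq T (j + 1) ∪ ghysSeq T j) = ⊥ :=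
        (Subgroup.closure_eq_bot_iff).mpr
          (Set.union_subset (hN _ (by omega)) (hN _ (by omega)))
      refine Subgroup.isSolvable_of_forall_comm fun x hx y hy => ?_
      rw [h1, Subgroup.mem_bot] at hx hy
      rw [hx, hy]
    | succ n ih =>
      intro j hj
      refine Subgroup.isSolvable_of_le (Subgroup.closure_mono (Set.union_subset_union_left _
        Subgroup.subset_closure))
        (S.isSolvable_closure_of_tower (isCommutatorTower_ghysSeq T j) (ih (j + 1) (by omega)))
  exact Subgroup.isSolvable_of_le (Subgroup.closure_mono Set.subset_union_right) (key N 0 (by omega))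

end Ghys

/-! ### Logarithms of quotients -/

namespace UnipotentAction

variable {Γ K : Type*} [Group Γ] [Field K] [Algebra ℂ K] (S : UnipotentAction Γ K)

/-- `x` is the derivative at the origin of the orbit of `f`. -/
def HasLog (g : Γ) (f x : K) : Prop :=
  ∀ m P, S.Interpolates g f m P → x - P.coeff 1 ∈ S.F m

theorem HasLog.sub_logSum_mem {S : UnipotentAction Γ K} {g : Γ} {f x : K} (h : S.HasLog g f x)
    {n : ℤ} (N : ℕ) (hf : f ∈ S.F n) : x - logSum (S.act g) N f ∈ S.F (n + N) := by
  rw [← interp_coeff_one]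
  exact h _ _ (S.interpolates_interp g hf N)

theorem hasLog_of_forall_exists {g : Γ} {f x : K} {a : ℤ} (hf : f ∈ S.F a)
    (h : ∀ N : ℕ, x - logSum (S.act g) N f ∈ S.F N) : S.HasLog g f x := by
  intro m P hP
  obtain ⟨N₁, h₁⟩ := Int.exists_nat_add_ge a m
  obtain ⟨N₂, h₂⟩ := Int.exists_nat_add_ge 0 m
  have e1 := Interpolates.coeff_sub_coeff_mem
    (fun n => S.anti (by push_cast; omega) (S.interpolates_interp g hf (N₁ + N₂) n)) hP 1
  have e2 := S.anti (by push_cast; omega : m ≤ ((N₁ + N₂ : ℕ) : ℤ)) (h (N₁ + N₂))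
  rw [interp_coeff_one] at e1
  have := (S.F m).add_mem e1 e2
  convert this using 1; ring

/-- Quotient rule, from the product rule for `r * q = p`. The logarithm of `r` is not yet known to
exist, so the first coefficient of an interpolating polynomial replaces it. -/
theorem HasLog.div {S : UnipotentAction Γ K} {g : Γ} {p q x y : K} (hp : S.HasLog g p x)
    (hq : S.HasLog g q y) (h0 : q ≠ 0) : S.HasLog g (p / q) ((x - p / q * y) / q) := by
  intro m P hP
  set r := p / q with hr
  obtain ⟨a, ha⟩ := S.exhaustive r
  obtain ⟨b, hb⟩ := S.exhaustive q
  obtain ⟨b', hb'⟩ := S.exhaustive q⁻¹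
  obtain ⟨a'', ha''⟩ := S.exhaustive y
  set c : ℤ := min (min a b) (min b' a'') with hc
  have hrc : r ∈ S.F c := S.anti (by omega) ha
  have hqc : q ∈ S.F c := S.anti (by omega) hb
  have hqc' : q⁻¹ ∈ S.F c := S.anti (by omega) hb'
  have hyc : y ∈ S.F c := S.anti (by omega) ha''
  set M' : ℤ := m - c with hM'
  set M : ℤ := max (max c (M' - c)) m with hM
  -- The bound `c` on the first coefficient must not depend on the precision `M`, which is fixed
  -- after it.
  obtain ⟨P', hP', hP'c⟩ : ∃ P', S.Interpolates g r M P' ∧ P'.coeff 1 ∈ S.F c := by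
    obtain ⟨N, hN⟩ := Int.exists_nat_add_ge a M
    refine ⟨_, fun n => S.anti hN (S.interpolates_interp g ha N n), ?_⟩
    rw [interp_coeff_one]
    exact Submodule.sum_mem _ fun k _ => Submodule.smul_mem _ _
      (S.anti (by omega) (S.delta_pow_mem g ha k))
  obtain ⟨Q, hQ⟩ := S.exists_interpolates g q M
  have hcM : c ≤ M := by omega
  have hmM : M' ≤ M + c := by omega
  have hPQ := hP'.mul hQ hcM hmM hrc hqc
  rw [hr, div_mul_cancel₀ p h0] at hPQ
  have h1 := hp _ _ hPQ
  rw [Polynomial.mul_coeff_one] at h1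
  have h2 := S.mul_sub_mul_mem hcM hmM hrc hyc hP'.coeff_zero_sub_mem (hq _ _ hQ)
  have h3 : P'.coeff 1 * (q - Q.coeff 0) + (x - r * y - P'.coeff 1 * q) ∈ S.F M' := by
    have := (S.F M').sub_mem h1 h2
    convert this using 1; ring
  have h4 : P'.coeff 1 * (q - Q.coeff 0) ∈ S.F M' := by
    have := S.mul_mem_F hQ.coeff_zero_sub_mem hP'c
    rw [mul_comm] at this
    exact S.anti hmM this
  have h5 := (S.F M').sub_mem h3 h4
  rw [add_sub_cancel_left] at h5
  have h6 := S.anti (by omega : m ≤ M' + c) (S.mul_mem_F h5 hqc')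
  have h7 := Interpolates.coeff_sub_coeff_mem
    (fun n => S.anti (by omega : m ≤ M) (hP' n)) hP 1
  have := (S.F m).add_mem h6 h7
  convert this using 1
  field_simp
  ring

end UnipotentAction

/-! ### The field of fractions of the ring of formal power series -/

namespace FormalPlane

open MvPowerSeries

/-- The ring of formal power series in two variables. -/
abbrev Ring : Type := MvPowerSeries (Fin 2) ℂ

instance : IsDomain Ring := NoZeroDivisors.to_isDomain _

/-- The field of fractions of the ring of formal power series in two variables. -/
abbrev Frac : Type := FractionRing Ring

/-- All terms of `p` have degree at least `n`. -/
def OrdGE (p : Ring) (n : ℤ) : Prop := ∀ e : Fin 2 →₀ ℕ, (e.degree : ℤ) < n → coeff e p = 0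

theorem OrdGE.mono {p : Ring} {m n : ℤ} (h : OrdGE p n) (hmn : m ≤ n) : OrdGE p m :=
  fun e he => h e (he.trans_le hmn)

theorem OrdGE.add {p q : Ring} {n : ℤ} (hp : OrdGE p n) (hq : OrdGE q n) : OrdGE (p + q) n :=
  fun e he => by rw [map_add, hp e he, hq e he, add_zero]

theorem OrdGE.sub {p q : Ring} {n : ℤ} (hp : OrdGE p n) (hq : OrdGE q n) : OrdGE (p - q) n :=
  fun e he => by rw [map_sub, hp e he, hq e he, sub_zero]

theorem OrdGE.smul {p : Ring} {n : ℤ} (c : ℂ) (hp : OrdGE p n) : OrdGE (c • p) n :=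
  fun e he => by rw [coeff_smul, hp e he, mul_zero]

theorem ordGE_zero (n : ℤ) : OrdGE 0 n := fun _ _ => coeff_zero _

theorem ordGE_of_nonpos (p : Ring) {n : ℤ} (hn : n ≤ 0) : OrdGE p n := fun e he => by omega

theorem OrdGE.mul {p q : Ring} {m n : ℤ} (hp : OrdGE p m) (hq : OrdGE q n) :
    OrdGE (p * q) (m + n) := fun e he => by
  classical
  rw [coeff_mul]
  refine Finset.sum_eq_zero fun x hx => ?_
  have h1 : x.1.degree + x.2.degree = e.degree := by
    rw [← Finset.HasAntidiagonal.mem_antidiagonal.mp hx, map_add]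
  by_cases h : (x.1.degree : ℤ) < m
  · rw [hp _ h, zero_mul]
  · rw [hq _ (by omega), mul_zero]

theorem OrdGE.eq_zero {p : Ring} (h : ∀ n, OrdGE p n) : p = 0 := by
  ext e
  exact h (e.degree + 1) e (by omega)

/-- The order of a nonzero power series. -/
noncomputable def ord (p : Ring) : ℕ := p.order.toNat

theorem ordGE_iff {p : Ring} (h : p ≠ 0) {n : ℤ} : OrdGE p n ↔ n ≤ ord p := by
  have h1 := ne_zero_iff_order_finite.mp h
  constructor
  · intro hp
    obtain ⟨d, hd, hd'⟩ := exists_coeff_ne_zero_and_order h1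
    by_contra hlt
    refine hd (hp d ?_)
    rw [← h1] at hd'
    have : d.degree = ord p := by exact_mod_cast hd'
    omega
  · intro hn e he
    refine coeff_of_lt_order ?_
    rw [← h1]
    have : e.degree < ord p := by omega
    exact_mod_cast this

theorem ordGE_ord (p : Ring) : OrdGE p (ord p) := by
  by_cases h : p = 0
  · rw [h]; exact ordGE_zero _
  · exact (ordGE_iff h).mpr le_rfl

theorem ord_mul {p q : Ring} (hp : p ≠ 0) (hq : q ≠ 0) : ord (p * q) = ord p + ord q := by
  rw [ord, order_mul, ord, ord, ENat.toNat_add]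
  · rwa [Ne, order_eq_top_iff]
  · rwa [Ne, order_eq_top_iff]

/-- Additivity of the order permits cancellation; the filtration of a fraction is thus independent
of its representation. -/
theorem OrdGE.of_mul {p q : Ring} (hq : q ≠ 0) {n : ℤ} (h : OrdGE (p * q) (n + ord q)) :
    OrdGE p n := by
  by_cases hp : p = 0
  · rw [hp]; exact ordGE_zero _
  · rw [ordGE_iff (mul_ne_zero hp hq), ord_mul hp hq] at h
    rw [ordGE_iff hp]
    push_cast at h
    omega

theorem algebraMap_ne_zero {q : Ring} (hq : q ≠ 0) : algebraMap Ring Frac q ≠ 0 :=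
  (map_ne_zero_iff _ (IsFractionRing.injective Ring Frac)).mpr hq

theorem algebraMap_smul (c : ℂ) (p : Ring) :
    algebraMap Ring Frac (c • p) = c • algebraMap Ring Frac p := by
  rw [Algebra.algebraMap_eq_smul_one, smul_assoc, ← Algebra.algebraMap_eq_smul_one]

theorem exists_eq_div (x : Frac) :
    ∃ p q : Ring, q ≠ 0 ∧ x = algebraMap Ring Frac p / algebraMap Ring Frac q := by
  obtain ⟨p, q, hq, h⟩ := IsFractionRing.div_surjective Ring x
  exact ⟨p, q, nonZeroDivisors.ne_zero hq, h.symm⟩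

/-- The filtration of the field of fractions by the order of vanishing. -/
noncomputable def level (n : ℤ) : Submodule ℂ Frac where
  carrier := {x | ∃ p q : Ring, q ≠ 0 ∧ x = algebraMap Ring Frac p / algebraMap Ring Frac q ∧
    OrdGE p (ord q + n)}
  add_mem' := by
    rintro _ _ ⟨p, q, hq, rfl, hp⟩ ⟨p', q', hq', rfl, hp'⟩
    refine ⟨p * q' + q * p', q * q', mul_ne_zero hq hq', ?_, ?_⟩
    · rw [div_add_div _ _ (algebraMap_ne_zero hq) (algebraMap_ne_zero hq')]
      simp only [map_add, map_mul]
    · rw [ord_mul hq hq']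
      push_cast
      exact ((hp.mul (ordGE_ord q')).mono (by omega)).add (((ordGE_ord q).mul hp').mono (by omega))
  zero_mem' := ⟨0, 1, one_ne_zero, by simp, ordGE_zero _⟩
  smul_mem' := by
    rintro c _ ⟨p, q, hq, rfl, hp⟩
    refine ⟨c • p, q, hq, ?_, hp.smul c⟩
    rw [algebraMap_smul, smul_div_assoc]

theorem mem_level_iff {p q : Ring} (hq : q ≠ 0) {n : ℤ} :
    algebraMap Ring Frac p / algebraMap Ring Frac q ∈ level n ↔ OrdGE p (ord q + n) := by
  refine ⟨?_, fun h => ⟨p, q, hq, rfl, h⟩⟩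
  rintro ⟨p', q', hq', h, hp'⟩
  rw [div_eq_div_iff (algebraMap_ne_zero hq) (algebraMap_ne_zero hq'), ← map_mul, ← map_mul] at h
  have h2 := IsFractionRing.injective Ring Frac h
  refine OrdGE.of_mul hq' ?_
  rw [h2]
  exact (hp'.mul (ordGE_ord q)).mono (by omega)

theorem algebraMap_mem_level {p : Ring} {n : ℤ} :
    algebraMap Ring Frac p ∈ level n ↔ OrdGE p n := by
  have h : ord (1 : Ring) = 0 := by
    have := ord_mul (one_ne_zero (α := Ring)) one_ne_zero
    rw [mul_one] at this
    omega
  have := mem_level_iff (p := p) (one_ne_zero (α := Ring)) (n := n)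
  rwa [map_one, div_one, h, Nat.cast_zero, zero_add] at this

theorem level_anti : Antitone level := by
  rintro m n h _ ⟨p, q, hq, rfl, hp⟩
  exact ⟨p, q, hq, rfl, hp.mono (by omega)⟩

theorem level_exhaustive (x : Frac) : ∃ n, x ∈ level n := by
  obtain ⟨p, q, hq, rfl⟩ := exists_eq_div x
  exact ⟨-ord q, (mem_level_iff hq).mpr (ordGE_of_nonpos p (by omega))⟩

theorem level_separated (x : Frac) (h : ∀ n, x ∈ level n) : x = 0 := by
  obtain ⟨p, q, hq, rfl⟩ := exists_eq_div x
  have : p = 0 := OrdGE.eq_zero fun n => ((mem_level_iff hq).mp (h (n - ord q))).mono (by omega)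
  rw [this, map_zero, zero_div]

theorem mul_mem_level {m n : ℤ} {x y : Frac} (hx : x ∈ level m) (hy : y ∈ level n) :
    x * y ∈ level (m + n) := by
  obtain ⟨p, q, hq, rfl, hp⟩ := hx
  obtain ⟨p', q', hq', rfl, hp'⟩ := hy
  refine ⟨p * p', q * q', mul_ne_zero hq hq', by rw [map_mul, map_mul, div_mul_div_comm], ?_⟩
  rw [ord_mul hq hq']
  push_cast
  exact (hp.mul hp').mono (by omega)

/-- The automorphism of the field of fractions induced by one of the ring. -/
noncomputable abbrev extend : (Ring ≃ₐ[ℂ] Ring) →* (Frac ≃ₐ[ℂ] Frac) :=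
  IsFractionRing.fieldEquivOfAlgEquivHom ℂ Frac

theorem extend_algebraMap (φ : Ring ≃ₐ[ℂ] Ring) (p : Ring) :
    extend φ (algebraMap Ring Frac p) = algebraMap Ring Frac (φ p) :=
  IsFractionRing.fieldEquivOfAlgEquiv_algebraMap ℂ Frac Frac φ p

/-- An automorphism raising the order of `p` when replacing `p` by `φ p - p`. -/
def IsUnipotent (φ : Ring ≃ₐ[ℂ] Ring) : Prop := ∀ p n, OrdGE p n → OrdGE (φ p - p) (n + 1)

/-- Otherwise `q = φ q - (φ q - q)` would have order greater than its own. -/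
theorem IsUnipotent.ord_apply_le {φ : Ring ≃ₐ[ℂ] Ring} (hφ : IsUnipotent φ) {q : Ring}
    (hq : q ≠ 0) : ord (φ q) ≤ ord q := by
  by_contra h
  have h1 := ((ordGE_ord (φ q)).mono (by omega : (ord q : ℤ) + 1 ≤ ord (φ q))).sub
    (hφ q _ (ordGE_ord q))
  rw [sub_sub_cancel, ordGE_iff hq] at h1
  omega

theorem IsUnipotent.extend_sub_mem {φ : Ring ≃ₐ[ℂ] Ring} (hφ : IsUnipotent φ) {n : ℤ} {x : Frac}
    (hx : x ∈ level n) : extend φ x - x ∈ level (n + 1) := by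
  obtain ⟨p, q, hq, rfl, hp⟩ := hx
  have hφq : φ q ≠ 0 := (map_ne_zero_iff _ φ.injective).mpr hq
  refine ⟨φ p * q - φ q * p, φ q * q, mul_ne_zero hφq hq, ?_, ?_⟩
  · rw [map_div₀, extend_algebraMap, extend_algebraMap,
      div_sub_div _ _ (algebraMap_ne_zero hφq) (algebraMap_ne_zero hq)]
    simp only [map_sub, map_mul]
  · have e : φ p * q - φ q * p = (φ p - p) * q - (φ q - q) * p := by ring
    have h1 := hφ.ord_apply_le hq
    rw [ord_mul hφq hq, e]
    push_cast
    exact (((hφ p _ hp).mul (ordGE_ord q)).mono (by omega)).sub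
      (((hφ q _ (ordGE_ord q)).mul hp).mono (by omega))

/-! ### The action and its logarithms -/

/-- The action on the field of fractions given by unipotent automorphisms of the ring. -/
noncomputable def unipotentAction {Γ : Type*} [Group Γ] (ρ : Γ →* (Ring ≃ₐ[ℂ] Ring))
    (hinj : Function.Injective ρ) (huni : ∀ g, IsUnipotent (ρ g)) : UnipotentAction Γ Frac where
  act := extend.comp ρ
  injective := (IsFractionRing.fieldEquivOfAlgEquivHom_injective ℂ Ring ℂ Frac).comp hinj
  F := level
  anti := level_anti
  exhaustive := level_exhaustive
  separated := level_separated
  mul_mem_F := mul_mem_level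
  act_sub_mem g _ _ hf := (huni g).extend_sub_mem hf

/-- The first `N` terms of the logarithm of `φ` applied to `p`. -/
noncomputable def ringLogSum (φ : Ring ≃ₐ[ℂ] Ring) (N : ℕ) (p : Ring) : Ring :=
  ∑ k ∈ Finset.range N, (choosePoly k).coeff 1 • ((φ.toLinearMap - 1 : Module.End ℂ Ring) ^ k) p

theorem logSum_extend (φ : Ring ≃ₐ[ℂ] Ring) (N : ℕ) (p : Ring) :
    logSum (extend φ) N (algebraMap Ring Frac p) = algebraMap Ring Frac (ringLogSum φ N p) := by
  have h : ∀ k : ℕ, (((extend φ).toLinearMap - 1 : Module.End ℂ Frac) ^ k) (algebraMap Ring Frac p) =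
      algebraMap Ring Frac (((φ.toLinearMap - 1 : Module.End ℂ Ring) ^ k) p) := by
    intro k
    induction k with
    | zero => simp
    | succ k ih =>
      rw [pow_succ', pow_succ', Module.End.mul_apply, Module.End.mul_apply, ih]
      simp only [LinearMap.sub_apply, Module.End.one_apply, AlgEquiv.toLinearMap_apply, map_sub,
        extend_algebraMap]
  simp only [logSum, ringLogSum, map_sum, h, algebraMap_smul]

theorem IsUnipotent.ordGE_pow {φ : Ring ≃ₐ[ℂ] Ring} (hφ : IsUnipotent φ) (p : Ring) (k : ℕ) :
    OrdGE (((φ.toLinearMap - 1 : Module.End ℂ Ring) ^ k) p) k := by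
  induction k with
  | zero => exact ordGE_of_nonpos _ le_rfl
  | succ k ih =>
    rw [pow_succ', Module.End.mul_apply]
    push_cast
    exact hφ _ _ ih

theorem IsUnipotent.ringLogSum_sub {φ : Ring ≃ₐ[ℂ] Ring} (hφ : IsUnipotent φ) (p : Ring) {M N : ℕ}
    (h : N ≤ M) : OrdGE (ringLogSum φ M p - ringLogSum φ N p) N := by
  rw [ringLogSum, ringLogSum, ← Finset.sum_sdiff (Finset.range_mono h), add_sub_cancel_right]
  refine Finset.sum_induction _ (fun p => OrdGE p N) (fun _ _ => OrdGE.add) (ordGE_zero _)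
    fun k hk => ?_
  have hk' : N ≤ k := by simpa using (Finset.mem_sdiff.mp hk).2
  exact ((hφ.ordGE_pow p k).mono (by omega)).smul _

theorem IsUnipotent.exists_ringLog {φ : Ring ≃ₐ[ℂ] Ring} (hφ : IsUnipotent φ) (p : Ring) :
    ∃ l : Ring, ∀ N : ℕ, OrdGE (l - ringLogSum φ N p) N := by
  -- The coefficient at `e` is stationary from `N = e.degree + 1` on.
  obtain ⟨l, hl⟩ : ∃ l : Ring, ∀ e, coeff e l = coeff e (ringLogSum φ (e.degree + 1) p) :=
    ⟨fun e => coeff e (ringLogSum φ (e.degree + 1) p), fun _ => rfl⟩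
  refine ⟨l, fun N e he => ?_⟩
  have h1 := hφ.ringLogSum_sub p (show e.degree + 1 ≤ N by omega) e (by omega)
  rw [map_sub, sub_eq_zero] at h1
  rw [map_sub, h1, hl, sub_self]

theorem exists_hasLog {Γ : Type*} [Group Γ] (ρ : Γ →* (Ring ≃ₐ[ℂ] Ring))
    (hinj : Function.Injective ρ) (huni : ∀ g, IsUnipotent (ρ g)) (g : Γ) (x : Frac) :
    ∃ y, (unipotentAction ρ hinj huni).HasLog g x y := by
  have key : ∀ p : Ring, ∃ y, (unipotentAction ρ hinj huni).HasLog g (algebraMap Ring Frac p) y := by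
    intro p
    obtain ⟨l, hl⟩ := (huni g).exists_ringLog p
    refine ⟨algebraMap Ring Frac l, UnipotentAction.hasLog_of_forall_exists _ (a := 0)
      (algebraMap_mem_level.mpr (ordGE_of_nonpos p le_rfl)) fun N => ?_⟩
    have e : logSum ((unipotentAction ρ hinj huni).act g) N (algebraMap Ring Frac p) =
        algebraMap Ring Frac (ringLogSum (ρ g) N p) := logSum_extend (ρ g) N p
    rw [e, ← map_sub]
    exact algebraMap_mem_level.mpr (hl N)
  obtain ⟨p, q, hq, rfl⟩ := exists_eq_div x
  obtain ⟨y, hy⟩ := key p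
  obtain ⟨z, hz⟩ := key q
  exact ⟨_, hy.div hz (algebraMap_ne_zero hq)⟩

/-! ### Partial derivatives -/

theorem OrdGE.pderiv {p : Ring} {n : ℤ} (h : OrdGE p n) (i : Fin 2) :
    OrdGE (MvPowerSeries.pderiv ℂ i p) (n - 1) := fun e he => by
  rw [coeff_pderiv, h, zero_mul]
  rw [map_add, Finsupp.degree_single]
  push_cast
  omega

theorem exists_polynomial_ordGE (p : Ring) (N : ℕ) :
    ∃ P : MvPolynomial (Fin 2) ℂ, OrdGE (p - (P : Ring)) N := by
  refine ⟨truncTotal N p, fun e he => ?_⟩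
  rw [map_sub, MvPolynomial.coeff_coe, coeff_truncTotal _ (by omega), sub_self]

theorem ordGE_X (i : Fin 2) : OrdGE (X i) 1 := fun e he => by
  classical
  rw [coeff_X, if_neg]
  rintro rfl
  rw [Finsupp.degree_single] at he
  omega

theorem derivation_algebraMap {D : Derivation ℂ Frac Frac}
    (hD : ∀ n x, x ∈ level n → D x ∈ level (n + 1)) (p : Ring) :
    D (algebraMap Ring Frac p) =
      D (algebraMap Ring Frac (X 0)) * algebraMap Ring Frac (pderiv ℂ 0 p) +
      D (algebraMap Ring Frac (X 1)) * algebraMap Ring Frac (pderiv ℂ 1 p) := by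
  set u := D (algebraMap Ring Frac (X 0)) with hu
  set v := D (algebraMap Ring Frac (X 1)) with hv
  have hX : ∀ i, D (algebraMap Ring Frac (X i)) ∈ level 0 := fun i =>
    level_anti (by norm_num) (hD 1 _ (algebraMap_mem_level.mpr (ordGE_X i)))
  let L : Ring → Frac := fun p => D (algebraMap Ring Frac p) -
    (u * algebraMap Ring Frac (pderiv ℂ 0 p) + v * algebraMap Ring Frac (pderiv ℂ 1 p))
  have hadd : ∀ p q, L (p + q) = L p + L q := fun p q => by
    simp only [L, map_add]; ring
  have hmul : ∀ p q, L (p * q) = algebraMap Ring Frac p * L q + algebraMap Ring Frac q * L p :=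
    fun p q => by
      simp only [L, map_mul, Derivation.leibniz, smul_eq_mul, map_add]; ring
  have hpoly : ∀ P : MvPolynomial (Fin 2) ℂ, L (P : Ring) = 0 := by
    intro P
    induction P using MvPolynomial.induction_on with
    | C a =>
      have h1 : algebraMap Ring Frac (C a) = algebraMap ℂ Frac a := by
        rw [IsScalarTower.algebraMap_apply ℂ Ring Frac]; rfl
      simp only [L, MvPolynomial.coe_C, pderiv_C, map_zero, mul_zero, add_zero, sub_zero, h1,
        Derivation.map_algebraMap]
    | add P Q hP hQ => rw [MvPolynomial.coe_add, hadd, hP, hQ, add_zero]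
    | mul_X P i hP =>
      have h1 : L (X i) = 0 := by
        fin_cases i
        · simp [L, hu]
        · simp [L, hv]
      rw [MvPolynomial.coe_mul, MvPolynomial.coe_X, hmul, hP, h1, mul_zero, mul_zero, add_zero]
  -- The defect `L` loses at most one order, so it is continuous; it vanishes on the dense set of
  -- polynomials.
  have hsmall : ∀ (n : ℤ) (r : Ring), OrdGE r n → L r ∈ level (n - 1) := by
    intro n r hr
    have h2 : ∀ i, ∀ w ∈ level 0, w * algebraMap Ring Frac (pderiv ℂ i r) ∈ level (n - 1) := by
      intro i w hw
      have := mul_mem_level hw (algebraMap_mem_level.mpr (hr.pderiv i))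
      rwa [zero_add] at this
    exact Submodule.sub_mem _ (level_anti (by omega) (hD n _ (algebraMap_mem_level.mpr hr)))
      (Submodule.add_mem _ (h2 0 u (hX 0)) (h2 1 v (hX 1)))
  have : L p = 0 := by
    refine level_separated _ fun n => ?_
    obtain ⟨P, hP⟩ := exists_polynomial_ordGE p (n + 1).toNat
    have h3 := hsmall _ _ hP
    have h4 : L p = L (p - (P : Ring)) := by
      have := hadd (p - (P : Ring)) P
      rwa [sub_add_cancel, hpoly, add_zero] at this
    rw [h4]
    exact level_anti (by omega) h3
  exact sub_eq_zero.mp this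

/-- The partial derivative of a fraction. -/
noncomputable def fracDeriv (i : Fin 2) (x : Frac) : Frac :=
  (algebraMap Ring Frac (pderiv ℂ i (exists_eq_div x).choose) -
    x * algebraMap Ring Frac (pderiv ℂ i (exists_eq_div x).choose_spec.choose)) /
    algebraMap Ring Frac (exists_eq_div x).choose_spec.choose

/-- Independence of the representation is not needed: it suffices that one fraction serves both
partial derivatives. -/
theorem fracDeriv_spec (x : Frac) : ∃ p q : Ring, q ≠ 0 ∧
    x = algebraMap Ring Frac p / algebraMap Ring Frac q ∧
    ∀ i, fracDeriv i x = (algebraMap Ring Frac (pderiv ℂ i p) -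
      x * algebraMap Ring Frac (pderiv ℂ i q)) / algebraMap Ring Frac q :=
  ⟨_, _, (exists_eq_div x).choose_spec.choose_spec.1, (exists_eq_div x).choose_spec.choose_spec.2,
    fun _ => rfl⟩

theorem derivation_eq {D : Derivation ℂ Frac Frac}
    (hD : ∀ n x, x ∈ level n → D x ∈ level (n + 1)) (x : Frac) :
    D x = D (algebraMap Ring Frac (X 0)) * fracDeriv 0 x +
      D (algebraMap Ring Frac (X 1)) * fracDeriv 1 x := by
  obtain ⟨p, q, hq, hx, hf⟩ := fracDeriv_spec x
  simp only [hf]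
  have hq' := algebraMap_ne_zero hq
  have h1 : algebraMap Ring Frac p = x * algebraMap Ring Frac q := by
    conv_rhs => rw [hx]
    rw [div_mul_cancel₀ _ hq']
  have h2 := congrArg D h1
  rw [Derivation.leibniz, derivation_algebraMap hD p, derivation_algebraMap hD q, smul_eq_mul,
    smul_eq_mul] at h2
  field_simp
  linear_combination -h2

theorem coeff_X_mul_pderiv (i : Fin 2) (p : Ring) (e : Fin 2 →₀ ℕ) :
    coeff e (X i * pderiv ℂ i p) = e i * coeff e p := by
  classical
  rw [X, coeff_monomial_mul]
  split_ifs with h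
  · rw [coeff_pderiv, one_mul, tsub_add_cancel_of_le h]
    have h1 : 1 ≤ e i := by simpa using h i
    rw [mul_comm]
    congr 1
    rw [Finsupp.tsub_apply, Finsupp.single_eq_same, Nat.cast_sub h1]
    push_cast; ring
  · have h1 : e i = 0 := by
      by_contra h0
      refine h fun j => ?_
      by_cases hj : j = i
      · subst hj; simpa using Nat.one_le_iff_ne_zero.mpr h0
      · rw [Finsupp.single_eq_of_ne hj]; exact Nat.zero_le _
    rw [h1]; simp

theorem coeff_add_mul_of_forall_lt {p q : Ring} {d e : Fin 2 →₀ ℕ}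
    (hp : ∀ x, toLex x < toLex d → coeff x p = 0) (hq : ∀ x, toLex x < toLex e → coeff x q = 0) :
    coeff (d + e) (p * q) = coeff d p * coeff e q := by
  classical
  rw [coeff_mul, Finset.sum_eq_single_of_mem ⟨d, e⟩ (by simp)]
  rintro ⟨u, v⟩ h h'
  simp only [Finset.HasAntidiagonal.mem_antidiagonal] at h
  rcases trichotomy_of_add_eq_add (congrArg toLex h) with h'' | h'' | h''
  · exact False.elim (h' (by simp [h''.1, h''.2]))
  · rw [hp u h'', zero_mul]
  · rw [hq v h'', mul_zero]

/-- The lexicographically smallest exponent of a nonzero power series. -/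
theorem exists_lex_min {p : Ring} (hp : p ≠ 0) :
    ∃ d, coeff d p ≠ 0 ∧ ∀ x, toLex x < toLex d → coeff x p = 0 := by
  obtain ⟨d, hd⟩ := exists_finsupp_eq_lexOrder_of_ne_zero hp
  refine ⟨d, coeff_ne_zero_of_lexOrder hd.symm, fun x hx => coeff_eq_zero_of_lt_lexOrder ?_⟩
  rw [hd]
  exact_mod_cast hx

/-- Multiplication by `X i` turns `∂ᵢ` into an operator diagonal on monomials. Comparing lowest
terms gives `(d i - e i) p_d q_e = 0`. -/
theorem lex_min_eq {p q : Ring} (h : ∀ i, pderiv ℂ i p * q = p * pderiv ℂ i q) {d e : Fin 2 →₀ ℕ}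
    (hd : coeff d p ≠ 0) (hd' : ∀ x, toLex x < toLex d → coeff x p = 0)
    (he : coeff e q ≠ 0) (he' : ∀ x, toLex x < toLex e → coeff x q = 0) : d = e := by
  ext i
  have h1 : X i * pderiv ℂ i p * q = p * (X i * pderiv ℂ i q) := by
    rw [mul_assoc, h i]; ring
  have h2 := congrArg (coeff (d + e)) h1
  rw [coeff_add_mul_of_forall_lt (fun x hx => by rw [coeff_X_mul_pderiv, hd' x hx, mul_zero]) he',
    coeff_add_mul_of_forall_lt hd' (fun x hx => by rw [coeff_X_mul_pderiv, he' x hx, mul_zero]),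
    coeff_X_mul_pderiv, coeff_X_mul_pderiv] at h2
  have h3 : ((d i : ℂ) - e i) * (coeff d p * coeff e q) = 0 := by linear_combination h2
  have h4 := (mul_eq_zero.mp h3).resolve_right (mul_ne_zero hd he)
  exact_mod_cast sub_eq_zero.mp h4

theorem exists_eq_smul_of_pderiv {p q : Ring} (hq : q ≠ 0)
    (h : ∀ i, pderiv ℂ i p * q = p * pderiv ℂ i q) : ∃ c : ℂ, p = c • q := by
  obtain ⟨e, he, he'⟩ := exists_lex_min hq
  -- This `c` kills the coefficient of `p - c q` at `e`; were the difference nonzero, `lex_min_eq`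
  -- would make `e` its lowest exponent.
  refine ⟨coeff e p / coeff e q, ?_⟩
  by_contra hne
  obtain ⟨d, hd, hd'⟩ := exists_lex_min (sub_ne_zero.mpr hne)
  have hde : d = e := by
    refine lex_min_eq (fun i => ?_) hd hd' he he'
    rw [map_sub, Derivation.map_smul, sub_mul, sub_mul, h i, smul_mul_assoc, smul_mul_assoc,
      mul_comm (pderiv ℂ i q)]
  rw [hde] at hd
  refine hd ?_
  rw [map_sub, coeff_smul, div_mul_cancel₀ _ he, sub_self]

theorem mem_range_of_fracDeriv_eq_zero {x : Frac} (h : ∀ i, fracDeriv i x = 0) :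
    x ∈ Set.range (algebraMap ℂ Frac) := by
  obtain ⟨p, q, hq, hx, hf⟩ := fracDeriv_spec x
  simp only [hf] at h
  have hq' := algebraMap_ne_zero hq
  obtain ⟨c, hc⟩ := exists_eq_smul_of_pderiv (p := p) hq fun i => by
    have h1 := (div_eq_zero_iff.mp (h i)).resolve_right hq'
    refine IsFractionRing.injective Ring Frac ?_
    rw [map_mul, map_mul, sub_eq_zero.mp h1]
    conv_lhs => rw [hx]
    field_simp
  refine ⟨c, ?_⟩
  rw [hx, hc, algebraMap_smul, smul_div_assoc, div_self hq', Algebra.algebraMap_eq_smul_one]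

/-- The action with logarithms given by unipotent automorphisms of the ring of power series. -/
noncomputable def logAction {Γ : Type*} [Group Γ] (ρ : Γ →* (Ring ≃ₐ[ℂ] Ring))
    (hinj : Function.Injective ρ) (huni : ∀ g, IsUnipotent (ρ g)) : LogAction Γ Frac where
  toUnipotentAction := unipotentAction ρ hinj huni
  exists_log g x := by
    obtain ⟨y, hy⟩ := exists_hasLog ρ hinj huni g x
    exact ⟨y, fun n N hx => hy.sub_logSum_mem N hx⟩
  u := algebraMap Ring Frac (X 0)
  v := algebraMap Ring Frac (X 1)
  du := fracDeriv 0
  dv := fracDeriv 1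
  chain_rule _ hD x := derivation_eq hD x
  const_of_partials x h0 h1 := mem_range_of_fracDeriv_eq_zero fun i => by
    fin_cases i
    · exact h0
    · exact h1

end FormalPlane

namespace FormalPlane

open MvPowerSeries Asymptotics Filter

/-! ### Polynomials of high order -/

/-- A point of `ℂ × ℂ` as a vector. -/
def vec (z : ℂ × ℂ) : Fin 2 → ℂ := ![z.1, z.2]

theorem vec_zero : vec 0 = 0 := by ext i; fin_cases i <;> rfl

theorem vec_injective : Function.Injective vec := fun _ _ h =>
  Prod.ext (congrFun h 0) (congrFun h 1)

theorem norm_vec_le (z : ℂ × ℂ) (i : Fin 2) : ‖vec z i‖ ≤ ‖z‖ := by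
  fin_cases i
  · exact norm_fst_le z
  · exact norm_snd_le z

theorem analyticAt_vec {f : ℂ × ℂ → ℂ × ℂ} {z : ℂ × ℂ} (hf : AnalyticAt ℂ f z) (i : Fin 2) :
    AnalyticAt ℂ (fun z => vec (f z) i) z := by
  fin_cases i
  · exact (ContinuousLinearMap.fst ℂ ℂ ℂ).analyticAt _ |>.comp hf
  · exact (ContinuousLinearMap.snd ℂ ℂ ℂ).analyticAt _ |>.comp hf

/-- The value of a polynomial at a point of `ℂ × ℂ`. -/
noncomputable abbrev evalAt (Q : MvPolynomial (Fin 2) ℂ) (z : ℂ × ℂ) : ℂ :=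
  MvPolynomial.eval (vec z) Q

theorem continuous_evalAt (Q : MvPolynomial (Fin 2) ℂ) : Continuous (evalAt Q) := by
  have : Continuous vec := continuous_pi fun i => by
    fin_cases i
    · exact continuous_fst
    · exact continuous_snd
  exact Q.continuous_eval.comp this

theorem coe_sub (Q Q' : MvPolynomial (Fin 2) ℂ) :
    ((Q - Q' : MvPolynomial (Fin 2) ℂ) : Ring) = (Q : Ring) - (Q' : Ring) := by
  ext e
  rw [map_sub, MvPolynomial.coeff_coe, MvPolynomial.coeff_sub, MvPolynomial.coeff_coe,
    MvPolynomial.coeff_coe]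

theorem isBigO_norm_pow {m n : ℕ} (h : n ≤ m) :
    (fun z : ℂ × ℂ => ‖z‖ ^ m) =O[nhds 0] fun z => ‖z‖ ^ n := by
  refine IsBigO.of_bound 1 ?_
  filter_upwards [Metric.ball_mem_nhds (0 : ℂ × ℂ) one_pos] with z hz
  rw [one_mul, norm_pow, norm_pow, norm_norm]
  exact pow_le_pow_of_le_one (norm_nonneg _) (mem_ball_zero_iff.mp hz).le h

theorem isBigO_evalAt {Q : MvPolynomial (Fin 2) ℂ} {N : ℕ} (h : OrdGE (Q : Ring) N) :
    evalAt Q =O[nhds 0] fun z => ‖z‖ ^ N := by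
  have e : evalAt Q = fun z => ∑ d ∈ Q.support, Q.coeff d * ∏ i, vec z i ^ d i := by
    ext z; exact MvPolynomial.eval_eq' _ _
  rw [e]
  refine IsBigO.fun_sum fun d hd => IsBigO.const_mul_left ?_ _
  have hd' : N ≤ d.degree := by
    by_contra hlt
    refine MvPolynomial.mem_support_iff.mp hd ?_
    rw [← MvPolynomial.coeff_coe]
    exact h d (by omega)
  refine IsBigO.trans (IsBigO.of_bound 1 (Eventually.of_forall fun z => ?_)) (isBigO_norm_pow hd')
  rw [one_mul, norm_pow, norm_norm, norm_prod, Finsupp.degree_eq_sum, ← Finset.prod_pow_eq_pow_sum]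
  refine Finset.prod_le_prod (fun _ _ => norm_nonneg _) fun i _ => ?_
  rw [norm_pow]
  exact pow_le_pow_left₀ (norm_nonneg _) (norm_vec_le z i) _

/-- The limit at the origin kills the constant term, and one divides by `t`, whence the punctured
neighbourhood. -/
theorem coeff_eq_zero_of_isBigO (N : ℕ) : ∀ q : Polynomial ℂ,
    ((fun t => q.eval t) =O[nhdsWithin 0 {0}ᶜ] fun t : ℂ => t ^ N) → ∀ k < N, q.coeff k = 0 := by
  induction N with
  | zero => intro q _ k hk; omega
  | succ N ih =>
    intro q hq
    have h0 : q.coeff 0 = 0 := by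
      have h1 : Tendsto (fun t : ℂ => t ^ (N + 1)) (nhdsWithin 0 {0}ᶜ) (nhds 0) := by
        have : Continuous fun t : ℂ => t ^ (N + 1) := by fun_prop
        simpa using this.continuousAt.tendsto.mono_left (nhdsWithin_le_nhds (a := 0))
      have h2 := hq.trans_tendsto h1
      have h3 : Tendsto (fun t => q.eval t) (nhdsWithin 0 {0}ᶜ) (nhds (q.eval 0)) :=
        q.continuous.continuousAt.tendsto.mono_left nhdsWithin_le_nhds
      rw [Polynomial.coeff_zero_eq_eval_zero]
      exact tendsto_nhds_unique h3 h2
    have hdiv : ∀ t, q.eval t = t * q.divX.eval t := fun t => by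
      conv_lhs => rw [← q.divX_mul_X_add, h0]
      simp [mul_comm]
    have h4 := ih q.divX (by
      obtain ⟨c, hc⟩ := hq.bound
      refine IsBigO.of_bound c ?_
      filter_upwards [hc, self_mem_nhdsWithin] with t ht ht0
      have ht0' : 0 < ‖t‖ := norm_pos_iff.mpr ht0
      rw [hdiv, norm_mul, pow_succ', norm_mul] at ht
      refine le_of_mul_le_mul_left ?_ ht0'
      linarith [ht, mul_left_comm c ‖t‖ ‖t ^ N‖])
    intro k hk
    cases k with
    | zero => exact h0
    | succ k => rw [← Polynomial.coeff_divX]; exact h4 k (by omega)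

theorem ordGE_of_isBigO {Q : MvPolynomial (Fin 2) ℂ} {N : ℕ}
    (h : evalAt Q =O[nhds 0] fun z => ‖z‖ ^ N) : OrdGE (Q : Ring) N := by
  have hhom : ∀ (k : ℕ) (t : ℂ) (x : Fin 2 → ℂ),
      MvPolynomial.eval (t • x) (MvPolynomial.homogeneousComponent k Q) =
      t ^ k * MvPolynomial.eval x (MvPolynomial.homogeneousComponent k Q) := by
    intro k t x
    rw [MvPolynomial.eval_eq', MvPolynomial.eval_eq', Finset.mul_sum]
    refine Finset.sum_congr rfl fun d hd => ?_
    have hdk : d.degree = k := by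
      by_contra hne
      refine MvPolynomial.mem_support_iff.mp hd ?_
      rw [MvPolynomial.coeff_homogeneousComponent, if_neg hne]
    rw [← hdk, Finsupp.degree_eq_sum, ← Finset.prod_pow_eq_pow_sum, mul_left_comm,
      ← Finset.prod_mul_distrib]
    simp only [Pi.smul_apply, smul_eq_mul, mul_pow]
  -- Restrict to the line `t ↦ t x`: the homogeneous components at `x` are the coefficients of a
  -- polynomial in `t`.
  have hcomp : ∀ k < N, MvPolynomial.homogeneousComponent k Q = 0 := by
    intro k hk
    refine MvPolynomial.funext fun x => ?_
    rw [map_zero]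
    set q : Polynomial ℂ := ∑ k ∈ Finset.range (Q.totalDegree + 1),
      Polynomial.C (MvPolynomial.eval x (MvPolynomial.homogeneousComponent k Q)) *
        Polynomial.X ^ k with hq
    have hqe : ∀ t, q.eval t = evalAt Q (t • (x 0, x 1)) := by
      intro t
      have e : vec (t • (x 0, x 1)) = t • x := by
        ext i; fin_cases i <;> rfl
      rw [evalAt, e]
      conv_rhs => rw [← MvPolynomial.sum_homogeneousComponent Q]
      rw [map_sum, hq, Polynomial.eval_finsetSum]
      refine Finset.sum_congr rfl fun k _ => ?_
      rw [hhom, Polynomial.eval_mul, Polynomial.eval_C, Polynomial.eval_pow, Polynomial.eval_X,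
        mul_comm]
    have hO : (fun t => q.eval t) =O[nhdsWithin 0 {0}ᶜ] fun t : ℂ => t ^ N := by
      have ht : Tendsto (fun t : ℂ => t • (x 0, x 1)) (nhdsWithin 0 {0}ᶜ) (nhds 0) := by
        have : Continuous fun t : ℂ => t • (x 0, x 1) := by fun_prop
        have h2 := this.continuousAt.tendsto.mono_left (nhdsWithin_le_nhds (a := (0 : ℂ)) (s := {0}ᶜ))
        rwa [zero_smul] at h2
      refine IsBigO.trans ((h.comp_tendsto ht).congr_left fun t => (hqe t).symm) ?_
      refine IsBigO.of_bound (‖(x 0, x 1)‖ ^ N) (Eventually.of_forall fun t => ?_)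
      simp only [Function.comp_apply]
      rw [norm_pow, norm_norm, norm_smul, mul_pow, norm_pow, mul_comm]
    have h5 := coeff_eq_zero_of_isBigO N q hO k hk
    rw [hq, Polynomial.finsetSum_coeff] at h5
    simp only [Polynomial.coeff_C_mul, Polynomial.coeff_X_pow, mul_ite, mul_one, mul_zero] at h5
    rw [Finset.sum_ite_eq] at h5
    split_ifs at h5 with hmem
    · exact h5
    · rw [MvPolynomial.homogeneousComponent_eq_zero _ _ (by simpa using hmem), map_zero]
  intro e he
  have h6 := congrArg (MvPolynomial.coeff e) (hcomp e.degree (by omega))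
  rw [MvPolynomial.coeff_homogeneousComponent, if_pos rfl, MvPolynomial.coeff_zero] at h6
  rw [MvPolynomial.coeff_coe, h6]

/-! ### Taylor series -/

/-- `P` is the asymptotic expansion of `f` at the origin. -/
def IsTaylor (f : ℂ × ℂ → ℂ) (P : Ring) : Prop :=
  ∀ N : ℕ, ∃ Q : MvPolynomial (Fin 2) ℂ, OrdGE (P - (Q : Ring)) N ∧
    (fun z => f z - evalAt Q z) =O[nhds 0] fun z => ‖z‖ ^ N

theorem IsTaylor.congr {f g : ℂ × ℂ → ℂ} {P : Ring} (h : IsTaylor f P) (hfg : f =ᶠ[nhds 0] g) :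
    IsTaylor g P := fun N => by
  obtain ⟨Q, hQ, hf⟩ := h N
  refine ⟨Q, hQ, hf.congr' ?_ EventuallyEq.rfl⟩
  filter_upwards [hfg] with z hz
  rw [hz]

theorem isTaylor_evalAt (Q : MvPolynomial (Fin 2) ℂ) : IsTaylor (evalAt Q) Q := fun N =>
  ⟨Q, by rw [sub_self]; exact ordGE_zero _, by simpa using isBigO_zero _ _⟩

theorem IsTaylor.sub {f g : ℂ × ℂ → ℂ} {P P' : Ring} (hf : IsTaylor f P) (hg : IsTaylor g P') :
    IsTaylor (fun z => f z - g z) (P - P') := fun N => by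
  obtain ⟨Q, hQ, hf⟩ := hf N
  obtain ⟨Q', hQ', hg⟩ := hg N
  refine ⟨Q - Q', ?_, ?_⟩
  · have e : P - P' - ((Q - Q' : MvPolynomial (Fin 2) ℂ) : Ring) = (P - Q) - (P' - Q') := by
      rw [coe_sub]; ring
    rw [e]
    exact hQ.sub hQ'
  · refine (hf.sub hg).congr_left fun z => ?_
    simp only [evalAt, map_sub]; ring

theorem IsTaylor.add {f g : ℂ × ℂ → ℂ} {P P' : Ring} (hf : IsTaylor f P) (hg : IsTaylor g P') :
    IsTaylor (fun z => f z + g z) (P + P') := fun N => by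
  obtain ⟨Q, hQ, hf⟩ := hf N
  obtain ⟨Q', hQ', hg⟩ := hg N
  refine ⟨Q + Q', ?_, ?_⟩
  · have e : P + P' - ((Q + Q' : MvPolynomial (Fin 2) ℂ) : Ring) = (P - Q) + (P' - Q') := by
      rw [MvPolynomial.coe_add]; ring
    rw [e]
    exact hQ.add hQ'
  · refine (hf.add hg).congr_left fun z => ?_
    simp only [evalAt, map_add]; ring

theorem IsTaylor.mul {f g : ℂ × ℂ → ℂ} {P P' : Ring} (hf : IsTaylor f P) (hg : IsTaylor g P') :
    IsTaylor (fun z => f z * g z) (P * P') := fun N => by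
  obtain ⟨Q, hQ, hf⟩ := hf N
  obtain ⟨Q', hQ', hg⟩ := hg N
  have hb : ∀ R : MvPolynomial (Fin 2) ℂ, evalAt R =O[nhds 0] fun _ => (1 : ℝ) := fun R =>
    (continuous_evalAt R).continuousAt.isBigO_one ℝ
  have hg1 : g =O[nhds 0] fun _ => (1 : ℝ) := by
    have h2 := (hg.trans (isBigO_norm_pow (Nat.zero_le N))).congr_right fun z => pow_zero _
    refine (h2.add (hb Q')).congr_left fun z => by ring
  refine ⟨Q * Q', ?_, ?_⟩
  · have e : P * P' - ((Q * Q' : MvPolynomial (Fin 2) ℂ) : Ring) =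
        (P - Q) * P' + (Q : Ring) * (P' - Q') := by
      rw [MvPolynomial.coe_mul]; ring
    rw [e]
    exact ((hQ.mul (ordGE_of_nonpos P' le_rfl)).mono (by omega)).add
      (((ordGE_of_nonpos (Q : Ring) le_rfl).mul hQ').mono (by omega))
  · have h1 := ((hf.mul hg1).congr_right fun z => mul_one _).add
      (((hb Q).mul hg).congr_right fun z => one_mul _)
    refine h1.congr_left fun z => ?_
    simp only [evalAt, map_mul]; ring

theorem IsTaylor.ordGE {f : ℂ × ℂ → ℂ} {P : Ring} (h : IsTaylor f P) {N : ℕ}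
    (hf : f =O[nhds 0] fun z => ‖z‖ ^ N) : OrdGE P N := by
  obtain ⟨Q, hQ, hfQ⟩ := h N
  have h1 : OrdGE (Q : Ring) N := ordGE_of_isBigO ((hf.sub hfQ).congr_left fun z => by ring)
  have := hQ.add h1
  rwa [sub_add_cancel] at this

theorem IsTaylor.isBigO {f : ℂ × ℂ → ℂ} {P : Ring} (h : IsTaylor f P) {N : ℕ} (hP : OrdGE P N) :
    f =O[nhds 0] fun z => ‖z‖ ^ N := by
  obtain ⟨Q, hQ, hfQ⟩ := h N
  have h1 : OrdGE (Q : Ring) N := by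
    have := hP.sub hQ
    rwa [sub_sub_cancel] at this
  exact (hfQ.add (isBigO_evalAt h1)).congr_left fun z => by ring

theorem IsTaylor.unique {f : ℂ × ℂ → ℂ} {P P' : Ring} (h : IsTaylor f P) (h' : IsTaylor f P') :
    P = P' := by
  refine sub_eq_zero.mp (OrdGE.eq_zero fun n => OrdGE.mono ?_ (Int.self_le_toNat n))
  refine (h.sub h').ordGE ?_
  simpa using isBigO_zero _ _

theorem IsTaylor.constantCoeff {f : ℂ × ℂ → ℂ} {P : Ring} (h : IsTaylor f P) :
    constantCoeff P = f 0 := by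
  obtain ⟨Q, hQ, hf⟩ := h 1
  have h1 := hQ 0 (by simp)
  obtain ⟨c, hc⟩ := hf.bound
  have h2 := hc.self_of_nhds
  simp only [norm_zero, pow_one, mul_zero, norm_le_zero_iff, evalAt, vec_zero,
    MvPolynomial.eval_zero] at h2
  rw [map_sub, sub_eq_zero, MvPolynomial.coeff_coe] at h1
  rw [sub_eq_zero.mp h2]
  exact h1

theorem ordGE_iff_le_order {p : Ring} {N : ℕ} : OrdGE p N ↔ (N : ℕ∞) ≤ p.order := by
  refine ⟨fun h => nat_le_order fun d hd => h d (by omega), fun h e he => ?_⟩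
  refine coeff_of_lt_order (lt_of_lt_of_le ?_ h)
  exact_mod_cast he

theorem OrdGE.subst {a : Fin 2 → Ring} (ha : ∀ i, MvPowerSeries.constantCoeff (a i) = 0) {p : Ring}
    {N : ℕ} (h : OrdGE p N) : OrdGE (subst a p) N := by
  rw [ordGE_iff_le_order] at h ⊢
  refine le_trans ?_ (le_order_subst (hasSubst_of_constantCoeff_zero ha) p)
  refine h.trans (le_mul_of_one_le_left zero_le (le_iInf fun i => ?_))
  exact one_le_order_iff_constCoeff_eq_zero.mpr (ha i)

/-- The Taylor series of a composition. -/
theorem IsTaylor.comp {f : ℂ × ℂ → ℂ} {P : Ring} {G : ℂ × ℂ → ℂ × ℂ} {a : Fin 2 → Ring}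
    (hf : IsTaylor f P) (hG : ∀ i, IsTaylor (fun z => vec (G z) i) (a i))
    (hG0 : G =O[nhds 0] fun z => ‖z‖) (ha : ∀ i, MvPowerSeries.constantCoeff (a i) = 0) :
    IsTaylor (fun z => f (G z)) (subst a P) := by
  have hpoly : ∀ Q : MvPolynomial (Fin 2) ℂ,
      IsTaylor (fun z => evalAt Q (G z)) (MvPolynomial.aeval a Q) := by
    intro Q
    induction Q using MvPolynomial.induction_on with
    | C c =>
      have := isTaylor_evalAt (MvPolynomial.C c)
      rw [MvPolynomial.coe_C] at this
      rw [MvPolynomial.aeval_C]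
      refine this.congr (Eventually.of_forall fun z => ?_)
      simp only [evalAt, MvPolynomial.eval_C]
    | add Q Q' h h' =>
      simp only [evalAt, map_add]
      exact h.add h'
    | mul_X Q i h =>
      simp only [evalAt, map_mul, MvPolynomial.eval_X, MvPolynomial.aeval_X]
      exact h.mul (hG i)
  intro N
  -- Approximate `f` by `Q`, then `Q ∘ G` by `Q'`; substitution of series without constant term does
  -- not lower the order of the error.
  obtain ⟨Q, hQ, hfQ⟩ := hf N
  obtain ⟨Q', hQ', hfQ'⟩ := hpoly Q N
  have hGt : Tendsto G (nhds 0) (nhds 0) :=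
    hG0.trans_tendsto (by simpa using (continuous_norm (E := ℂ × ℂ)).tendsto 0)
  have hs := hasSubst_of_constantCoeff_zero ha
  refine ⟨Q', ?_, ?_⟩
  · have h1 := (hQ.subst ha).add hQ'
    rw [subst_sub hs, subst_coe] at h1
    rwa [sub_add_sub_cancel] at h1
  · have h1 : (fun z => f (G z) - evalAt Q (G z)) =O[nhds 0] fun z => ‖z‖ ^ N :=
      (hfQ.comp_tendsto hGt).trans (hG0.norm_left.pow N)
    exact (h1.add hfQ').congr_left fun z => by ring

/-- Expand one argument at a time in the standard basis. -/
theorem exists_evalAt_eq {n : ℕ} (p : MultilinearMap ℂ (fun _ : Fin n => ℂ × ℂ) ℂ) :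
    ∃ Q, ∀ z, p (fun _ => z) = evalAt Q z := by
  induction n with
  | zero =>
    refine ⟨MvPolynomial.C (p fun _ => 0), fun z => ?_⟩
    rw [evalAt, MvPolynomial.eval_C]
    congr 1
    exact funext fun i => i.elim0
  | succ n ih =>
    obtain ⟨Q₁, h₁⟩ := ih (p.curryLeft (1, 0))
    obtain ⟨Q₂, h₂⟩ := ih (p.curryLeft (0, 1))
    refine ⟨MvPolynomial.X 0 * Q₁ + MvPolynomial.X 1 * Q₂, fun z => ?_⟩
    have e1 : p (fun _ => z) = p.curryLeft z (fun _ => z) := by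
      rw [MultilinearMap.curryLeft_apply]
      congr 1
      exact funext fun i => Fin.cases rfl (fun _ => rfl) i
    have e2 : z = z.1 • ((1, 0) : ℂ × ℂ) + z.2 • ((0, 1) : ℂ × ℂ) := by ext <;> simp
    have e3 : p.curryLeft z = z.1 • p.curryLeft (1, 0) + z.2 • p.curryLeft (0, 1) := by
      conv_lhs => rw [e2]
      rw [map_add, map_smul, map_smul]
    rw [e1, e3, add_apply, smul_apply, smul_apply, h₁, h₂]
    simp [evalAt, vec]

theorem exists_isTaylor {f : ℂ × ℂ → ℂ} (hf : AnalyticAt ℂ f 0) : ∃ P, IsTaylor f P := by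
  obtain ⟨p, hp⟩ := hf
  have hQ : ∀ N : ℕ, ∃ Q : MvPolynomial (Fin 2) ℂ,
      (fun z => f z - evalAt Q z) =O[nhds 0] fun z => ‖z‖ ^ N := by
    intro N
    choose Q hQ using fun k => exists_evalAt_eq (p k).toMultilinearMap
    refine ⟨∑ k ∈ Finset.range N, Q k, ?_⟩
    have h1 := hp.isBigO_sub_partialSum_pow N
    refine h1.congr_left fun z => ?_
    rw [zero_add, FormalMultilinearSeries.partialSum, evalAt, map_sum]
    congr 1
    exact Finset.sum_congr rfl fun k _ => hQ k z
  choose Q hQ using hQ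
  -- Each coefficient is read from an approximation one order finer than its degree; finer
  -- approximations agree with it there by `ordGE_of_isBigO`.
  obtain ⟨P, hP⟩ : ∃ P : Ring, ∀ e, coeff e P = (Q (e.degree + 1)).coeff e :=
    ⟨fun e => (Q (e.degree + 1)).coeff e, fun _ => rfl⟩
  refine ⟨P, fun N => ⟨Q N, fun e he => ?_, hQ N⟩⟩
  have h2 : OrdGE ((Q N - Q (e.degree + 1) : MvPolynomial (Fin 2) ℂ) : Ring)
      ((e.degree + 1 : ℕ) : ℤ) := by
    refine ordGE_of_isBigO ?_
    have h3 := (hQ N).trans (isBigO_norm_pow (by omega : e.degree + 1 ≤ N))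
    refine ((hQ (e.degree + 1)).sub h3).congr_left fun z => ?_
    simp only [evalAt, map_sub]; ring
  have h4 := h2 e (by push_cast; omega)
  rw [MvPolynomial.coeff_coe, MvPolynomial.coeff_sub] at h4
  rw [map_sub, hP, MvPolynomial.coeff_coe, ← neg_sub, h4, neg_zero]

/-- An analytic function with zero Taylor series vanishes near the origin. -/
theorem eventually_eq_zero_of_isTaylor {f : ℂ × ℂ → ℂ} (hf : AnalyticAt ℂ f 0)
    (h : IsTaylor f 0) : f =ᶠ[nhds 0] 0 := by
  obtain ⟨p, r, hp⟩ := hf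
  have hk : ∀ k z, p k (fun _ => z) = 0 := by
    intro k
    induction k using Nat.strong_induction_on with
    | _ k ih =>
      -- Once the lower terms vanish, the term of degree `k` is `O(‖z‖^(k+1))`, which forces it to
      -- be zero.
      refine IsBigO.continuousMultilinearMap_apply_eq_zero ?_
      have h1 := hp.hasFPowerSeriesAt.isBigO_sub_partialSum_pow (k + 1)
      have h2 := h.isBigO (ordGE_zero ((k + 1 : ℕ) : ℤ))
      refine (h2.sub h1).congr_left fun z => ?_
      rw [zero_add, FormalMultilinearSeries.partialSum, Finset.sum_range_succ,
        Finset.sum_eq_zero fun j hj => ih j (Finset.mem_range.mp hj) z]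
      ring
  filter_upwards [Metric.eball_mem_nhds (0 : ℂ × ℂ) hp.r_pos] with z hz
  have h3 := hp.hasSum hz
  simp only [hk, zero_add] at h3
  exact h3.unique hasSum_zero

end FormalPlane

namespace FormalPlane

open MvPowerSeries Asymptotics Filter

/-! ### The action of germs -/

theorem exists_series (γ : HolGerm) : ∃ a : Fin 2 → Ring, ∀ f : HolMap, (f : HolGerm) = γ →
    ∀ i, IsTaylor (fun z => vec (f.1 z) i) (a i) := by
  induction γ using Con.induction_on with
  | H f₀ =>
    choose a ha using fun i => exists_isTaylor (analyticAt_vec f₀.2.1 i)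
    refine ⟨a, fun f hf i => (ha i).congr ?_⟩
    filter_upwards [germCon.eq.mp hf] with z hz
    rw [hz]

/-- The Taylor series of the components of a germ. -/
noncomputable def series (γ : HolGerm) : Fin 2 → Ring := (exists_series γ).choose

theorem isTaylor_series (f : HolMap) (i : Fin 2) :
    IsTaylor (fun z => vec (f.1 z) i) (series f i) :=
  (exists_series f).choose_spec f rfl i

theorem constantCoeff_series (γ : HolGerm) (i : Fin 2) : constantCoeff (series γ i) = 0 := by
  induction γ using Con.induction_on with
  | H f => rw [(isTaylor_series f i).constantCoeff, f.2.2, vec_zero, Pi.zero_apply]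

theorem hasSubst_series (γ : HolGerm) : HasSubst (series γ) :=
  hasSubst_of_constantCoeff_zero (constantCoeff_series γ)

theorem isTaylor_coord (i : Fin 2) : IsTaylor (fun z => vec z i) (X i) := by
  have := isTaylor_evalAt (MvPolynomial.X i)
  rw [MvPolynomial.coe_X] at this
  refine this.congr (Eventually.of_forall fun z => ?_)
  simp only [evalAt, MvPolynomial.eval_X]

theorem series_one : series 1 = X := funext fun i => (isTaylor_series 1 i).unique (isTaylor_coord i)

theorem series_mul (γ δ : HolGerm) (i : Fin 2) :
    series (γ * δ) i = subst (series δ) (series γ i) := by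
  induction γ, δ using Con.induction_on₂ with
  | H f g =>
    refine (isTaylor_series (f * g) i).unique ((isTaylor_series f i).comp (isTaylor_series g) ?_
      (constantCoeff_series g))
    have h := g.2.1.differentiableAt.isBigO_sub
    have h0 : (g.1 : ℂ × ℂ → ℂ × ℂ) 0 = 0 := g.2.2
    simp only [h0, sub_zero] at h
    exact h.norm_right

/-- The pullback of formal power series by a germ. -/
noncomputable def pullback (γ : HolGerm) : Ring →ₐ[ℂ] Ring := substAlgHom (hasSubst_series γ)

theorem pullback_apply (γ : HolGerm) (p : Ring) : pullback γ p = subst (series γ) p :=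
  substAlgHom_apply _ p

theorem pullback_one : pullback 1 = AlgHom.id ℂ Ring := by
  ext1 p
  rw [pullback_apply, series_one, subst_self]
  rfl

theorem pullback_mul (γ δ : HolGerm) : pullback (γ * δ) = (pullback δ).comp (pullback γ) := by
  ext1 p
  have e : series (γ * δ) = fun i => subst (series δ) (series γ i) := funext (series_mul γ δ)
  rw [AlgHom.comp_apply, pullback_apply, pullback_apply, pullback_apply, e]
  exact (subst_comp_subst_apply (hasSubst_series γ) (hasSubst_series δ) p).symm

theorem eq_one_of_pullback {γ : HolGerm} (h : pullback γ = AlgHom.id ℂ Ring) : γ = 1 := by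
  have hX : ∀ i, series γ i = X i := fun i => by
    have h1 := congrArg (fun φ : Ring →ₐ[ℂ] Ring => φ (X i)) h
    rw [← subst_X (R := ℂ) (hasSubst_series γ) i, ← pullback_apply]
    exact h1
  induction γ using Con.induction_on with
  | H f =>
    refine germCon.eq.mpr ?_
    have key : ∀ i, (fun z => vec (f.1 z) i - vec z i) =ᶠ[nhds 0] 0 := fun i => by
      refine eventually_eq_zero_of_isTaylor
        ((analyticAt_vec f.2.1 i).sub (analyticAt_vec analyticAt_id i)) ?_
      have := (isTaylor_series f i).sub (isTaylor_coord i)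
      rwa [hX i, sub_self] at this
    filter_upwards [key 0, key 1] with z h0 h1
    refine vec_injective (funext fun i => ?_)
    fin_cases i
    · exact sub_eq_zero.mp h0
    · exact sub_eq_zero.mp h1

/-- The action of germs of diffeomorphisms on formal power series. -/
noncomputable def germAction : DiffGerm →* (Ring ≃ₐ[ℂ] Ring) where
  -- The inverse makes this a homomorphism, since pullback reverses products.
  toFun g := AlgEquiv.ofAlgHom (pullback (g⁻¹ : DiffGerm)) (pullback g)
    (by rw [← pullback_mul, Units.mul_inv, pullback_one])
    (by rw [← pullback_mul, Units.inv_mul, pullback_one])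
  map_one' := by
    ext1 p
    change pullback ((1⁻¹ : DiffGerm) : HolGerm) p = p
    rw [inv_one, Units.val_one, pullback_one]
    rfl
  map_mul' g h := by
    ext1 p
    change pullback (((g * h)⁻¹ : DiffGerm) : HolGerm) p =
      pullback ((g⁻¹ : DiffGerm) : HolGerm) (pullback ((h⁻¹ : DiffGerm) : HolGerm) p)
    rw [mul_inv_rev, Units.val_mul, pullback_mul, AlgHom.comp_apply]

theorem germAction_apply (g : DiffGerm) (p : Ring) :
    germAction g p = pullback ((g⁻¹ : DiffGerm) : HolGerm) p := rfl

theorem germAction_injective : Function.Injective germAction := by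
  rw [injective_iff_map_eq_one]
  intro g hg
  have h1 : pullback ((g⁻¹ : DiffGerm) : HolGerm) = AlgHom.id ℂ Ring := by
    ext1 p
    rw [← germAction_apply, hg]
    rfl
  exact inv_eq_one.mp (Units.ext (eq_one_of_pullback h1))

/-! ### Germs tangent to the identity act unipotently -/

theorem ordGE_series_sub {γ : HolGerm} (h : HolGerm.linearPart γ = 1) (i : Fin 2) :
    OrdGE (series γ i - X i) (2 : ℕ) := by
  induction γ using Con.induction_on with
  | H f =>
    have hf : fderiv ℂ (f.1 : ℂ × ℂ → ℂ × ℂ) 0 = 1 := h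
    refine ((isTaylor_series f i).sub (isTaylor_coord i)).ordGE ?_
    obtain ⟨p, hp⟩ := f.2.1
    have h1 : (fun z => (f.1 : ℂ × ℂ → ℂ × ℂ) z - z) =O[nhds 0] fun z => ‖z‖ ^ 2 := by
      refine (hp.isBigO_sub_partialSum_pow 2).congr_left fun z => ?_
      have h2 : p 1 (fun _ => z) = z := by
        have := congrArg (fun L : ℂ × ℂ →L[ℂ] ℂ × ℂ => L z) (hp.fderiv_eq.symm.trans hf)
        rw [show (fun _ : Fin 1 => z) = ![z] from funext fun i => by fin_cases i; rfl]
        simpa using this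
      rw [zero_add, FormalMultilinearSeries.partialSum, Finset.sum_range_succ,
        Finset.sum_range_one, hp.coeff_zero, h2]
      have h0 : (f.1 : ℂ × ℂ → ℂ × ℂ) 0 = 0 := f.2.2
      rw [h0, zero_add]
    refine IsBigO.trans (IsBigO.of_bound 1 (Eventually.of_forall fun z => ?_)) h1
    rw [one_mul]
    have e : vec (f.1 z) i - vec z i = vec ((f.1 : ℂ × ℂ → ℂ × ℂ) z - z) i := by
      fin_cases i <;> rfl
    rw [e]
    exact norm_vec_le _ i

theorem ordGE_pow_sub {p q : Ring} (hp : OrdGE p 1) (hq : OrdGE q 1) (h : OrdGE (p - q) 2) (n : ℕ) :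
    OrdGE (p ^ n) n ∧ OrdGE (q ^ n) n ∧ OrdGE (p ^ n - q ^ n) (n + 1) := by
  induction n with
  | zero =>
    refine ⟨ordGE_of_nonpos _ le_rfl, ordGE_of_nonpos _ le_rfl, ?_⟩
    rw [pow_zero, pow_zero, sub_self]
    exact ordGE_zero _
  | succ n ih =>
    obtain ⟨h1, h2, h3⟩ := ih
    push_cast
    refine ⟨by rw [pow_succ]; exact h1.mul hp, by rw [pow_succ]; exact h2.mul hq, ?_⟩
    have e : p ^ (n + 1) - q ^ (n + 1) = (p ^ n - q ^ n) * p + q ^ n * (p - q) := by ring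
    rw [e]
    exact ((h3.mul hp).mono (by omega)).add ((h2.mul h).mono (by omega))

/-- Modulo order `n + 1` the series is a polynomial, and in each monomial replacing `X i` by `a i`,
equal to it up to order two, gains one order. -/
theorem ordGE_subst_sub {a : Fin 2 → Ring} (ha : ∀ i, constantCoeff (a i) = 0)
    (h : ∀ i, OrdGE (a i - X i) 2) {p : Ring} {n : ℤ} (hp : OrdGE p n) :
    OrdGE (subst a p - p) (n + 1) := by
  have hs := hasSubst_of_constantCoeff_zero ha
  have ha1 : ∀ i, OrdGE (a i) 1 := fun i => by
    have := ((h i).mono (by norm_num : (1 : ℤ) ≤ 2)).add (ordGE_X i)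
    rwa [sub_add_cancel] at this
  obtain ⟨P, hP⟩ := exists_polynomial_ordGE p (n + 1).toNat
  have hP' := hP.mono (Int.self_le_toNat (n + 1))
  have hPn : OrdGE (P : Ring) n := by
    have := hp.sub (hP'.mono (by omega : n ≤ n + 1))
    rwa [sub_sub_cancel] at this
  have e : subst a p - p = subst a (p - (P : Ring)) - (p - (P : Ring)) +
      (subst a (P : Ring) - (P : Ring)) := by
    rw [subst_sub hs]; ring
  rw [e]
  refine (((hP.subst ha).mono (Int.self_le_toNat _)).sub hP').add ?_
  have hpoly : ∀ (b : Fin 2 → Ring), MvPolynomial.aeval b P =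
      ∑ d ∈ P.support, P.coeff d • (b 0 ^ d 0 * b 1 ^ d 1) := fun b => by
    rw [MvPolynomial.aeval_def, MvPolynomial.eval₂_eq']
    refine Finset.sum_congr rfl fun d _ => ?_
    rw [Fin.prod_univ_two, Algebra.smul_def]
  have hX : (P : Ring) = MvPolynomial.aeval (X : Fin 2 → Ring) P := by
    rw [← subst_coe, subst_self]; rfl
  have e2 : subst a (P : Ring) - (P : Ring) = ∑ d ∈ P.support,
      P.coeff d • (a 0 ^ d 0 * a 1 ^ d 1 - X 0 ^ d 0 * X 1 ^ d 1) := by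
    rw [subst_coe]
    conv_lhs => rw [hX]
    rw [hpoly, hpoly, ← Finset.sum_sub_distrib]
    exact Finset.sum_congr rfl fun d _ => (smul_sub _ _ _).symm
  rw [e2]
  refine Finset.sum_induction _ (fun p => OrdGE p (n + 1)) (fun _ _ => OrdGE.add) (ordGE_zero _)
    fun d hd => OrdGE.smul _ ?_
  have hd' : n ≤ d 0 + d 1 := by
    by_contra hlt
    refine MvPolynomial.mem_support_iff.mp hd ?_
    rw [← MvPolynomial.coeff_coe]
    refine hPn d ?_
    rw [Finsupp.degree_eq_sum, Fin.sum_univ_two]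
    push_cast
    omega
  obtain ⟨h1, -, h3⟩ := ordGE_pow_sub (ha1 0) (ordGE_X 0) (h 0) (d 0)
  obtain ⟨-, h2', h3'⟩ := ordGE_pow_sub (ha1 1) (ordGE_X 1) (h 1) (d 1)
  obtain ⟨h1', -, -⟩ := ordGE_pow_sub (ha1 1) (ordGE_X 1) (h 1) (d 1)
  have e3 : a 0 ^ d 0 * a 1 ^ d 1 - X 0 ^ d 0 * X 1 ^ d 1 =
      a 0 ^ d 0 * (a 1 ^ d 1 - X 1 ^ d 1) + (a 0 ^ d 0 - X 0 ^ d 0) * X 1 ^ d 1 := by ring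
  rw [e3]
  exact ((h1.mul h3').mono (by omega)).add ((h3.mul h2').mono (by omega))

theorem isUnipotent_germAction {g : DiffGerm} (hg : g ∈ tangentToIdentity) :
    IsUnipotent (germAction g) := by
  intro p n hp
  have h1 : HolGerm.linearPart ((g⁻¹ : DiffGerm) : HolGerm) = 1 := by
    have h2 := inv_mem hg
    rw [tangentToIdentity, MonoidHom.mem_ker] at h2
    exact congrArg Units.val h2
  rw [germAction_apply, pullback_apply]
  exact ordGE_subst_sub (constantCoeff_series _) (ordGE_series_sub h1) hp

end FormalPlane

/-! ### Passage to the group of germs tangent to the identity -/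

theorem image_signedCommutators {Γ Γ' : Type*} [Group Γ] [Group Γ'] (f : Γ →* Γ') (A B : Set Γ) :
    signedCommutators (f '' A) (f '' B) = f '' signedCommutators A B := by
  ext c
  constructor
  · rintro ⟨_, ⟨x, hx, rfl⟩, _, ⟨y, hy, rfl⟩, a, b, ha, hb, rfl⟩
    have lift : ∀ (z : Γ) (w : Γ'), w = f z ∨ w = (f z)⁻¹ → ∃ v, (v = z ∨ v = z⁻¹) ∧ f v = w := by
      rintro z w (rfl | rfl)
      · exact ⟨z, Or.inl rfl, rfl⟩
      · exact ⟨z⁻¹, Or.inr rfl, map_inv f z⟩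
    obtain ⟨a', ha', rfl⟩ := lift x a ha
    obtain ⟨b', hb', rfl⟩ := lift y b hb
    exact ⟨_, ⟨x, hx, y, hy, a', b', ha', hb', rfl⟩, by simp⟩
  · rintro ⟨_, ⟨x, hx, y, hy, a, b, ha, hb, rfl⟩, rfl⟩
    refine ⟨f x, ⟨x, hx, rfl⟩, f y, ⟨y, hy, rfl⟩, f a, f b, ?_, ?_, by simp⟩
    · rcases ha with rfl | rfl
      · exact Or.inl rfl
      · exact Or.inr (map_inv f x)
    · rcases hb with rfl | rfl
      · exact Or.inl rfl
      · exact Or.inr (map_inv f y)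

theorem image_ghysSeq {Γ Γ' : Type*} [Group Γ] [Group Γ'] (f : Γ →* Γ') (T : Set Γ) (j : ℕ) :
    ghysSeq (f '' T) j = f '' ghysSeq T j := by
  induction j using Nat.strong_induction_on with
  | _ j ih =>
    match j, ih with
    | 0, _ => rfl
    | 1, _ => exact image_signedCommutators f T T
    | j + 2, ih =>
      rw [ghysSeq, ghysSeq, ih (j + 1) (by omega), ih j (by omega), ← Set.image_union,
        image_signedCommutators]

/-- A pseudo-solvable subgroup remains so in a subgroup containing it. -/
theorem IsPseudoSolvable.subgroupOf {Γ : Type*} [Group Γ] {G H : Subgroup Γ}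
    (hG : IsPseudoSolvable G) (hGH : G ≤ H) : IsPseudoSolvable (G.subgroupOf H) := by
  obtain ⟨T, hT, rfl, N, hN⟩ := hG
  have hTH : T ⊆ H := fun x hx => hGH (Subgroup.subset_closure hx)
  have himage : H.subtype '' (Subtype.val ⁻¹' T) = T :=
    (Subtype.image_preimage_coe (H : Set Γ) T).trans (Set.inter_eq_right.mpr hTH)
  refine ⟨Subtype.val ⁻¹' T, hT.preimage Subtype.val_injective.injOn, ?_, N, fun j hj x hx => ?_⟩
  · apply Subgroup.map_injective H.subtype_injective
    rw [MonoidHom.map_closure, himage, Subgroup.subgroupOf_map_subtype, inf_eq_left.mpr hGH]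
  · have h1 : H.subtype x ∈ ghysSeq T j := by
      rw [← himage, image_ghysSeq]
      exact ⟨x, hx, rfl⟩
    exact Subtype.ext (hN j hj h1)

theorem mainTheorem2 (G : Subgroup DiffGerm) (hG : G ≤ tangentToIdentity)
    (hps : IsPseudoSolvable G) : Group.IsSolvable G := by
  -- Unipotence is available only for germs tangent to the identity, so `G` is first regarded as a
  -- subgroup of that group.
  have hsol : Group.IsSolvable (G.subgroupOf tangentToIdentity) :=
    (FormalPlane.logAction (FormalPlane.germAction.comp tangentToIdentity.subtype)
      (FormalPlane.germAction_injective.comp tangentToIdentity.subtype_injective)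
      fun g => FormalPlane.isUnipotent_germAction g.2).isSolvable_of_isPseudoSolvable
      (hps.subgroupOf hG)
  exact Group.isSolvable_of_isSolvable_injective
    (f := (Subgroup.subgroupOfEquivOfLe hG).symm.toMonoidHom)
    (Subgroup.subgroupOfEquivOfLe hG).symm.injective
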